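/- Conventions. Let $(M,g,K)$ be a smooth $4$-dimensional para-Kähler–Einstein (pKE) manifold: $g$ is a pseudo-Riemannian metric of signature $(+,+,-,-)$, $K$ an endomorphism of $TM$ with $K^2=\mathrm{id}$, with $\pm1$-eigenspaces of rank $2$, and with $g(KX,KY)=-g(X,Y)$; both eigendistributions of $K$ are integrable, $\rho(X,Y)=g(KX,Y)$ is closed, and the trace-free Ricci tensor of $g$ vanishes. An adapted coframe is a coframe $(\theta^1,\theta^2,\theta^3,\theta^4)$ with $g=2\theta^1\theta^3+2\theta^2\theta^4$ and $K=\theta^1\otimes\partial_{\theta^1}+\theta^2\otimes\partial_{\theta^2}-\theta^3\otimes\partial_{\theta^3}-\theta^4\otimes\partial_{\theta^4}$. Its Levi-Civita forms are $\Gamma^a{}_b$, with $d\theta^a=-\Gamma^a{}_b\wedge\theta^b$; its curvature is $d\Gamma^a{}_b+\Gamma^a{}_c\wedge\Gamma^c{}_b=\frac12R^a{}_{bcd}\theta^c\wedge\theta^d$, with $R_{ab}=R^c{}_{acb}$. With $C_{abcd}$ the components of the Weyl tensor, put $\Psi_0=C_{1414}$, $\Psi_1=C_{2414}$, $\Psi_2=-C_{1423}$,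 $\Psi_3=C_{1323}$, $\Psi_4=C_{2323}$ (the anti-self-dual part) and $\Psi_2'=C_{1234}$. For a pKE metric $\Psi_2'=-R/12$, and $\Psi_2'$ is assumed to be a non-zero constant. The anti-self-dual Weyl tensor has Petrov type III if at each point the binary quartic $\Psi_4\eta^4+4\Psi_3\eta^3\xi+6\Psi_2\eta^2\xi^2+4\Psi_1\eta\xi^3+\Psi_0\xi^4$ has one triple and one simple root in $\mathbb{RP}^1$. In that case, for adapted coframe fields with $\Psi_0=\Psi_1=\Psi_2=0$ and $\Psi_3\ne0$, $J_2$ denotes the coefficient of $\theta^3$ in $\Gamma^2{}_1$ (it depends only on the coframe at the point). Proposition. (a) Let $(M,g,K)$ be pKE of Petrov type III with $J_2\neq0$ everywhere, and let $c_3,c_2$ be non-zero constants. The adapted coframes with $\Psi_0=\Psi_1=\Psi_2=0$, $\Psi_3=c_3$, $J_2=c_2$ form a smooth line bundle $\mathcal F^5\to M$: the group $\mathbb R$, acting by $(\theta^1,\theta^2,\theta^3,\theta^4)\mapsto(\theta^1+t\theta^2,\theta^2,\theta^3,\theta^4-t\theta^3)$, is simply transitive on the fibres, and $\mathcal F^5$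 has smooth local sections. Every smooth local section satisfies $\Gamma^1{}_4=\Gamma^4{}_1=0$, \[d\theta^1=-\Gamma^1{}_1\wedge\theta^1-\Gamma^1{}_2\wedge\theta^2,\quad d\theta^2=-\Gamma^2{}_1\wedge\theta^1-\Gamma^2{}_2\wedge\theta^2,\quad d\theta^3=\Gamma^1{}_1\wedge\theta^3+\Gamma^2{}_1\wedge\theta^4,\quad d\theta^4=\Gamma^1{}_2\wedge\theta^3+\Gamma^2{}_2\wedge\theta^4,\] \[d\Gamma^1{}_1=-\Gamma^1{}_2\wedge\Gamma^2{}_1-2\Psi_2'\theta^1\wedge\theta^3-\Psi_3\theta^2\wedge\theta^3-\Psi_2'\theta^2\wedge\theta^4,\] \[d\Gamma^1{}_2=-\Gamma^1{}_1\wedge\Gamma^1{}_2-\Gamma^1{}_2\wedge\Gamma^2{}_2-\Psi_3\theta^1\wedge\theta^3-\Psi_2'\theta^1\wedge\theta^4-\Psi_4\theta^2\wedge\theta^3+\Psi_3\theta^2\wedge\theta^4,\] \[d\Gamma^2{}_1=\Gamma^1{}_1\wedge\Gamma^2{}_1+\Gamma^2{}_1\wedge\Gamma^2{}_2-\Psi_2'\theta^2\wedge\theta^3,\]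 \[d\Gamma^2{}_2=\Gamma^1{}_2\wedge\Gamma^2{}_1-\Psi_2'\theta^1\wedge\theta^3+\Psi_3\theta^2\wedge\theta^3-2\Psi_2'\theta^2\wedge\theta^4,\] where $\Psi_3=c_3$, and for some smooth functions $J_1,J_3,J_4,J_5,J_6$ and $J_2=c_2$ \[\Gamma^2{}_1=J_1\theta^2+J_2\theta^3,\quad \Gamma^1{}_1=-3J_1\theta^1+J_3\theta^2+J_4\theta^3+3J_2\theta^4,\quad \Gamma^2{}_2=-J_1\theta^1+J_5\theta^3+J_6\theta^2+J_2\theta^4.\] (b) Let $P\ne0$ be a constant, and let $U=U(y^1,y^3)$ and $W=W(y^3,y^4)$ be arbitrary smooth functions on open subsets of $\mathbb R^2$. Write $U_1=U_{y^1}$, $U_{11}=U_{y^1y^1}$, $W_3=W_{y^3}$, $W_{33}=W_{y^3y^3}$, $W_{34}=W_{y^3y^4}$, and $e_r=e^{r y^4}$. On the open set of $\mathbb R^4$ where $U$ and $W$ are defined, let \[\begin{aligned}\theta^1=&-\tfrac14\big(3e_{1/2}Py^1+y^2e_{1/2}P+6P^2y^1+2y^2e_1-2e_{1/2}W_3-P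W_3+e_1-U_1+U_{11}\big)e_{-2}\,dy^1+e_{-1}\,dy^2+\tfrac12e_{-3/2}\big(y^2e_{1/2}-2W_{34}\big)dy^4\\&-\tfrac14\big(6P^2y^1y^2e_{1/2}-9y^2e_1Py^1+e_1P(y^2)^2+9Py^1W_3e_{1/2}-2W_3Py^2e_{1/2}-6P^2y^1W_3+4y^2e_1W_3-2W_3^2e_{1/2}-U_1y^2e_{1/2}+U_{11}y^2e_{1/2}+W_3^2P-2(y^2)^2e_{3/2}-e_1W_3-4Ue_{1/2}+4W_{33}e_{1/2}+U_1W_3-W_3U_{11}+y^2e_{3/2}\big)e_{-2}\,dy^3,\\ \theta^2=&\;e_{-1/2}\,dy^1+\big(y^2-e_{-1/2}W_3\big)dy^3,\qquad \theta^3=e_1\,dy^3,\\ \theta^4=&\;(-Pe_{-1/2}-1)\,dy^1+\tfrac12\,dy^4+\Big(\tfrac32e_{-1/2}P^2y^1+\tfrac34e_{-1/2}W_3P-\tfrac14e_{-1/2}U_1+\tfrac14e_{-1/2}U_{11}-\tfrac12y^2e_{1/2}+\tfrac34Py^1-\tfrac34Py^2-\tfrac34e_{1/2}+\tfrac12W_3\Big)dy^3.\end{aligned}\]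 These forms are an adapted coframe of a pKE structure with $g=2\theta^1\theta^3+2\theta^2\theta^4$ and $\Psi_2'=P$, which has Petrov type III and $J_2\ne0$; in this coframe $\Psi_0=\Psi_1=\Psi_2=0$, $\Psi_3=J_2=1$, $J_1=0$, $J_6=-P$, and the connection forms have the form displayed in (a). -/

import Mathlib

open scoped Manifold ContDiff

noncomputable section

/-! ### Smooth objects on a `4`-manifold -/

/-- The model space of `4`-manifolds. -/
abbrev E4 : Type := EuclideanSpace ℝ (Fin 4)

section Basic

variable {M : Type*} [TopologicalSpace M] [ChartedSpace E4 M] [IsManifold 𝓘(ℝ, E4) ∞ M]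

/-- Smoothness of a real function on a set. -/
def SmoothFunOn (f : M → ℝ) (U : Set M) : Prop :=
  ContMDiffOn 𝓘(ℝ, E4) 𝓘(ℝ, ℝ) ∞ f U

/-- Smoothness of a vector field on a set. -/
def SmoothFieldOn (X : (x : M) → TangentSpace 𝓘(ℝ, E4) x) (U : Set M) : Prop :=
  ContMDiffOn 𝓘(ℝ, E4) (𝓘(ℝ, E4)).tangent ∞
    (fun x => (⟨x, X x⟩ : TangentBundle 𝓘(ℝ, E4) M)) U

/-- The derivative `X f` of a function along a vector field. -/
def derivAlong (X : (x : M) → TangentSpace 𝓘(ℝ, E4) x) (f : M → ℝ) (x : M) : ℝ :=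
  mfderiv 𝓘(ℝ, E4) 𝓘(ℝ, ℝ) f x (X x)

/-- The Lie bracket `[X, Y]`. -/
def bracket (X Y : (x : M) → TangentSpace 𝓘(ℝ, E4) x) (x : M) : TangentSpace 𝓘(ℝ, E4) x :=
  VectorField.mlieBracket 𝓘(ℝ, E4) X Y x

/-- The exterior derivative of a `1`-form:
`(dη)(X, Y) = X (η Y) - Y (η X) - η [X, Y]`. -/
def dOne (η : (x : M) → TangentSpace 𝓘(ℝ, E4) x →L[ℝ] ℝ)
    (X Y : (x : M) → TangentSpace 𝓘(ℝ, E4) x) (x : M) : ℝ :=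
  derivAlong X (fun z => η z (Y z)) x - derivAlong Y (fun z => η z (X z)) x
    - η x (bracket X Y x)

/-- The wedge product of two `1`-forms, evaluated on two vector fields. -/
def wedge (α β : (x : M) → TangentSpace 𝓘(ℝ, E4) x →L[ℝ] ℝ)
    (X Y : (x : M) → TangentSpace 𝓘(ℝ, E4) x) (x : M) : ℝ :=
  α x (X x) * β x (Y x) - α x (Y x) * β x (X x)

/-- A coframe at `x`, written as the isomorphism `v ↦ (θ¹ v, θ² v, θ³ v, θ⁴ v)`.
The indices `1, 2, 3, 4` are `0, 1, 2, 3` in the code;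
`(θ¹, θ², θ³, θ⁴) = (α¹, α², ᾱ¹, ᾱ²)`. -/
abbrev Coframe (x : M) : Type := TangentSpace 𝓘(ℝ, E4) x ≃L[ℝ] (Fin 4 → ℝ)

/-- The `1`-form `θᵃ` of a coframe field. -/
def theta (u : (x : M) → Coframe x) (a : Fin 4) (x : M) : TangentSpace 𝓘(ℝ, E4) x →L[ℝ] ℝ :=
  (ContinuousLinearMap.proj (R := ℝ) (φ := fun _ : Fin 4 => ℝ) a).comp
    (u x : TangentSpace 𝓘(ℝ, E4) x →L[ℝ] (Fin 4 → ℝ))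

/-- The vector field `∂/∂θᵃ` of the dual frame. -/
def dualFrame (u : (x : M) → Coframe x) (a : Fin 4) (x : M) : TangentSpace 𝓘(ℝ, E4) x :=
  (u x).symm (Pi.single a 1)

/-- A coframe field is smooth iff its dual frame consists of smooth vector fields. -/
def SmoothCoframeOn (u : (x : M) → Coframe x) (U : Set M) : Prop :=
  ∀ a, SmoothFieldOn (dualFrame u a) U

/-! ### Levi-Civita connection and curvature in a null coframe, `g = 2 θ¹ θ³ + 2 θ² θ⁴` -/

/-- The constant matrix `g_{ab}` in a null coframe; it is its own inverse. -/
def eta : Matrix (Fin 4) (Fin 4) ℝ :=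
  !![0, 0, 1, 0; 0, 0, 0, 1; 1, 0, 0, 0; 0, 1, 0, 0]

/-- The involution `1 ↔ 3`, `2 ↔ 4`, by which `g` lowers and raises indices in a null coframe. -/
def flip4 (a : Fin 4) : Fin 4 := ![2, 3, 0, 1] a

/-- Structure functions: `[∂_b, ∂_c] = Cᵃ_{bc} ∂_a`, that is `dθᵃ = - ½ Cᵃ_{bc} θᵇ ∧ θᶜ`. -/
def structFun (u : (x : M) → Coframe x) (a b c : Fin 4) (x : M) : ℝ :=
  theta u a x (bracket (dualFrame u b) (dualFrame u c) x)

/-- The component `Γᵃ_b(∂_c)` of the Levi-Civita connection in a null coframe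
(the Koszul formula).  `gammaCoef_torsionFree` and `gammaCoef_metric` below are the two
first structure equations, which determine it. -/
def gammaCoef (u : (x : M) → Coframe x) (a b c : Fin 4) (x : M) : ℝ :=
  (structFun u a c b x - structFun u (flip4 c) b (flip4 a) x
    + structFun u (flip4 b) (flip4 a) c x) / 2

/-- The Levi-Civita connection form `Γᵃ_b`. -/
def Gam (u : (x : M) → Coframe x) (a b : Fin 4) (x : M) : TangentSpace 𝓘(ℝ, E4) x →L[ℝ] ℝ :=
  ∑ c, gammaCoef u a b c x • theta u c x

/-- The curvature components `Rᵃ_{bcd}`: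
`dΓᵃ_b + Γᵃ_e ∧ Γᵉ_b = ½ Rᵃ_{bcd} θᶜ ∧ θᵈ`. -/
def riem (u : (x : M) → Coframe x) (a b c d : Fin 4) (x : M) : ℝ :=
  dOne (Gam u a b) (dualFrame u c) (dualFrame u d) x
    + ∑ e, wedge (Gam u a e) (Gam u e b) (dualFrame u c) (dualFrame u d) x

/-- Ricci tensor `R_{ab} = Rᶜ_{acb}`. -/
def ricci (u : (x : M) → Coframe x) (a b : Fin 4) (x : M) : ℝ :=
  ∑ c, riem u c a c b x

/-- Scalar curvature `R = R_{ab} gᵃᵇ`. -/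
def scal (u : (x : M) → Coframe x) (x : M) : ℝ :=
  ∑ a, ∑ b, eta a b * ricci u a b x

/-- Schouten tensor `P_{ab} = ½ R_{ab} - (1/12) R g_{ab}`. -/
def schouten (u : (x : M) → Coframe x) (a b : Fin 4) (x : M) : ℝ :=
  ricci u a b x / 2 - scal u x / 12 * eta a b

/-- Weyl tensor with all indices down, `C_{abcd} = g_{ae} Cᵉ_{bcd}`. -/
def weyl (u : (x : M) → Coframe x) (a b c d : Fin 4) (x : M) : ℝ :=
  (∑ e, eta a e * riem u e b c d x)
    + eta a d * schouten u c b x - eta a c * schouten u d b x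
    + eta b c * schouten u d a x - eta b d * schouten u c a x

/-- `Ψ₀ = C₁₄₁₄`. -/
def psi0 (u : (x : M) → Coframe x) (x : M) : ℝ := weyl u 0 3 0 3 x
/-- `Ψ₁ = C₂₄₁₄`. -/
def psi1 (u : (x : M) → Coframe x) (x : M) : ℝ := weyl u 1 3 0 3 x
/-- `Ψ₂ = - C₁₄₂₃`. -/
def psi2 (u : (x : M) → Coframe x) (x : M) : ℝ := - weyl u 0 3 1 2 x
/-- `Ψ₃ = C₁₃₂₃`. -/
def psi3 (u : (x : M) → Coframe x) (x : M) : ℝ := weyl u 0 2 1 2 x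
/-- `Ψ₄ = C₂₃₂₃`. -/
def psi4 (u : (x : M) → Coframe x) (x : M) : ℝ := weyl u 1 2 1 2 x
/-- `Ψ₂' = C₁₂₃₄`, the component of the self-dual Weyl tensor. -/
def psi2' (u : (x : M) → Coframe x) (x : M) : ℝ := weyl u 0 1 2 3 x

/-- The binary quartic `W(ξ⁰, ξ¹)` that represents the anti-self-dual Weyl tensor. -/
def weylQuartic (u : (x : M) → Coframe x) (x : M) (s t : ℝ) : ℝ :=
  psi4 u x * t ^ 4 + 4 * psi3 u x * (t ^ 3 * s) + 6 * psi2 u x * (t ^ 2 * s ^ 2)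
    + 4 * psi1 u x * (t * s ^ 3) + psi0 u x * s ^ 4

/-! ### Para-Kähler-Einstein structures on an open set `S` -/

/-- Almost para-Hermitian structure `(g, K)` on `S`.  A symmetric nondegenerate `g` with such
a `K` has signature `(+, +, -, -)`, because the eigenspaces of `K` are null planes.
Smoothness of `g` and `K` is tested on local smooth vector fields. -/
structure IsAlmostParaHermitian (S : Set M)
    (g : (x : M) → TangentSpace 𝓘(ℝ, E4) x →L[ℝ] TangentSpace 𝓘(ℝ, E4) x →L[ℝ] ℝ)
    (K : (x : M) → TangentSpace 𝓘(ℝ, E4) x →L[ℝ] TangentSpace 𝓘(ℝ, E4) x) : Prop where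
  smooth_g : ∀ U : Set M, IsOpen U → U ⊆ S → ∀ X Y : (x : M) → TangentSpace 𝓘(ℝ, E4) x,
    SmoothFieldOn X U → SmoothFieldOn Y U → SmoothFunOn (fun x => g x (X x) (Y x)) U
  smooth_K : ∀ U : Set M, IsOpen U → U ⊆ S → ∀ X : (x : M) → TangentSpace 𝓘(ℝ, E4) x,
    SmoothFieldOn X U → SmoothFieldOn (fun x => K x (X x)) U
  symm : ∀ x ∈ S, ∀ v w, g x v w = g x w v
  nondegenerate : ∀ x ∈ S, ∀ v, (∀ w, g x v w = 0) → v = 0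
  K_sq : ∀ x ∈ S, ∀ v, K x (K x v) = v
  rank_pos : ∀ x ∈ S, Module.finrank ℝ
    (Module.End.eigenspace (K x : TangentSpace 𝓘(ℝ, E4) x →ₗ[ℝ] TangentSpace 𝓘(ℝ, E4) x) 1) = 2
  rank_neg : ∀ x ∈ S, Module.finrank ℝ
    (Module.End.eigenspace (K x : TangentSpace 𝓘(ℝ, E4) x →ₗ[ℝ] TangentSpace 𝓘(ℝ, E4) x) (-1)) = 2
  compatible : ∀ x ∈ S, ∀ v w, g x (K x v) (K x w) = - g x v w

/-- Para-Kähler structure: the two eigendistributions of `K` are integrable and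
the `2`-form `ρ(X, Y) = g(K X, Y)` is closed. -/
structure IsParaKahler (S : Set M)
    (g : (x : M) → TangentSpace 𝓘(ℝ, E4) x →L[ℝ] TangentSpace 𝓘(ℝ, E4) x →L[ℝ] ℝ)
    (K : (x : M) → TangentSpace 𝓘(ℝ, E4) x →L[ℝ] TangentSpace 𝓘(ℝ, E4) x) : Prop
    extends IsAlmostParaHermitian S g K where
  integrable_pos : ∀ U : Set M, IsOpen U → U ⊆ S →
    ∀ X Y : (x : M) → TangentSpace 𝓘(ℝ, E4) x, SmoothFieldOn X U → SmoothFieldOn Y U →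
    (∀ x ∈ U, K x (X x) = X x) → (∀ x ∈ U, K x (Y x) = Y x) →
    ∀ x ∈ U, K x (bracket X Y x) = bracket X Y x
  integrable_neg : ∀ U : Set M, IsOpen U → U ⊆ S →
    ∀ X Y : (x : M) → TangentSpace 𝓘(ℝ, E4) x, SmoothFieldOn X U → SmoothFieldOn Y U →
    (∀ x ∈ U, K x (X x) = - X x) → (∀ x ∈ U, K x (Y x) = - Y x) →
    ∀ x ∈ U, K x (bracket X Y x) = - bracket X Y x
  closed : ∀ U : Set M, IsOpen U → U ⊆ S →
    ∀ X Y Z : (x : M) → TangentSpace 𝓘(ℝ, E4) x,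
    SmoothFieldOn X U → SmoothFieldOn Y U → SmoothFieldOn Z U → ∀ x ∈ U,
      derivAlong X (fun z => g z (K z (Y z)) (Z z)) x
        + derivAlong Y (fun z => g z (K z (Z z)) (X z)) x
        + derivAlong Z (fun z => g z (K z (X z)) (Y z)) x
        - g x (K x (bracket X Y x)) (Z x)
        - g x (K x (bracket Y Z x)) (X x)
        - g x (K x (bracket Z X x)) (Y x) = 0

/-- A coframe at `x` is adapted to `(g, K)` if `g = 2 θ¹ θ³ + 2 θ² θ⁴` and
`K = θ¹ ⊗ ∂₁ + θ² ⊗ ∂₂ - θ³ ⊗ ∂₃ - θ⁴ ⊗ ∂₄` at `x`. -/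
def IsAdaptedAt (g : (x : M) → TangentSpace 𝓘(ℝ, E4) x →L[ℝ] TangentSpace 𝓘(ℝ, E4) x →L[ℝ] ℝ)
    (K : (x : M) → TangentSpace 𝓘(ℝ, E4) x →L[ℝ] TangentSpace 𝓘(ℝ, E4) x)
    (x : M) (w : Coframe x) : Prop :=
  (∀ v v', g x v v' = w v 0 * w v' 2 + w v 2 * w v' 0 + w v 1 * w v' 3 + w v 3 * w v' 1) ∧
  (∀ v, w (K x v) = ![w v 0, w v 1, - w v 2, - w v 3])

/-- A smooth adapted coframe field on `U`. -/
def IsAdaptedOn (g : (x : M) → TangentSpace 𝓘(ℝ, E4) x →L[ℝ] TangentSpace 𝓘(ℝ, E4) x →L[ℝ] ℝ)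
    (K : (x : M) → TangentSpace 𝓘(ℝ, E4) x →L[ℝ] TangentSpace 𝓘(ℝ, E4) x)
    (U : Set M) (u : (x : M) → Coframe x) : Prop :=
  SmoothCoframeOn u U ∧ ∀ x ∈ U, IsAdaptedAt g K x (u x)

/-- Para-Kähler-Einstein structure on `S` with `Ψ₂' = P`, a nonzero constant
(so that the scalar curvature `-12 P` does not vanish). -/
structure IsPKE (S : Set M)
    (g : (x : M) → TangentSpace 𝓘(ℝ, E4) x →L[ℝ] TangentSpace 𝓘(ℝ, E4) x →L[ℝ] ℝ)
    (K : (x : M) → TangentSpace 𝓘(ℝ, E4) x →L[ℝ] TangentSpace 𝓘(ℝ, E4) x)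
    (P : ℝ) : Prop extends IsParaKahler S g K where
  einstein : ∀ U : Set M, IsOpen U → U ⊆ S → ∀ u : (x : M) → Coframe x, IsAdaptedOn g K U u →
    ∀ x ∈ U, ∀ a b, ricci u a b x - scal u x / 4 * eta a b = 0
  psi2'_eq : ∀ U : Set M, IsOpen U → U ⊆ S → ∀ u : (x : M) → Coframe x, IsAdaptedOn g K U u →
    ∀ x ∈ U, psi2' u x = P
  ne_zero : P ≠ 0

/-- The anti-self-dual Weyl tensor has Petrov type III at every point of `S`: the quartic has
one triple and one simple root, both real, in the projective line. -/
def IsPetrovIII (S : Set M)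
    (g : (x : M) → TangentSpace 𝓘(ℝ, E4) x →L[ℝ] TangentSpace 𝓘(ℝ, E4) x →L[ℝ] ℝ)
    (K : (x : M) → TangentSpace 𝓘(ℝ, E4) x →L[ℝ] TangentSpace 𝓘(ℝ, E4) x) : Prop :=
  ∀ U : Set M, IsOpen U → U ⊆ S → ∀ u : (x : M) → Coframe x, IsAdaptedOn g K U u →
    ∀ x ∈ U, ∃ a b c d : ℝ, a * d - b * c ≠ 0 ∧
      ∀ s t : ℝ, weylQuartic u x s t = (a * s + b * t) ^ 3 * (c * s + d * t)

/-! ### The reduced bundles -/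

/-- A smooth adapted coframe field on `U` that moves the triple root to zero:
`Ψ₀ = Ψ₁ = Ψ₂ = 0` and `Ψ₃ ≠ 0`. -/
def IsTripleRootAdaptedOn
    (g : (x : M) → TangentSpace 𝓘(ℝ, E4) x →L[ℝ] TangentSpace 𝓘(ℝ, E4) x →L[ℝ] ℝ)
    (K : (x : M) → TangentSpace 𝓘(ℝ, E4) x →L[ℝ] TangentSpace 𝓘(ℝ, E4) x)
    (U : Set M) (u : (x : M) → Coframe x) : Prop :=
  IsAdaptedOn g K U u ∧
    ∀ x ∈ U, psi0 u x = 0 ∧ psi1 u x = 0 ∧ psi2 u x = 0 ∧ psi3 u x ≠ 0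

/-- `J₂`, the coefficient of `θ³` in `Γ²₁`. -/
def Jtwo (u : (x : M) → Coframe x) (x : M) : ℝ := gammaCoef u 1 0 2 x

/-- The condition `J₂ ≠ 0`, for the coframe fields with `Ψ₀ = Ψ₁ = Ψ₂ = 0`, `Ψ₃ ≠ 0`. -/
def JtwoNonvanishing (S : Set M)
    (g : (x : M) → TangentSpace 𝓘(ℝ, E4) x →L[ℝ] TangentSpace 𝓘(ℝ, E4) x →L[ℝ] ℝ)
    (K : (x : M) → TangentSpace 𝓘(ℝ, E4) x →L[ℝ] TangentSpace 𝓘(ℝ, E4) x) : Prop :=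
  ∀ U : Set M, IsOpen U → U ⊆ S → ∀ u : (x : M) → Coframe x, IsTripleRootAdaptedOn g K U u →
    ∀ x ∈ U, Jtwo u x ≠ 0

/-- The fibre over `x` of `F⁵`: the adapted coframes at `x` with
`Ψ₀ = Ψ₁ = Ψ₂ = 0`, `Ψ₃ = c₃`, `J₂ = c₂` (`J₂` being taken along any local coframe field
with `Ψ₀ = Ψ₁ = Ψ₂ = 0`, `Ψ₃ ≠ 0` through the given coframe). -/
def normalizedFibre (S : Set M)
    (g : (x : M) → TangentSpace 𝓘(ℝ, E4) x →L[ℝ] TangentSpace 𝓘(ℝ, E4) x →L[ℝ] ℝ)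
    (K : (x : M) → TangentSpace 𝓘(ℝ, E4) x →L[ℝ] TangentSpace 𝓘(ℝ, E4) x)
    (c₃ c₂ : ℝ) (x : M) : Set (Coframe x) :=
  {w | ∃ U : Set M, IsOpen U ∧ x ∈ U ∧ U ⊆ S ∧ ∃ u : (x : M) → Coframe x,
    IsTripleRootAdaptedOn g K U u ∧ u x = w ∧ psi3 u x = c₃ ∧ Jtwo u x = c₂}

/-- The action on coframes of `A = (1 t; 0 1)`, the one-parameter group of the fibre
coordinate `a₁₂`: `(θ¹, θ², θ³, θ⁴) ↦ (θ¹ + t θ², θ², θ³, θ⁴ - t θ³)`. -/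
def shear (t : ℝ) (p : Fin 4 → ℝ) : Fin 4 → ℝ :=
  ![p 0 + t * p 1, p 1, p 2, p 3 - t * p 2]

/-- A family of sets of coframes is (the family of fibres of) a smooth line bundle over `S`,
with the group `{(1 t; 0 1)} ≅ ℝ` acting simply transitively on the fibres: around every point
there is a smooth coframe field `u` for which `(y, t) ↦ shear t ∘ u y` is a bijective
local trivialization. -/
def IsShearLineBundle (S : Set M) (F : (x : M) → Set (Coframe x)) : Prop :=
  ∀ x ∈ S, ∃ U : Set M, IsOpen U ∧ x ∈ U ∧ U ⊆ S ∧ ∃ u : (x : M) → Coframe x,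
    SmoothCoframeOn u U ∧
    (∀ y ∈ U, ∀ t : ℝ, ∃ w ∈ F y, ∀ v, w v = shear t (u y v)) ∧
    (∀ y ∈ U, ∀ w ∈ F y, ∃! t : ℝ, ∀ v, w v = shear t (u y v))

/-! ### The structure equations -/

/-- The structure equations of a para-Kähler-Einstein coframe, as equalities of `2`-forms
(evaluated on all pairs of vector fields of the dual frame): the first four are the first
structure equations, with the remaining connection forms `Γ¹₄`, `Γ⁴₁` equal to zero,
the last four express the curvature by `Ψ₂'`, `Ψ₀, …, Ψ₄`. -/
def StructureEquations (U : Set M) (u : (x : M) → Coframe x)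
    (G11 G12 G21 G22 : (x : M) → TangentSpace 𝓘(ℝ, E4) x →L[ℝ] ℝ)
    (p2' p0 p1 p2 p3 p4 : M → ℝ) : Prop :=
  ∀ x ∈ U, ∀ b c : Fin 4,
    let d := fun η => dOne η (dualFrame u b) (dualFrame u c) x
    let w := fun α β => wedge α β (dualFrame u b) (dualFrame u c) x
    let a1 := theta u 0
    let a2 := theta u 1
    let b1 := theta u 2
    let b2 := theta u 3
    d a1 = - w G11 a1 - w G12 a2 ∧
    d a2 = - w G21 a1 - w G22 a2 ∧
    d b1 = w G11 b1 + w G21 b2 ∧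
    d b2 = w G12 b1 + w G22 b2 ∧
    d G11 = - w G12 G21 + (-2 * p2' x - p2 x) * w a1 b1 + p1 x * w a1 b2
      - p3 x * w a2 b1 + (p2 x - p2' x) * w a2 b2 ∧
    d G12 = - w G11 G12 - w G12 G22 - p3 x * w a1 b1 + (p2 x - p2' x) * w a1 b2
      - p4 x * w a2 b1 + p3 x * w a2 b2 ∧
    d G21 = w G11 G21 + w G21 G22 + p1 x * w a1 b1 - p0 x * w a1 b2
      + (p2 x - p2' x) * w a2 b1 - p1 x * w a2 b2 ∧
    d G22 = w G12 G21 + (p2 x - p2' x) * w a1 b1 - p1 x * w a1 b2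
      + p3 x * w a2 b1 + (-2 * p2' x - p2 x) * w a2 b2

/-- The reduced form of the Levi-Civita connection forms on `U`. -/
def ReducedConnection (U : Set M) (u : (x : M) → Coframe x) (J1 J2 J3 J4 J5 J6 : M → ℝ) : Prop :=
  ∀ x ∈ U,
    Gam u 1 0 x = J1 x • theta u 1 x + J2 x • theta u 2 x ∧
    Gam u 0 0 x = (-3 * J1 x) • theta u 0 x + J3 x • theta u 1 x + J4 x • theta u 2 x
      + (3 * J2 x) • theta u 3 x ∧
    Gam u 1 1 x = (- J1 x) • theta u 0 x + J5 x • theta u 2 x + J6 x • theta u 1 x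
      + J2 x • theta u 3 x

/-! ### The connection is the Levi-Civita connection -/

set_option linter.unusedSectionVars false in
/-- Torsion-freeness `dθᵃ + Γᵃ_b ∧ θᵇ = 0`, in components. -/
theorem gammaCoef_torsionFree (u : (x : M) → Coframe x) (a b c : Fin 4) (x : M) :
    structFun u a b c x = gammaCoef u a c b x - gammaCoef u a b c x := by
  have h : ∀ a b c : Fin 4, structFun u a b c x = - structFun u a c b x := by
    intro a b c
    simp only [structFun, bracket]
    rw [VectorField.mlieBracket_swap_apply, map_neg]
  simp only [gammaCoef]
  linarith [h a b c, h (flip4 c) b (flip4 a), h (flip4 b) (flip4 a) c]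

set_option linter.unusedSectionVars false in
/-- Metricity `g_{ac} Γᶜ_b + g_{bc} Γᶜ_a = 0`, in components. -/
theorem gammaCoef_metric (u : (x : M) → Coframe x) (a b c : Fin 4) (x : M) :
    gammaCoef u (flip4 a) b c x + gammaCoef u (flip4 b) a c x = 0 := by
  have h : ∀ a b c : Fin 4, structFun u a b c x = - structFun u a c b x := by
    intro a b c
    simp only [structFun, bracket]
    rw [VectorField.mlieBracket_swap_apply, map_neg]
  have hf : ∀ a, flip4 (flip4 a) = a := by decide
  simp only [gammaCoef, hf]
  linarith [h (flip4 a) c b, h (flip4 c) b a, h (flip4 b) a c]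

end Basic

/-! ### The explicit coframe -/

/-- The coframe `(θ¹, θ², θ³, θ⁴)` at `y ∈ ℝ⁴`, evaluated on a tangent vector `v`;
`P = Ψ₂'`, `U = U(y¹, y³)`, `W = W(y³, y⁴)`. -/
def exampleForms (P : ℝ) (U W : ℝ → ℝ → ℝ) (y v : E4) : Fin 4 → ℝ :=
  let y1 := y 0
  let y2 := y 1
  let y3 := y 2
  let y4 := y 3
  let e := fun r : ℝ => Real.exp (r * y4)
  let U0 := U y1 y3
  let U1 := deriv (fun s => U s y3) y1
  let U11 := deriv (fun s => deriv (fun r => U r y3) s) y1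
  let W3 := deriv (fun s => W s y4) y3
  let W33 := deriv (fun s => deriv (fun r => W r y4) s) y3
  let W34 := deriv (fun t => deriv (fun s => W s t) y3) y4
  ![-(1 / 4) * (3 * e (1/2) * P * y1 + y2 * e (1/2) * P + 6 * P ^ 2 * y1 + 2 * y2 * e 1
        - 2 * e (1/2) * W3 - P * W3 + e 1 - U1 + U11) * e (-2) * v 0
      + e (-1) * v 1
      + (1 / 2) * e (-3/2) * (y2 * e (1/2) - 2 * W34) * v 3
      - (1 / 4) * (6 * P ^ 2 * y1 * y2 * e (1/2) - 9 * y2 * e 1 * P * y1 + e 1 * P * y2 ^ 2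
        + 9 * P * y1 * W3 * e (1/2) - 2 * W3 * P * y2 * e (1/2) - 6 * P ^ 2 * y1 * W3
        + 4 * y2 * e 1 * W3 - 2 * W3 ^ 2 * e (1/2) - U1 * y2 * e (1/2) + U11 * y2 * e (1/2)
        + W3 ^ 2 * P - 2 * y2 ^ 2 * e (3/2) - e 1 * W3
        - 4 * U0 * e (1/2) + 4 * W33 * e (1/2) + U1 * W3 - W3 * U11
        + y2 * e (3/2)) * e (-2) * v 2,
    e (-1/2) * v 0 + (y2 - e (-1/2) * W3) * v 2,
    e 1 * v 2,
    (-P * e (-1/2) - 1) * v 0 + (1 / 2) * v 3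
      + ((3 / 2) * e (-1/2) * P ^ 2 * y1 + (3 / 4) * e (-1/2) * W3 * P
        - (1 / 4) * e (-1/2) * U1 + (1 / 4) * e (-1/2) * U11 - (1 / 2) * y2 * e (1/2)
        + (3 / 4) * P * y1 - (3 / 4) * P * y2 - (3 / 4) * e (1/2) + (1 / 2) * W3) * v 2]

end

set_option linter.unusedSectionVars false

open scoped Manifold ContDiff

noncomputable section

/-! Part (a) is a reduction of the structure group GL(2,ℝ) of adapted coframes. Integrability of the
two eigendistributions and closedness of ρ are exactly what makes the Koszul expressions for Γ¹₄ and
Γ⁴₁ vanish (`IsParaKahler.isKahlerFrameOn`), so the connection is gl(2,ℝ)-valued. Pair symmetry then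
removes the θ¹∧θ² and θ³∧θ⁴ components of the curvature, and the Einstein condition expresses what
is left by Ψ₂' and Ψ₀, …, Ψ₄ (`IsKahlerFrameOn.riem_eq_psi`). These are the structure equations.

The quartic is intrinsic: it is g(V, R(V, A) A) for V in the +1 eigenspace and A the vector of the
−1 eigenspace orthogonal to V. Hence a change of coframe acts on it by linear substitution with
weight det⁻² (`IsParaChange.weylQuartic_eq`). The Hessian of a quartic with a triple and a simple
root is a non-zero multiple of the fourth power of the triple factor, so the triple root depends
smoothly on the point and can be moved to Ψ₀ = Ψ₁ = Ψ₂ = 0 (`IsPKE.exists_tripleRoot`). The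
remaining changes are triangular; with diagonal entries p, m they act by Ψ₃ ↦ (m/p) Ψ₃ and J₂ ↦ J₂/m
(`IsPKE.transMat_one_zero`, `IsPKE.Jtwo_change`). Prescribing Ψ₃ and J₂ therefore fixes p and m and
leaves the shears, which gives the line bundle.

The shape of the connection comes from the second Bianchi identity, which becomes algebraic wherever
the curvature components are constant. Constancy of Ω²₁ = −Ψ₂' θ²∧θ³ kills the θ¹ and θ⁴
coefficients of Γ²₁ (`IsPKE.gammaCoef_tripleRoot`). Constancy of Ω¹₁, once Ψ₃ is constant, ties two
coefficients of Γ¹₁ to those of Γ²₂ and Γ²₁ (`IsPKE.gammaCoef_psi3_const`). The structure equation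
for Γ²₁ with J₂ constant fixes the two coefficients of Γ²₂ (`IsPKE.gammaCoef_Jtwo_const`).

Part (b) takes the metric and endomorphism defined by the explicit coframe. Its structure functions
give Γ¹₁, Γ²₁, Γ²₂ in closed form, and the curvature forms Ω¹₁, Ω²₁, Ω²₂ already determine the Ricci
tensor and Ψ₀, …, Ψ₃. The conditions over all adapted coframes follow from the transformation laws
of part (a).

The calculus underneath rests on Lie brackets: symmetry of second derivatives and both Bianchi
identities are consequences of the Jacobi identity. -/

theorem minSmoothness_le_infty (n : ℕ∞) : minSmoothness ℝ (n : WithTop ℕ∞) ≤ ∞ := by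
  rw [minSmoothness_of_isRCLikeNormedField]
  exact WithTop.coe_le_coe.2 le_top

/-! ### Calculus of smooth functions, vector fields and Lie brackets on a 4-manifold. -/

section Calculus

variable {M : Type*} [TopologicalSpace M] [ChartedSpace E4 M] [IsManifold 𝓘(ℝ, E4) ∞ M]

/-- Vector fields, with no regularity imposed. -/
abbrev VField (M : Type*) [TopologicalSpace M] [ChartedSpace E4 M] : Type _ :=
  (x : M) → TangentSpace 𝓘(ℝ, E4) x

variable {U V : Set M} {f g : M → ℝ} {X Y Z : VField M} {x : M}

/-! ### Smooth functions and vector fields -/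

namespace SmoothFunOn

theorem mono (hf : SmoothFunOn f U) (h : V ⊆ U) : SmoothFunOn f V := ContMDiffOn.mono hf h

theorem congr (hf : SmoothFunOn f U) (h : ∀ x ∈ U, g x = f x) : SmoothFunOn g U :=
  ContMDiffOn.congr hf h

theorem const (c : ℝ) : SmoothFunOn (fun _ : M => c) U := contMDiffOn_const

theorem add (hf : SmoothFunOn f U) (hg : SmoothFunOn g U) :
    SmoothFunOn (fun x => f x + g x) U := ContMDiffOn.add hf hg

theorem sub (hf : SmoothFunOn f U) (hg : SmoothFunOn g U) :
    SmoothFunOn (fun x => f x - g x) U := ContMDiffOn.sub hf hg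

theorem neg (hf : SmoothFunOn f U) : SmoothFunOn (fun x => - f x) U := ContMDiffOn.neg hf

theorem mul (hf : SmoothFunOn f U) (hg : SmoothFunOn g U) :
    SmoothFunOn (fun x => f x * g x) U := ContMDiffOn.mul hf hg

theorem sum {ι : Type*} {s : Finset ι} {f : ι → M → ℝ} (hf : ∀ i ∈ s, SmoothFunOn (f i) U) :
    SmoothFunOn (fun x => ∑ i ∈ s, f i x) U := contMDiffOn_finsetSum hf

theorem inv (hf : SmoothFunOn f U) (h : ∀ x ∈ U, f x ≠ 0) : SmoothFunOn (fun x => (f x)⁻¹) U :=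
  ContMDiffOn.inv₀ hf h

theorem div (hf : SmoothFunOn f U) (hg : SmoothFunOn g U) (h : ∀ x ∈ U, g x ≠ 0) :
    SmoothFunOn (fun x => f x / g x) U := ContMDiffOn.div₀ hf hg h

theorem mdifferentiableAt (hf : SmoothFunOn f U) (hU : IsOpen U) (hx : x ∈ U) :
    MDifferentiableAt 𝓘(ℝ, E4) 𝓘(ℝ, ℝ) f x :=
  (ContMDiffOn.contMDiffAt hf (hU.mem_nhds hx)).mdifferentiableAt (by simp)

theorem isOpen_ne_zero (hf : SmoothFunOn f U) (hU : IsOpen U) : IsOpen {x ∈ U | f x ≠ 0} :=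
  hf.continuousOn.isOpen_inter_preimage hU isOpen_ne

end SmoothFunOn

namespace SmoothFieldOn

theorem mono (hX : SmoothFieldOn X U) (h : V ⊆ U) : SmoothFieldOn X V := ContMDiffOn.mono hX h

theorem congr (hX : SmoothFieldOn X U) (h : ∀ x ∈ U, Y x = X x) : SmoothFieldOn Y U :=
  ContMDiffOn.congr hX fun x hx => by rw [h x hx]

theorem add (hX : SmoothFieldOn X U) (hY : SmoothFieldOn Y U) :
    SmoothFieldOn (fun x => X x + Y x) U := ContMDiffOn.add_section hX hY

theorem smul (hf : SmoothFunOn f U) (hX : SmoothFieldOn X U) :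
    SmoothFieldOn (fun x => f x • X x) U := ContMDiffOn.smul_section hf hX

theorem sum {ι : Type*} {s : Finset ι} {X : ι → VField M}
    (hX : ∀ i ∈ s, SmoothFieldOn (X i) U) : SmoothFieldOn (fun x => ∑ i ∈ s, X i x) U :=
  ContMDiffOn.sum_section hX

theorem contMDiffAt (hX : SmoothFieldOn X U) (hU : IsOpen U) (hx : x ∈ U) :
    ContMDiffAt 𝓘(ℝ, E4) (𝓘(ℝ, E4)).tangent ∞
      (fun x => (⟨x, X x⟩ : TangentBundle 𝓘(ℝ, E4) M)) x :=
  ContMDiffOn.contMDiffAt hX (hU.mem_nhds hx)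

theorem mdifferentiableAt (hX : SmoothFieldOn X U) (hU : IsOpen U) (hx : x ∈ U) :
    MDifferentiableAt 𝓘(ℝ, E4) (𝓘(ℝ, E4)).tangent
      (fun x => (⟨x, X x⟩ : TangentBundle 𝓘(ℝ, E4) M)) x :=
  (hX.contMDiffAt hU hx).mdifferentiableAt (by simp)

theorem bracket (hU : IsOpen U) (hX : SmoothFieldOn X U) (hY : SmoothFieldOn Y U) :
    SmoothFieldOn (bracket X Y) U := fun x hx =>
  have : IsManifold 𝓘(ℝ, E4) (((⊤ : ℕ∞) : WithTop ℕ∞) + 1) M := ‹IsManifold 𝓘(ℝ, E4) ∞ M›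
  have : IsManifold 𝓘(ℝ, E4) (minSmoothness ℝ 2) M :=
    IsManifold.of_le (n := ∞) (minSmoothness_le_infty 2)
  (ContMDiffAt.mlieBracket_vectorField (m := ⊤) (n := ⊤) (hX.contMDiffAt hU hx)
    (hY.contMDiffAt hU hx) (by simp)).contMDiffWithinAt

end SmoothFieldOn

/-! ### Derivatives along vector fields and Lie brackets -/

theorem derivAlong_congr (hU : IsOpen U) (hx : x ∈ U) (h : ∀ z ∈ U, f z = g z) :
    derivAlong X f x = derivAlong X g x := by
  unfold derivAlong
  rw [Filter.EventuallyEq.mfderiv_eq (Filter.eventuallyEq_of_mem (hU.mem_nhds hx) h)]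
  rfl

theorem derivAlong_const (c : ℝ) : derivAlong X (fun _ => c) x = 0 := by
  unfold derivAlong
  rw [mfderiv_const]; rfl

theorem derivAlong_add (hU : IsOpen U) (hx : x ∈ U) (hf : SmoothFunOn f U) (hg : SmoothFunOn g U) :
    derivAlong X (fun z => f z + g z) x = derivAlong X f x + derivAlong X g x :=
  congrArg (fun L : TangentSpace 𝓘(ℝ, E4) x →L[ℝ] ℝ => L (X x))
    (mfderiv_add (hf.mdifferentiableAt hU hx) (hg.mdifferentiableAt hU hx))

theorem derivAlong_sub (hU : IsOpen U) (hx : x ∈ U) (hf : SmoothFunOn f U) (hg : SmoothFunOn g U) :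
    derivAlong X (fun z => f z - g z) x = derivAlong X f x - derivAlong X g x :=
  congrArg (fun L : TangentSpace 𝓘(ℝ, E4) x →L[ℝ] ℝ => L (X x))
    (mfderiv_sub (hf.mdifferentiableAt hU hx) (hg.mdifferentiableAt hU hx))

theorem derivAlong_mul (hU : IsOpen U) (hx : x ∈ U) (hf : SmoothFunOn f U) (hg : SmoothFunOn g U) :
    derivAlong X (fun z => f z * g z) x = f x * derivAlong X g x + g x * derivAlong X f x :=
  congrArg (fun L : TangentSpace 𝓘(ℝ, E4) x →L[ℝ] ℝ => L (X x))
    (mvfderiv_mul (hf.mdifferentiableAt hU hx) (hg.mdifferentiableAt hU hx))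

theorem derivAlong_sum {ι : Type*} {s : Finset ι} {f : ι → M → ℝ} (hU : IsOpen U) (hx : x ∈ U)
    (hf : ∀ i ∈ s, SmoothFunOn (f i) U) :
    derivAlong X (fun z => ∑ i ∈ s, f i z) x = ∑ i ∈ s, derivAlong X (f i) x := by
  classical
  induction s using Finset.induction_on with
  | empty => simpa using derivAlong_const (X := X) (x := x) 0
  | insert a s ha ih =>
    simp only [Finset.sum_insert ha]
    rw [derivAlong_add hU hx (hf a (by simp))
      (SmoothFunOn.sum fun i hi => hf i (by simp [hi])), ih fun i hi => hf i (by simp [hi])]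

theorem bracket_swap (X Y : VField M) (x : M) : bracket X Y x = - bracket Y X x :=
  VectorField.mlieBracket_swap_apply

theorem bracket_congr (hU : IsOpen U) (hx : x ∈ U) {X' Y' : VField M}
    (hX : ∀ z ∈ U, X z = X' z) (hY : ∀ z ∈ U, Y z = Y' z) : bracket X Y x = bracket X' Y' x :=
  Filter.EventuallyEq.mlieBracket_vectorField_eq
    (Filter.eventuallyEq_of_mem (hU.mem_nhds hx) hX)
    (Filter.eventuallyEq_of_mem (hU.mem_nhds hx) hY)

theorem bracket_smul_right (hU : IsOpen U) (hx : x ∈ U) (hf : SmoothFunOn f U)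
    (hY : SmoothFieldOn Y U) :
    bracket X (fun z => f z • Y z) x = derivAlong X f x • Y x + f x • bracket X Y x :=
  VectorField.mlieBracket_smul_right (hf.mdifferentiableAt hU hx) (hY.mdifferentiableAt hU hx)

theorem bracket_add_right (hU : IsOpen U) (hx : x ∈ U) (hY : SmoothFieldOn Y U)
    (hZ : SmoothFieldOn Z U) :
    bracket X (fun z => Y z + Z z) x = bracket X Y x + bracket X Z x :=
  VectorField.mlieBracket_add_right (hY.mdifferentiableAt hU hx) (hZ.mdifferentiableAt hU hx)

theorem bracket_sum_right {ι : Type*} {s : Finset ι} {Y : ι → VField M} (hU : IsOpen U)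
    (hx : x ∈ U) (hY : ∀ i ∈ s, SmoothFieldOn (Y i) U) :
    bracket X (fun z => ∑ i ∈ s, Y i z) x = ∑ i ∈ s, bracket X (Y i) x := by
  classical
  induction s using Finset.induction_on with
  | empty => exact congrFun VectorField.mlieBracket_zero_right x
  | insert a s ha ih =>
    simp only [Finset.sum_insert ha]
    rw [bracket_add_right hU hx (hY a (by simp))
      (SmoothFieldOn.sum fun i hi => hY i (by simp [hi])), ih fun i hi => hY i (by simp [hi])]

theorem bracket_jacobi (hU : IsOpen U) (hx : x ∈ U) (hX : SmoothFieldOn X U)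
    (hY : SmoothFieldOn Y U) (hZ : SmoothFieldOn Z U) :
    bracket X (bracket Y Z) x = bracket (bracket X Y) Z x + bracket Y (bracket X Z) x :=
  have h2 : minSmoothness ℝ 2 ≤ ∞ := minSmoothness_le_infty 2
  have : IsManifold 𝓘(ℝ, E4) (minSmoothness ℝ 3) M :=
    IsManifold.of_le (n := ∞) (minSmoothness_le_infty 3)
  VectorField.leibniz_identity_mlieBracket_apply ((hX.contMDiffAt hU hx).of_le h2)
    ((hY.contMDiffAt hU hx).of_le h2) ((hZ.contMDiffAt hU hx).of_le h2)

end Calculus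

section Frames

variable {M : Type*} [TopologicalSpace M] [ChartedSpace E4 M] [IsManifold 𝓘(ℝ, E4) ∞ M]
variable {U V : Set M} {f : M → ℝ} {X Y Z : VField M} {x : M} {u u' : (x : M) → Coframe x}

/-! ### Coframes and their dual frames -/

theorem theta_dualFrame (u : (x : M) → Coframe x) (a b : Fin 4) (x : M) :
    theta u a x (dualFrame u b x) = (1 : Matrix (Fin 4) (Fin 4) ℝ) a b := by
  simp [theta, dualFrame, Matrix.one_apply, Pi.single_apply]

theorem sum_theta_smul_dualFrame (u : (x : M) → Coframe x) (x : M) (v : TangentSpace 𝓘(ℝ, E4) x) :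
    ∑ a, theta u a x v • dualFrame u a x = v := by
  apply (u x).injective
  rw [map_sum]
  ext b
  simp [theta, dualFrame, Pi.single_apply]

theorem linear_expand {F : Type*} [AddCommMonoid F] [Module ℝ F] (u : (x : M) → Coframe x) (x : M)
    (L : TangentSpace 𝓘(ℝ, E4) x →ₗ[ℝ] F) (v : TangentSpace 𝓘(ℝ, E4) x) :
    L v = ∑ c, theta u c x v • L (dualFrame u c x) := by
  conv_lhs => rw [← sum_theta_smul_dualFrame u x v]
  simp

/-- The differential of a real function, as a linear form. -/
def differential (f : M → ℝ) (x : M) : TangentSpace 𝓘(ℝ, E4) x →L[ℝ] ℝ :=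
  mfderiv 𝓘(ℝ, E4) 𝓘(ℝ, ℝ) f x

theorem derivAlong_expand (u : (x : M) → Coframe x) (f : M → ℝ) (X : VField M) (x : M) :
    derivAlong X f x = ∑ c, theta u c x (X x) * derivAlong (dualFrame u c) f x :=
  linear_expand u x (differential f x).toLinearMap (X x)

theorem Gam_dualFrame (u : (x : M) → Coframe x) (a b c : Fin 4) (x : M) :
    Gam u a b x (dualFrame u c x) = gammaCoef u a b c x := by
  simp [Gam, theta_dualFrame, Matrix.one_apply]

theorem Gam_apply (u : (x : M) → Coframe x) (a b : Fin 4) (x : M) (v : TangentSpace 𝓘(ℝ, E4) x) :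
    Gam u a b x v = ∑ c, gammaCoef u a b c x * theta u c x v := by
  simp [Gam]

theorem bracket_dualFrame (u : (x : M) → Coframe x) (b c : Fin 4) (x : M) :
    bracket (dualFrame u b) (dualFrame u c) x = ∑ a, structFun u a b c x • dualFrame u a x :=
  (sum_theta_smul_dualFrame u x _).symm

theorem structFun_swap (u : (x : M) → Coframe x) (a b c : Fin 4) (x : M) :
    structFun u a b c x = - structFun u a c b x := by
  rw [structFun, bracket_swap, map_neg, structFun]

/-- A coframe field over an open set `U` that is smooth together with its dual frame. -/
structure IsFrameOn (U : Set M) (u : (x : M) → Coframe x) : Prop where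
  isOpen : IsOpen U
  smooth : SmoothCoframeOn u U
  smooth_theta : ∀ V ⊆ U, IsOpen V → ∀ X : VField M, SmoothFieldOn X V →
    ∀ a, SmoothFunOn (fun x => theta u a x (X x)) V

namespace IsFrameOn

theorem mono (F : IsFrameOn U u) (hV : IsOpen V) (h : V ⊆ U) : IsFrameOn V u where
  isOpen := hV
  smooth a := (F.smooth a).mono h
  smooth_theta V' h' := F.smooth_theta V' (h'.trans h)

theorem theta_smooth (F : IsFrameOn U u) (hX : SmoothFieldOn X U) (a : Fin 4) :
    SmoothFunOn (fun x => theta u a x (X x)) U :=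
  F.smooth_theta U subset_rfl F.isOpen X hX a

/-- X f is the component along `dualFrame u 0` of [X, f ∂] − f [X, ∂] with ∂ = `dualFrame u 0`, and
brackets and components of smooth fields are smooth. -/
theorem derivAlong_smooth (F : IsFrameOn U u) (hX : SmoothFieldOn X U) (hf : SmoothFunOn f U) :
    SmoothFunOn (derivAlong X f) U := by
  have h1 := F.theta_smooth (SmoothFieldOn.bracket F.isOpen hX (SmoothFieldOn.smul hf (F.smooth 0))) 0
  have h2 := F.theta_smooth (SmoothFieldOn.bracket F.isOpen hX (F.smooth 0)) 0
  refine (h1.sub (hf.mul h2)).congr fun x hx => ?_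
  rw [bracket_smul_right F.isOpen hx hf (F.smooth 0), map_add, map_smul, map_smul, theta_dualFrame]
  simp

theorem structFun_smooth (F : IsFrameOn U u) (a b c : Fin 4) : SmoothFunOn (structFun u a b c) U :=
  F.theta_smooth (SmoothFieldOn.bracket F.isOpen (F.smooth b) (F.smooth c)) a

theorem gammaCoef_smooth (F : IsFrameOn U u) (a b c : Fin 4) : SmoothFunOn (gammaCoef u a b c) U :=
  (((F.structFun_smooth _ _ _).sub (F.structFun_smooth _ _ _)).add
    (F.structFun_smooth _ _ _)).div (.const 2) (by simp)

theorem Gam_smooth (F : IsFrameOn U u) (hX : SmoothFieldOn X U) (a b : Fin 4) :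
    SmoothFunOn (fun x => Gam u a b x (X x)) U := by
  simp only [Gam_apply]
  exact .sum fun c _ => (F.gammaCoef_smooth a b c).mul (F.theta_smooth hX c)

/-- `X (Y f) - Y (X f) = [X, Y] f`, from the Jacobi identity for `X`, `Y` and `f • Z`. -/
theorem derivAlong_commutator (F : IsFrameOn U u) (hx : x ∈ U) (hX : SmoothFieldOn X U)
    (hY : SmoothFieldOn Y U) (hf : SmoothFunOn f U) :
    derivAlong X (derivAlong Y f) x - derivAlong Y (derivAlong X f) x
      = derivAlong (bracket X Y) f x := by
  have hU := F.isOpen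
  -- In [X, [Y, f Z]] the terms with one derivative of f are symmetric in X and Y. They drop out of
  -- the Jacobi identity, and only second derivatives of f and the derivative along [X, Y] survive.
  have key : ∀ {X Y : VField M}, SmoothFieldOn X U → SmoothFieldOn Y U →
      bracket X (bracket Y fun z => f z • dualFrame u 0 z) x
      = (derivAlong X (derivAlong Y f) x • dualFrame u 0 x
          + derivAlong Y f x • bracket X (dualFrame u 0) x)
        + (derivAlong X f x • bracket Y (dualFrame u 0) x
          + f x • bracket X (bracket Y (dualFrame u 0)) x) := by
    intro X Y hX hY
    have hb := SmoothFieldOn.bracket hU hY (F.smooth 0)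
    rw [bracket_congr hU hx (X' := X) (fun _ _ => rfl)
      (fun z hz => bracket_smul_right (X := Y) hU hz hf (F.smooth 0)),
      bracket_add_right hU hx ((F.smooth 0).smul (F.derivAlong_smooth hY hf)) (hb.smul hf),
      bracket_smul_right hU hx (F.derivAlong_smooth hY hf) (F.smooth 0),
      bracket_smul_right hU hx hf hb]
  have h0 := F.smooth 0
  have J := bracket_jacobi hU hx hX hY (SmoothFieldOn.smul hf h0)
  rw [key hX hY, key hY hX, bracket_smul_right hU hx hf h0, bracket_jacobi hU hx hX hY h0] at J
  have J' := congrArg (theta u 0 x) J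
  simp only [map_add, map_smul, theta_dualFrame, smul_eq_mul, Matrix.one_apply_eq] at J'
  linarith

/-- The Levi-Civita connection forms of the null coframe are torsion-free:
`dθᵃ = - Γᵃ_b ∧ θᵇ`, evaluated on arbitrary vector fields. -/
theorem theta_bracket (F : IsFrameOn U u) (hx : x ∈ U) (hX : SmoothFieldOn X U)
    (hY : SmoothFieldOn Y U) (a : Fin 4) :
    theta u a x (bracket X Y x) = derivAlong X (fun z => theta u a z (Y z)) x
      - derivAlong Y (fun z => theta u a z (X z)) x
      + ∑ b, (Gam u a b x (X x) * theta u b x (Y x) - Gam u a b x (Y x) * theta u b x (X x)) := by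
  have hU := F.isOpen
  have key : ∀ (X Y : VField M), SmoothFieldOn Y U → bracket X Y x
      = ∑ c, (derivAlong X (fun z => theta u c z (Y z)) x • dualFrame u c x
        + theta u c x (Y x) • bracket X (dualFrame u c) x) := by
    intro X Y hY
    rw [bracket_congr hU hx (X' := X) (Y' := fun z => ∑ c, theta u c z (Y z) • dualFrame u c z)
      (fun _ _ => rfl) (fun z _ => (sum_theta_smul_dualFrame u z (Y z)).symm),
      bracket_sum_right hU hx fun c _ => (F.smooth c).smul (F.theta_smooth hY c)]
    exact Finset.sum_congr rfl fun c _ =>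
      bracket_smul_right hU hx (F.theta_smooth hY c) (F.smooth c)
  -- Expanding X in the dual frame as well leaves only brackets of frame fields, whose components
  -- are differences of connection coefficients.
  have h1 : ∀ c, theta u a x (bracket X (dualFrame u c) x)
      = - derivAlong (dualFrame u c) (fun z => theta u a z (X z)) x
        - ∑ b, theta u b x (X x) * (gammaCoef u a b c x - gammaCoef u a c b x) := by
    intro c
    rw [bracket_swap, key _ X hX]
    simp only [map_neg, map_sum, map_add, map_smul, theta_dualFrame, smul_eq_mul, Matrix.one_apply,
      mul_ite, mul_one, mul_zero, Finset.sum_add_distrib, Finset.sum_ite_eq, Finset.mem_univ,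
      if_true, neg_add, ← gammaCoef_torsionFree]
    rfl
  rw [key X Y hY]
  simp only [map_sum, map_add, map_smul, theta_dualFrame, smul_eq_mul, Matrix.one_apply,
      mul_ite, mul_one, mul_zero, Finset.sum_add_distrib, Finset.sum_ite_eq, Finset.mem_univ,
      if_true, h1]
  rw [derivAlong_expand u _ Y]
  simp only [Gam_apply, Fin.sum_univ_four]
  ring

/-! ### Matrix-valued connection and curvature -/

end IsFrameOn

/-- The derivative of a matrix-valued function along a vector field. -/
def derivMat (X : VField M) (A : M → Matrix (Fin 4) (Fin 4) ℝ) (x : M) :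
    Matrix (Fin 4) (Fin 4) ℝ :=
  Matrix.of fun i j => derivAlong X (fun z => A z i j) x

/-- Smoothness of a matrix-valued function on a set. -/
def SmoothMatOn (A : M → Matrix (Fin 4) (Fin 4) ℝ) (U : Set M) : Prop :=
  ∀ i j, SmoothFunOn (fun z => A z i j) U

/-- The matrix `Γᵃ_b(X)`. -/
def gamMat (u : (x : M) → Coframe x) (X : VField M) (x : M) : Matrix (Fin 4) (Fin 4) ℝ :=
  Matrix.of fun a b => Gam u a b x (X x)

/-- The matrix of curvature `2`-forms, evaluated on two vector fields. -/
def curvMat (u : (x : M) → Coframe x) (X Y : VField M) (x : M) : Matrix (Fin 4) (Fin 4) ℝ :=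
  derivMat X (gamMat u Y) x - derivMat Y (gamMat u X) x - gamMat u (bracket X Y) x
    + (gamMat u X x * gamMat u Y x - gamMat u Y x * gamMat u X x)

theorem curvMat_apply (u : (x : M) → Coframe x) (X Y : VField M) (x : M) (a b : Fin 4) :
    curvMat u X Y x a b = dOne (Gam u a b) X Y x + ∑ e, wedge (Gam u a e) (Gam u e b) X Y x := by
  simp [curvMat, derivMat, gamMat, dOne, wedge, Matrix.mul_apply]

theorem riem_eq_curvMat (u : (x : M) → Coframe x) (a b c d : Fin 4) (x : M) :
    riem u a b c d x = curvMat u (dualFrame u c) (dualFrame u d) x a b :=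
  (curvMat_apply u _ _ x a b).symm

theorem derivMat_congr {A B : M → Matrix (Fin 4) (Fin 4) ℝ} (hU : IsOpen U) (hx : x ∈ U)
    (h : ∀ z ∈ U, A z = B z) : derivMat X A x = derivMat X B x := by
  ext i j
  exact derivAlong_congr hU hx fun z hz => by rw [h z hz]

theorem derivMat_const (A : Matrix (Fin 4) (Fin 4) ℝ) : derivMat X (fun _ => A) x = 0 := by
  ext i j
  exact derivAlong_const _

namespace SmoothMatOn

variable {A B : M → Matrix (Fin 4) (Fin 4) ℝ}

theorem add (hA : SmoothMatOn A U) (hB : SmoothMatOn B U) : SmoothMatOn (fun z => A z + B z) U :=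
  fun i j => (hA i j).add (hB i j)

theorem sub (hA : SmoothMatOn A U) (hB : SmoothMatOn B U) : SmoothMatOn (fun z => A z - B z) U :=
  fun i j => (hA i j).sub (hB i j)

theorem mul (hA : SmoothMatOn A U) (hB : SmoothMatOn B U) : SmoothMatOn (fun z => A z * B z) U := by
  intro i j
  simp only [Matrix.mul_apply]
  exact .sum fun k _ => (hA i k).mul (hB k j)

theorem derivMat (F : IsFrameOn U u) (hX : SmoothFieldOn X U) (hA : SmoothMatOn A U) :
    SmoothMatOn (derivMat X A) U :=
  fun i j => F.derivAlong_smooth hX (hA i j)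

end SmoothMatOn

section
variable {A B : M → Matrix (Fin 4) (Fin 4) ℝ}

theorem derivMat_add (hU : IsOpen U) (hx : x ∈ U) (hA : SmoothMatOn A U) (hB : SmoothMatOn B U) :
    derivMat X (fun z => A z + B z) x = derivMat X A x + derivMat X B x := by
  ext i j
  exact derivAlong_add hU hx (hA i j) (hB i j)

theorem derivMat_sub (hU : IsOpen U) (hx : x ∈ U) (hA : SmoothMatOn A U) (hB : SmoothMatOn B U) :
    derivMat X (fun z => A z - B z) x = derivMat X A x - derivMat X B x := by
  ext i j
  exact derivAlong_sub hU hx (hA i j) (hB i j)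

theorem derivMat_mul (hU : IsOpen U) (hx : x ∈ U) (hA : SmoothMatOn A U) (hB : SmoothMatOn B U) :
    derivMat X (fun z => A z * B z) x = derivMat X A x * B x + A x * derivMat X B x := by
  ext i j
  simp only [derivMat, Matrix.mul_apply, Matrix.add_apply, Matrix.of_apply]
  rw [derivAlong_sum hU hx fun k _ => (hA i k).mul (hB k j), ← Finset.sum_add_distrib]
  refine Finset.sum_congr rfl fun k _ => ?_
  rw [derivAlong_mul hU hx (hA i k) (hB k j)]
  ring

theorem derivMat_commutator (F : IsFrameOn U u) (hx : x ∈ U) (hX : SmoothFieldOn X U)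
    (hY : SmoothFieldOn Y U) (hA : SmoothMatOn A U) :
    derivMat X (derivMat Y A) x - derivMat Y (derivMat X A) x = derivMat (bracket X Y) A x := by
  ext i j
  exact F.derivAlong_commutator hx hX hY (hA i j)

end

theorem gamMat_add (u : (x : M) → Coframe x) (X Y : VField M) (x : M) :
    gamMat u (fun z => X z + Y z) x = gamMat u X x + gamMat u Y x := by
  ext; simp [gamMat]

theorem gamMat_eq_of_eq (u : (x : M) → Coframe x) (h : X x = Y x) : gamMat u X x = gamMat u Y x := by
  simp [gamMat, h]

namespace IsFrameOn

theorem gamMat_smooth (F : IsFrameOn U u) (hX : SmoothFieldOn X U) : SmoothMatOn (gamMat u X) U :=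
  fun a b => F.Gam_smooth hX a b

theorem curvMat_smooth (F : IsFrameOn U u) (hX : SmoothFieldOn X U) (hY : SmoothFieldOn Y U) :
    SmoothMatOn (curvMat u X Y) U := by
  have hG := F.gamMat_smooth hX
  have hG' := F.gamMat_smooth hY
  exact (((hG'.derivMat F hX).sub (hG.derivMat F hY)).sub
    (F.gamMat_smooth (.bracket F.isOpen hX hY))).add ((hG.mul hG').sub (hG'.mul hG))

theorem riem_smooth (F : IsFrameOn U u) (a b c d : Fin 4) : SmoothFunOn (riem u a b c d) U :=
  (F.curvMat_smooth (F.smooth c) (F.smooth d) a b).congr fun x _ => riem_eq_curvMat u a b c d x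

/-- The exterior derivative of a `1`-form in terms of its frame components. -/
theorem dOne_sum_theta (F : IsFrameOn U u) (hx : x ∈ U) (hX : SmoothFieldOn X U)
    (hY : SmoothFieldOn Y U) {γ : Fin 4 → M → ℝ} (hγ : ∀ c, SmoothFunOn (γ c) U) :
    dOne (fun z => ∑ c, γ c z • theta u c z) X Y x
      = ∑ c, (derivAlong X (γ c) x * theta u c x (Y x) - derivAlong Y (γ c) x * theta u c x (X x)
        - γ c x * ∑ b, (Gam u c b x (X x) * theta u b x (Y x)
          - Gam u c b x (Y x) * theta u b x (X x))) := by
  have hU := F.isOpen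
  have h : ∀ {X Y : VField M}, SmoothFieldOn Y U →
      derivAlong X (fun z => (∑ c, γ c z • theta u c z) (Y z)) x
      = ∑ c, (γ c x * derivAlong X (fun z => theta u c z (Y z)) x
          + theta u c x (Y x) * derivAlong X (γ c) x) := by
    intro X Y hY
    simp only [_root_.sum_apply, _root_.smul_apply, smul_eq_mul]
    rw [derivAlong_sum hU hx fun c _ => (hγ c).mul (F.theta_smooth hY c)]
    exact Finset.sum_congr rfl fun c _ => derivAlong_mul hU hx (hγ c) (F.theta_smooth hY c)
  simp only [dOne]
  rw [h hY, h hX]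
  simp only [_root_.sum_apply, _root_.smul_apply, smul_eq_mul,
    ← Finset.sum_sub_distrib]
  refine Finset.sum_congr rfl fun c _ => ?_
  rw [F.theta_bracket hx hX hY c]
  ring

theorem derivAlong_eq_differential (X : VField M) (f : M → ℝ) (x : M) :
    derivAlong X f x = differential f x (X x) := rfl

theorem curvMat_expand_left (F : IsFrameOn U u) (hx : x ∈ U) (hX : SmoothFieldOn X U)
    (hY : SmoothFieldOn Y U) :
    curvMat u X Y x = ∑ c, theta u c x (X x) • curvMat u (dualFrame u c) Y x := by
  ext a b
  -- Tensoriality: by `dOne_sum_theta` all derivatives of X cancel, so the curvature is the value at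
  -- `X x` of one linear form that does not depend on the field X.
  obtain ⟨L, hL⟩ : ∃ L : TangentSpace 𝓘(ℝ, E4) x →L[ℝ] ℝ, ∀ X : VField M, SmoothFieldOn X U →
      curvMat u X Y x a b = L (X x) := by
    refine ⟨∑ c, (theta u c x (Y x) • differential (gammaCoef u a b c) x
        - derivAlong Y (gammaCoef u a b c) x • theta u c x
        - gammaCoef u a b c x • ∑ e, (theta u e x (Y x) • Gam u c e x
          - Gam u c e x (Y x) • theta u e x))
        + ∑ e, (Gam u e b x (Y x) • Gam u a e x - Gam u a e x (Y x) • Gam u e b x), ?_⟩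
    intro X hX
    rw [curvMat_apply, show Gam u a b = fun z => ∑ c, gammaCoef u a b c z • theta u c z from rfl,
      F.dOne_sum_theta hx hX hY fun c => F.gammaCoef_smooth a b c]
    simp only [wedge, derivAlong_eq_differential, _root_.sum_apply, _root_.smul_apply,
      _root_.add_apply, _root_.sub_apply, smul_eq_mul]
    congr 1
    · refine Finset.sum_congr rfl fun c _ => ?_
      congr 1
      · ring
      · congr 1
        exact Finset.sum_congr rfl fun e _ => by ring
    · exact Finset.sum_congr rfl fun e _ => by ring
  rw [hL X hX, ← ContinuousLinearMap.coe_coe, linear_expand u x]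
  simp only [Matrix.sum_apply, Matrix.smul_apply]
  exact Finset.sum_congr rfl fun c _ => by rw [hL _ (F.smooth c)]; rfl

end IsFrameOn

theorem curvMat_swap (u : (x : M) → Coframe x) (X Y : VField M) (x : M) :
    curvMat u X Y x = - curvMat u Y X x := by
  have : gamMat u (bracket X Y) x = - gamMat u (bracket Y X) x := by
    ext a b
    simp only [gamMat, Matrix.of_apply, Matrix.neg_apply]
    rw [bracket_swap, map_neg]
  rw [curvMat, curvMat, this]
  abel

namespace IsFrameOn

theorem curvMat_expand_right (F : IsFrameOn U u) (hx : x ∈ U) (hX : SmoothFieldOn X U)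
    (hY : SmoothFieldOn Y U) :
    curvMat u X Y x = ∑ c, theta u c x (Y x) • curvMat u X (dualFrame u c) x := by
  rw [curvMat_swap, F.curvMat_expand_left hx hY hX, ← Finset.sum_neg_distrib]
  refine Finset.sum_congr rfl fun c _ => ?_
  rw [curvMat_swap u X, smul_neg]

theorem curvMat_expand (F : IsFrameOn U u) (hx : x ∈ U) (hX : SmoothFieldOn X U)
    (hY : SmoothFieldOn Y U) (a b : Fin 4) :
    curvMat u X Y x a b
      = ∑ c, ∑ d, theta u c x (X x) * theta u d x (Y x) * riem u a b c d x := by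
  rw [F.curvMat_expand_left hx hX hY]
  simp only [Matrix.sum_apply, Matrix.smul_apply, smul_eq_mul]
  refine Finset.sum_congr rfl fun c _ => ?_
  rw [F.curvMat_expand_right hx (F.smooth c) hY]
  simp only [Matrix.sum_apply, Matrix.smul_apply, smul_eq_mul, Finset.mul_sum, riem_eq_curvMat]
  exact Finset.sum_congr rfl fun d _ => by ring

end IsFrameOn

end Frames

section Gauge

variable {M : Type*} [TopologicalSpace M] [ChartedSpace E4 M] [IsManifold 𝓘(ℝ, E4) ∞ M]
variable {U V : Set M} {f : M → ℝ} {X Y Z : VField M} {x : M} {u u' : (x : M) → Coframe x}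

/-! ### Bianchi identities -/

theorem bracket_jacobi_cyclic (hU : IsOpen U) (hx : x ∈ U) (hX : SmoothFieldOn X U)
    (hY : SmoothFieldOn Y U) (hZ : SmoothFieldOn Z U) :
    bracket (bracket X Y) Z x + bracket (bracket Y Z) X x + bracket (bracket Z X) Y x = 0 := by
  have h1 := bracket_jacobi hU hx hX hY hZ
  have h2 : bracket Y (bracket X Z) x = bracket (bracket Z X) Y x := by
    rw [bracket_swap (bracket Z X) Y, bracket_congr (X' := Y)
      (Y' := fun z => (fun _ => (-1 : ℝ)) z • bracket Z X z) hU hx (fun _ _ => rfl)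
      (fun z _ => by rw [bracket_swap X Z]; simp),
      bracket_smul_right hU hx (.const _) (SmoothFieldOn.bracket hU hZ hX), derivAlong_const]
    simp
  rw [h2, bracket_swap X] at h1
  rw [add_right_comm, ← h1]
  simp

namespace IsFrameOn

/-- The Jacobi identity for the structure functions. -/
theorem structFun_jacobi (F : IsFrameOn U u) (hx : x ∈ U) (a b c d : Fin 4) :
    derivAlong (dualFrame u b) (structFun u a c d) x
      + derivAlong (dualFrame u c) (structFun u a d b) x
      + derivAlong (dualFrame u d) (structFun u a b c) x
      + ∑ e, (structFun u e c d x * structFun u a b e x + structFun u e d b x * structFun u a c e x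
        + structFun u e b c x * structFun u a d e x) = 0 := by
  have hU := F.isOpen
  have key : ∀ b c d, theta u a x (bracket (bracket (dualFrame u c) (dualFrame u d))
      (dualFrame u b) x) = - derivAlong (dualFrame u b) (structFun u a c d) x
        - ∑ e, structFun u e c d x * structFun u a b e x := by
    intro b c d
    rw [bracket_swap, bracket_congr (X' := dualFrame u b) hU hx (fun _ _ => rfl)
      (fun z _ => bracket_dualFrame u c d z),
      bracket_sum_right hU hx fun e _ => (F.smooth e).smul (F.structFun_smooth e c d),
      Finset.sum_congr rfl fun e _ => bracket_smul_right hU hx (F.structFun_smooth e c d)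
        (F.smooth e)]
    simp only [map_neg, map_sum, map_add, map_smul, theta_dualFrame, smul_eq_mul, Matrix.one_apply,
      mul_ite, mul_one, mul_zero, Finset.sum_add_distrib, Finset.sum_ite_eq, Finset.mem_univ,
      if_true, neg_add]
    rfl
  have J := congrArg (theta u a x)
    (bracket_jacobi_cyclic hU hx (F.smooth b) (F.smooth c) (F.smooth d))
  rw [map_add, map_add, key, key, key, map_zero] at J
  simp only [Finset.sum_add_distrib]
  linarith

theorem riem_eq (a b c d : Fin 4) :
    riem u a b c d x = derivAlong (dualFrame u c) (gammaCoef u a b d) x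
      - derivAlong (dualFrame u d) (gammaCoef u a b c) x
      + ∑ e, (gammaCoef u a e c x * gammaCoef u e b d x - gammaCoef u a e d x * gammaCoef u e b c x
        - gammaCoef u a b e x * structFun u e c d x) := by
  simp only [riem, dOne, wedge, Gam_dualFrame, Finset.sum_sub_distrib]
  rw [bracket_dualFrame]
  simp only [map_sum, map_smul, Gam_dualFrame, smul_eq_mul, mul_comm (structFun _ _ _ _ _)]
  ring

/-- The first Bianchi identity. -/
theorem riem_cyclic (F : IsFrameOn U u) (hx : x ∈ U) (a b c d : Fin 4) :
    riem u a b c d x + riem u a c d b x + riem u a d b c x = 0 := by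
  have key : ∀ b c d, derivAlong (dualFrame u b) (structFun u a c d) x
      = derivAlong (dualFrame u b) (gammaCoef u a d c) x
        - derivAlong (dualFrame u b) (gammaCoef u a c d) x := by
    intro b c d
    rw [← derivAlong_sub F.isOpen hx (F.gammaCoef_smooth a d c) (F.gammaCoef_smooth a c d)]
    exact derivAlong_congr F.isOpen hx fun z _ => gammaCoef_torsionFree u a c d z
  have J := F.structFun_jacobi hx a b c d
  rw [key, key, key] at J
  rw [riem_eq, riem_eq, riem_eq]
  simp only [gammaCoef_torsionFree, Fin.sum_univ_four] at J ⊢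
  linear_combination J

/-- The second Bianchi identity. -/
theorem curvMat_bianchi (F : IsFrameOn U u) (hx : x ∈ U) (hX : SmoothFieldOn X U)
    (hY : SmoothFieldOn Y U) (hZ : SmoothFieldOn Z U) :
    (derivMat X (curvMat u Y Z) x + gamMat u X x * curvMat u Y Z x
        - curvMat u Y Z x * gamMat u X x - curvMat u (bracket X Y) Z x)
      + (derivMat Y (curvMat u Z X) x + gamMat u Y x * curvMat u Z X x
        - curvMat u Z X x * gamMat u Y x - curvMat u (bracket Y Z) X x)
      + (derivMat Z (curvMat u X Y) x + gamMat u Z x * curvMat u X Y x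
        - curvMat u X Y x * gamMat u Z x - curvMat u (bracket Z X) Y x) = 0 := by
  have hU := F.isOpen
  have hd : ∀ {X Y Z : VField M}, SmoothFieldOn X U → SmoothFieldOn Y U → SmoothFieldOn Z U →
      derivMat X (curvMat u Y Z) x = derivMat X (derivMat Y (gamMat u Z)) x
        - derivMat X (derivMat Z (gamMat u Y)) x - derivMat X (gamMat u (bracket Y Z)) x
        + ((derivMat X (gamMat u Y) x * gamMat u Z x + gamMat u Y x * derivMat X (gamMat u Z) x)
          - (derivMat X (gamMat u Z) x * gamMat u Y x
            + gamMat u Z x * derivMat X (gamMat u Y) x)) := by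
    intro X Y Z hX hY hZ
    have gY := F.gamMat_smooth hY
    have gZ := F.gamMat_smooth hZ
    have gb := F.gamMat_smooth (SmoothFieldOn.bracket hU hY hZ)
    unfold curvMat
    rw [derivMat_add hU hx (((gZ.derivMat F hY).sub (gY.derivMat F hZ)).sub gb)
        ((gY.mul gZ).sub (gZ.mul gY)),
      derivMat_sub hU hx ((gZ.derivMat F hY).sub (gY.derivMat F hZ)) gb,
      derivMat_sub hU hx (gZ.derivMat F hY) (gY.derivMat F hZ),
      derivMat_sub hU hx (gY.mul gZ) (gZ.mul gY), derivMat_mul hU hx gY gZ,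
      derivMat_mul hU hx gZ gY]
  have hJ : gamMat u (bracket (bracket X Y) Z) x + gamMat u (bracket (bracket Y Z) X) x
      + gamMat u (bracket (bracket Z X) Y) x = 0 := by
    rw [← gamMat_add, ← gamMat_add, gamMat_eq_of_eq (Y := fun _ => 0) u
      (bracket_jacobi_cyclic hU hx hX hY hZ)]
    ext; simp [gamMat]
  rw [hd hX hY hZ, hd hY hZ hX, hd hZ hX hY]
  -- The second derivatives of Γ combine into derivatives along brackets, and `hJ` removes the
  -- values of Γ on double brackets. What remains is associativity of the matrix product.
  have c1 := derivMat_commutator F hx hX hY (F.gamMat_smooth hZ)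
  have c2 := derivMat_commutator F hx hY hZ (F.gamMat_smooth hX)
  have c3 := derivMat_commutator F hx hZ hX (F.gamMat_smooth hY)
  simp only [curvMat, ← c1, ← c2, ← c3]
  rw [← hJ]
  noncomm_ring

theorem riem_bianchi (F : IsFrameOn U u) (hx : x ∈ U) (a b c d e : Fin 4) :
    (derivAlong (dualFrame u c) (riem u a b d e) x
        + ∑ f, (gammaCoef u a f c x * riem u f b d e x - riem u a f d e x * gammaCoef u f b c x
          - structFun u f c d x * riem u a b f e x))
      + (derivAlong (dualFrame u d) (riem u a b e c) x
        + ∑ f, (gammaCoef u a f d x * riem u f b e c x - riem u a f e c x * gammaCoef u f b d x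
          - structFun u f d e x * riem u a b f c x))
      + (derivAlong (dualFrame u e) (riem u a b c d) x
        + ∑ f, (gammaCoef u a f e x * riem u f b c d x - riem u a f c d x * gammaCoef u f b e x
          - structFun u f e c x * riem u a b f d x)) = 0 := by
  have J := congrFun₂ (F.curvMat_bianchi hx (F.smooth c) (F.smooth d) (F.smooth e)) a b
  have hb : ∀ c d e, curvMat u (bracket (dualFrame u c) (dualFrame u d)) (dualFrame u e) x a b
      = ∑ f, structFun u f c d x * riem u a b f e x := by
    intro c d e
    rw [F.curvMat_expand_left hx (.bracket F.isOpen (F.smooth c) (F.smooth d)) (F.smooth e)]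
    simp only [Matrix.sum_apply, Matrix.smul_apply, smul_eq_mul, riem_eq_curvMat]
    rfl
  have hr : ∀ c d e, derivAlong (dualFrame u c) (riem u a b d e) x
      = derivMat (dualFrame u c) (curvMat u (dualFrame u d) (dualFrame u e)) x a b := fun c d e =>
    derivAlong_congr F.isOpen hx fun z _ => riem_eq_curvMat u a b d e z
  rw [hr, hr, hr]
  simp only [Matrix.add_apply, Matrix.sub_apply, Matrix.mul_apply, hb, Matrix.zero_apply] at J
  simp only [Finset.sum_sub_distrib, riem_eq_curvMat]
  simp only [riem_eq_curvMat, gamMat, Matrix.of_apply, Gam_dualFrame] at J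
  linarith

end IsFrameOn

/-! ### Change of coframe -/

theorem eta_mul_apply (A : Matrix (Fin 4) (Fin 4) ℝ) (a b : Fin 4) :
    (eta * A) a b = A (flip4 a) b := by
  fin_cases a <;> simp [eta, flip4, Matrix.mul_apply, Fin.sum_univ_four]

theorem flip4_flip4 (a : Fin 4) : flip4 (flip4 a) = a := by
  revert a; decide

theorem eta_transpose : eta.transpose = eta := by
  ext a b
  fin_cases a <;> fin_cases b <;> simp [eta]

/-- Torsion-freeness and metricity determine the Levi-Civita connection. -/
theorem gammaCoef_unique {T : Fin 4 → Fin 4 → Fin 4 → ℝ}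
    (tor : ∀ a b c, structFun u a b c x = T a c b - T a b c)
    (met : ∀ a b c, T (flip4 a) b c + T (flip4 b) a c = 0) (a b c : Fin 4) :
    gammaCoef u a b c x = T a b c := by
  simp only [gammaCoef, tor]
  have h1 := met c b (flip4 a)
  have h2 := met c (flip4 a) b
  have h3 := met (flip4 a) b c
  simp only [flip4_flip4] at h1 h2 h3
  linarith

theorem eta_gamMat (u : (x : M) → Coframe x) (X : VField M) (x : M) :
    eta * gamMat u X x + (gamMat u X x).transpose * eta = 0 := by
  have h : (gamMat u X x).transpose * eta = (eta * gamMat u X x).transpose := by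
    rw [Matrix.transpose_mul, eta_transpose]
  ext a b
  rw [h, Matrix.add_apply, Matrix.transpose_apply, eta_mul_apply, eta_mul_apply]
  simp only [gamMat, Matrix.of_apply, Gam_apply, ← Finset.sum_add_distrib, ← add_mul,
    gammaCoef_metric]
  simp

/-- The matrix `βᵃ_b = θᵃ(∂'_b)` that relates two coframe fields. -/
def transMat (u u' : (x : M) → Coframe x) (x : M) : Matrix (Fin 4) (Fin 4) ℝ :=
  Matrix.of fun a b => theta u a x (dualFrame u' b x)

theorem theta_eq_sum_transMat (u u' : (x : M) → Coframe x) (a : Fin 4) (x : M)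
    (v : TangentSpace 𝓘(ℝ, E4) x) : theta u a x v = ∑ b, transMat u u' x a b * theta u' b x v := by
  conv_lhs => rw [← sum_theta_smul_dualFrame u' x v]
  simp [transMat, mul_comm]

theorem transMat_mul_transMat (u u' : (x : M) → Coframe x) (x : M) :
    transMat u u' x * transMat u' u x = 1 := by
  ext a b
  rw [← theta_dualFrame u a b x, theta_eq_sum_transMat u u']
  rfl

/-- Two smooth coframe fields with the same associated metric. -/
structure IsNullChange (U : Set M) (u u' : (x : M) → Coframe x) : Prop where
  left : IsFrameOn U u
  right : IsFrameOn U u'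
  metric : ∀ x ∈ U, (transMat u u' x).transpose * eta * transMat u u' x = eta

namespace IsNullChange

theorem smooth_trans (H : IsNullChange U u u') : SmoothMatOn (transMat u u') U :=
  fun a b => H.left.theta_smooth (H.right.smooth b) a

theorem smooth_trans' (H : IsNullChange U u u') : SmoothMatOn (transMat u' u) U :=
  fun a b => H.right.theta_smooth (H.left.smooth b) a

/-- The inverse of a matrix β preserving η is η βᵀ η, as η² = 1. -/
theorem eta_mul (H : IsNullChange U u u') (hx : x ∈ U) :
    eta * transMat u' u x = (transMat u u' x).transpose * eta := by
  conv_lhs => rw [← H.metric x hx]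
  rw [mul_assoc, transMat_mul_transMat, mul_one]

/-- The transformation law of the connection forms. -/
theorem gamMat_eq (H : IsNullChange U u u') (hx : x ∈ U) (X : VField M) :
    gamMat u' X x = transMat u' u x * gamMat u X x * transMat u u' x
      + transMat u' u x * derivMat X (transMat u u') x := by
  have F := H.left
  have hU := F.isOpen
  set B := transMat u' u x with hB
  set β := transMat u u' x with hβ
  have main : ∀ a b c, gammaCoef u' a b c x
      = (B * gamMat u (dualFrame u' c) x * β
        + B * derivMat (dualFrame u' c) (transMat u u') x) a b := by
    refine gammaCoef_unique (T := fun a b c => (B * gamMat u (dualFrame u' c) x * β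
        + B * derivMat (dualFrame u' c) (transMat u u') x) a b) (fun a b c => ?_)
        (fun a b c => ?_)
    · have h := F.theta_bracket hx (H.right.smooth b) (H.right.smooth c)
      have : structFun u' a b c x
          = ∑ d, B a d * theta u d x (bracket (dualFrame u' b) (dualFrame u' c) x) :=
        theta_eq_sum_transMat u' u a x _
      rw [this]
      simp only [h, Matrix.add_apply, mul_assoc B, Matrix.mul_apply, ← Finset.sum_sub_distrib,
        ← Finset.sum_add_distrib]
      refine Finset.sum_congr rfl fun d _ => ?_
      simp only [derivMat, transMat, Matrix.of_apply, gamMat, hβ, Finset.sum_sub_distrib]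
      ring
    · set X := dualFrame u' c
      have hD : derivMat X (fun z => (transMat u u' z).transpose) x
          = (derivMat X (transMat u u') x).transpose := rfl
      -- Differentiating βᵀ η β = η supplies the metricity of the inhomogeneous term β⁻¹ dβ.
      have h0 := derivMat_congr (X := X) hU hx H.metric
      have hc : SmoothMatOn (fun _ : M => eta) U := fun i j => .const _
      have ht : SmoothMatOn (fun z => (transMat u u' z).transpose) U :=
        fun i j => H.smooth_trans j i
      rw [derivMat_const, derivMat_mul hU hx (ht.mul hc) H.smooth_trans, derivMat_mul hU hx ht hc,
        derivMat_const, hD, mul_zero, add_zero] at h0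
      set D := derivMat X (transMat u u') x
      have hT : ∀ A : Matrix (Fin 4) (Fin 4) ℝ, A (flip4 a) b + A (flip4 b) a
          = (eta * A + (eta * A).transpose) a b := by
        intro A
        rw [Matrix.add_apply, Matrix.transpose_apply, eta_mul_apply, eta_mul_apply]
      rw [hT, mul_add, mul_assoc B, ← mul_assoc eta, ← mul_assoc eta, H.eta_mul hx]
      have hm := congrArg (fun A => β.transpose * A * β) (eta_gamMat u X x)
      simp only [mul_add, add_mul, mul_zero, zero_mul] at hm
      simp only [Matrix.transpose_add, Matrix.transpose_mul, Matrix.transpose_transpose,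
        eta_transpose]
      have : β.transpose * eta * (gamMat u X x * β) + β.transpose * eta * D +
          ((β.transpose * (gamMat u X x).transpose) * (eta * β) + D.transpose * (eta * β)) = 0 := by
        rw [← add_zero (0 : Matrix (Fin 4) (Fin 4) ℝ)]
        nth_rewrite 1 [← hm]
        rw [← h0]
        simp only [mul_assoc]
        abel
      rw [this]
      rfl
  ext a b
  have h1 : gamMat u' X x a b = ∑ c, theta u' c x (X x) * gammaCoef u' a b c x := by
    simp only [gamMat, Matrix.of_apply, Gam_apply, mul_comm]
  have h2 : gamMat u X x = ∑ c, theta u' c x (X x) • gamMat u (dualFrame u' c) x := by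
    ext i j
    simp only [Matrix.sum_apply, Matrix.smul_apply, gamMat, Matrix.of_apply]
    exact linear_expand u' x (Gam u i j x).toLinearMap (X x)
  have h3 : derivMat X (transMat u u') x
      = ∑ c, theta u' c x (X x) • derivMat (dualFrame u' c) (transMat u u') x := by
    ext i j
    simp only [Matrix.sum_apply, Matrix.smul_apply, derivMat, Matrix.of_apply, smul_eq_mul]
    exact derivAlong_expand u' _ X x
  rw [h1, h2, h3]
  simp only [main, Finset.mul_sum, Finset.sum_mul, ← Finset.sum_add_distrib, Matrix.sum_apply,
    mul_smul_comm, smul_mul_assoc, ← smul_add, Matrix.smul_apply, smul_eq_mul]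

/-- The curvature forms transform tensorially. -/
theorem curvMat_eq (H : IsNullChange U u u') (hx : x ∈ U) (hX : SmoothFieldOn X U)
    (hY : SmoothFieldOn Y U) :
    curvMat u' X Y x = transMat u' u x * curvMat u X Y x * transMat u u' x := by
  have F := H.left
  have hU := F.isOpen
  have hB := H.smooth_trans'
  have hβ := H.smooth_trans
  have hd : ∀ {X Y : VField M}, SmoothFieldOn X U → SmoothFieldOn Y U →
      derivMat X (gamMat u' Y) x
      = ((derivMat X (transMat u' u) x * gamMat u Y x
            + transMat u' u x * derivMat X (gamMat u Y) x) * transMat u u' x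
          + transMat u' u x * gamMat u Y x * derivMat X (transMat u u') x)
        + (derivMat X (transMat u' u) x * derivMat Y (transMat u u') x
          + transMat u' u x * derivMat X (derivMat Y (transMat u u')) x) := by
    intro X Y hX hY
    have hG := F.gamMat_smooth hY
    have hD := hβ.derivMat F hY
    rw [derivMat_congr hU hx fun z hz => H.gamMat_eq hz Y,
      derivMat_add hU hx ((hB.mul hG).mul hβ) (hB.mul hD), derivMat_mul hU hx (hB.mul hG) hβ,
      derivMat_mul hU hx hB hG, derivMat_mul hU hx hB hD]
  -- The derivative of an inverse matrix. With it all first derivatives of β cancel in the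
  -- curvature, and the second derivatives cancel through the commutator `hc`.
  have hDB : ∀ X : VField M, derivMat X (transMat u' u) x
      = - (transMat u' u x * derivMat X (transMat u u') x * transMat u' u x) := by
    intro X
    have h := derivMat_congr (X := X) hU hx fun z _ => transMat_mul_transMat u' u z
    rw [derivMat_const, derivMat_mul hU hx hB hβ] at h
    have h' := congrArg (· * transMat u' u x) h
    simp only [add_mul, zero_mul, mul_assoc _ (transMat u u' x), transMat_mul_transMat,
      mul_one] at h'
    exact eq_neg_of_add_eq_zero_left h'
  have hc := derivMat_commutator F hx hX hY hβ
  rw [curvMat, hd hX hY, hd hY hX, hDB, hDB, H.gamMat_eq hx, H.gamMat_eq hx, H.gamMat_eq hx, ← hc,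
    curvMat]
  have h1 := transMat_mul_transMat u u' x
  have h2 : ∀ A, transMat u u' x * (transMat u' u x * A) = A := fun A => by
    rw [← mul_assoc, h1, one_mul]
  simp only [mul_add, add_mul, mul_sub, sub_mul, neg_mul, mul_assoc, h2]
  abel

end IsNullChange

end Gauge

section Kahler

variable {M : Type*} [TopologicalSpace M] [ChartedSpace E4 M] [IsManifold 𝓘(ℝ, E4) ∞ M]
variable {U V S : Set M} {f : M → ℝ} {X Y Z : VField M} {x : M} {u u' : (x : M) → Coframe x}
  {g : (x : M) → TangentSpace 𝓘(ℝ, E4) x →L[ℝ] TangentSpace 𝓘(ℝ, E4) x →L[ℝ] ℝ}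
  {K : (x : M) → TangentSpace 𝓘(ℝ, E4) x →L[ℝ] TangentSpace 𝓘(ℝ, E4) x} {P : ℝ}

/-! ### Algebraic symmetries of the curvature -/

theorem derivAlong_neg (X : VField M) (f : M → ℝ) (x : M) :
    derivAlong X (fun z => - f z) x = - derivAlong X f x :=
  congrArg (fun L : TangentSpace 𝓘(ℝ, E4) x →L[ℝ] ℝ => L (X x)) mfderiv_neg

theorem riem_swap (u : (x : M) → Coframe x) (a b c d : Fin 4) (x : M) :
    riem u a b c d x = - riem u a b d c x := by
  rw [riem_eq_curvMat, curvMat_swap, riem_eq_curvMat]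
  rfl

/-- The curvature matrix lies in the Lie algebra so(η), because Γ(X) and its derivatives do and the
algebra is closed under commutators. -/
theorem riem_metric (u : (x : M) → Coframe x) (a b c d : Fin 4) (x : M) :
    riem u (flip4 a) b c d x + riem u (flip4 b) a c d x = 0 := by
  have hD : ∀ X Y : VField M, eta * derivMat X (gamMat u Y) x
      + (derivMat X (gamMat u Y) x).transpose * eta = 0 := by
    intro X Y
    have h : ∀ A : Matrix (Fin 4) (Fin 4) ℝ, A.transpose * eta = (eta * A).transpose := by
      intro A
      rw [Matrix.transpose_mul, eta_transpose]
    ext i j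
    rw [h, Matrix.add_apply, Matrix.transpose_apply, eta_mul_apply, eta_mul_apply]
    have : (fun z => gamMat u Y z (flip4 j) i) = fun z => - gamMat u Y z (flip4 i) j := by
      funext z
      have := congrFun₂ (eta_gamMat u Y z) i j
      rw [h, Matrix.add_apply, Matrix.transpose_apply, eta_mul_apply, eta_mul_apply] at this
      exact eq_neg_of_add_eq_zero_right this
    simp only [derivMat, Matrix.of_apply, this, derivAlong_neg, Matrix.zero_apply]
    ring
  have hc : ∀ X Y : VField M, eta * curvMat u X Y x + (curvMat u X Y x).transpose * eta = 0 := by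
    intro X Y
    have h1 := hD X Y
    have h2 := hD Y X
    have h3 := eta_gamMat u (bracket X Y) x
    have h4 := eq_neg_of_add_eq_zero_right (eta_gamMat u X x)
    have h5 := eq_neg_of_add_eq_zero_right (eta_gamMat u Y x)
    simp only [curvMat, Matrix.transpose_add, Matrix.transpose_sub, Matrix.transpose_mul, mul_add,
      mul_sub, add_mul, sub_mul]
    rw [mul_assoc _ _ eta, mul_assoc _ _ eta, h4, h5, mul_neg, mul_neg, ← mul_assoc _ eta,
      ← mul_assoc _ eta, h4, h5, eq_neg_of_add_eq_zero_right h1, eq_neg_of_add_eq_zero_right h2,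
      eq_neg_of_add_eq_zero_right h3]
    noncomm_ring
  have h := congrFun₂ (hc (dualFrame u c) (dualFrame u d)) a b
  have h' : (curvMat u (dualFrame u c) (dualFrame u d) x).transpose * eta
      = (eta * curvMat u (dualFrame u c) (dualFrame u d) x).transpose := by
    rw [Matrix.transpose_mul, eta_transpose]
  rw [h', Matrix.add_apply, Matrix.transpose_apply, eta_mul_apply, eta_mul_apply] at h
  rwa [riem_eq_curvMat, riem_eq_curvMat]

/-- The classical argument: the four cyclic identities, one for each choice of the fixed index, are
added with signs and the two antisymmetries cancel everything but the pair exchange. -/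
theorem IsFrameOn.riem_pair (F : IsFrameOn U u) (hx : x ∈ U) (a b c d : Fin 4) :
    riem u (flip4 a) b c d x = riem u (flip4 c) d a b x := by
  have m := fun a b c d => riem_metric u a b c d x
  have s := fun a b c d => riem_swap u a b c d x
  have y := fun a b c d => F.riem_cyclic hx a b c d
  linarith [y (flip4 a) b c d, y (flip4 b) a c d, y (flip4 c) a b d, y (flip4 d) a b c,
    m a b c d, m a c b d, m a c d b, m a d b c, m b c a d, m b c d a, m b d a c, m b d c a,
    m c d a b, m a d c b, s (flip4 a) c b d, s (flip4 a) d b c, s (flip4 b) c a d, s (flip4 b) d a c,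
    s (flip4 c) d a b, s (flip4 c) b a d, s (flip4 c) a b d, s (flip4 d) a b c, s (flip4 d) b a c,
    s (flip4 d) c a b, s (flip4 a) b c d, s (flip4 b) a c d]

/-! ### Para-Kähler coframes -/

/-- A smooth null coframe field whose Levi-Civita connection preserves the splitting into the
spans of the first two and of the last two vectors of the dual frame: `Γ¹₄ = Γ⁴₁ = 0`. -/
structure IsKahlerFrameOn (U : Set M) (u : (x : M) → Coframe x) : Prop extends IsFrameOn U u where
  gamma_zero_three : ∀ x ∈ U, ∀ c, gammaCoef u 0 3 c x = 0
  gamma_three_zero : ∀ x ∈ U, ∀ c, gammaCoef u 3 0 c x = 0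

/-- The algebra so(2,2) has dimension six: metricity leaves Γ¹₁, Γ¹₂, Γ²₁, Γ²₂ and the two forms
Γ¹₄, Γ⁴₁ that mix the null planes. `riem_lower` is the same count for the curvature. -/
theorem gammaCoef_lower (u : (x : M) → Coframe x) (c : Fin 4) (x : M) :
    gammaCoef u 2 2 c x = - gammaCoef u 0 0 c x ∧ gammaCoef u 2 3 c x = - gammaCoef u 1 0 c x ∧
    gammaCoef u 3 2 c x = - gammaCoef u 0 1 c x ∧ gammaCoef u 3 3 c x = - gammaCoef u 1 1 c x ∧
    gammaCoef u 0 2 c x = 0 ∧ gammaCoef u 1 3 c x = 0 ∧ gammaCoef u 2 0 c x = 0 ∧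
    gammaCoef u 3 1 c x = 0 ∧ gammaCoef u 1 2 c x = - gammaCoef u 0 3 c x ∧
    gammaCoef u 2 1 c x = - gammaCoef u 3 0 c x := by
  have m := fun a b => gammaCoef_metric u a b c x
  refine ⟨?_, ?_, ?_, ?_, ?_, ?_, ?_, ?_, ?_, ?_⟩
  · have := m 0 2; simp [flip4] at this; linarith
  · have := m 0 3; simp [flip4] at this; linarith
  · have := m 1 2; simp [flip4] at this; linarith
  · have := m 1 3; simp [flip4] at this; linarith
  · have := m 2 2; simp [flip4] at this; linarith
  · have := m 3 3; simp [flip4] at this; linarith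
  · have := m 0 0; simp [flip4] at this; linarith
  · have := m 1 1; simp [flip4] at this; linarith
  · have := m 2 3; simp [flip4] at this; linarith
  · have := m 0 1; simp [flip4] at this; linarith

theorem riem_lower (u : (x : M) → Coframe x) (c d : Fin 4) (x : M) :
    riem u 2 2 c d x = - riem u 0 0 c d x ∧ riem u 2 3 c d x = - riem u 1 0 c d x ∧
    riem u 3 2 c d x = - riem u 0 1 c d x ∧ riem u 3 3 c d x = - riem u 1 1 c d x ∧
    riem u 0 2 c d x = 0 ∧ riem u 1 3 c d x = 0 ∧ riem u 2 0 c d x = 0 ∧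
    riem u 3 1 c d x = 0 ∧ riem u 1 2 c d x = - riem u 0 3 c d x ∧
    riem u 2 1 c d x = - riem u 3 0 c d x := by
  have m := fun a b => riem_metric u a b c d x
  refine ⟨?_, ?_, ?_, ?_, ?_, ?_, ?_, ?_, ?_, ?_⟩
  · have := m 0 2; simp [flip4] at this; linarith
  · have := m 0 3; simp [flip4] at this; linarith
  · have := m 1 2; simp [flip4] at this; linarith
  · have := m 1 3; simp [flip4] at this; linarith
  · have := m 2 2; simp [flip4] at this; linarith
  · have := m 3 3; simp [flip4] at this; linarith
  · have := m 0 0; simp [flip4] at this; linarith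
  · have := m 1 1; simp [flip4] at this; linarith
  · have := m 2 3; simp [flip4] at this; linarith
  · have := m 0 1; simp [flip4] at this; linarith

namespace IsKahlerFrameOn

theorem gamma_one_two (F : IsKahlerFrameOn U u) (hx : x ∈ U) (c : Fin 4) :
    gammaCoef u 1 2 c x = 0 := by
  have h := (gammaCoef_lower u c x).2.2.2.2.2.2.2.2.1
  rw [h, F.gamma_zero_three x hx, neg_zero]

theorem gamma_two_one (F : IsKahlerFrameOn U u) (hx : x ∈ U) (c : Fin 4) :
    gammaCoef u 2 1 c x = 0 := by
  have h := (gammaCoef_lower u c x).2.2.2.2.2.2.2.2.2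
  rw [h, F.gamma_three_zero x hx, neg_zero]

theorem mono (F : IsKahlerFrameOn U u) (hV : IsOpen V) (h : V ⊆ U) : IsKahlerFrameOn V u where
  toIsFrameOn := F.toIsFrameOn.mono hV h
  gamma_zero_three x hx := F.gamma_zero_three x (h hx)
  gamma_three_zero x hx := F.gamma_three_zero x (h hx)

/-- A connection with values in the block-diagonal subalgebra gl(2,ℝ) has curvature there too. -/
theorem riem_zero_three (F : IsKahlerFrameOn U u) (hx : x ∈ U) (c d : Fin 4) :
    riem u 0 3 c d x = 0 := by
  have h : ∀ c d, derivAlong (dualFrame u c) (gammaCoef u 0 3 d) x = 0 := fun c d => by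
    rw [derivAlong_congr F.isOpen hx fun z hz => F.gamma_zero_three z hz d, derivAlong_const]
  have l := fun c => gammaCoef_lower u c x
  simp only [IsFrameOn.riem_eq, h, Fin.sum_univ_four, F.gamma_zero_three x hx, (l _).2.2.2.2.1,
    (l _).2.2.2.2.2.1]
  ring

theorem riem_three_zero (F : IsKahlerFrameOn U u) (hx : x ∈ U) (c d : Fin 4) :
    riem u 3 0 c d x = 0 := by
  have h : ∀ c d, derivAlong (dualFrame u c) (gammaCoef u 3 0 d) x = 0 := fun c d => by
    rw [derivAlong_congr F.isOpen hx fun z hz => F.gamma_three_zero z hz d, derivAlong_const]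
  have l := fun c => gammaCoef_lower u c x
  simp only [IsFrameOn.riem_eq, h, Fin.sum_univ_four, F.gamma_three_zero x hx,
    (l _).2.2.2.2.2.2.1, (l _).2.2.2.2.2.2.2.1]
  ring

/-- The symmetries of the curvature of a para-Kähler coframe. -/
theorem riem_symm (F : IsKahlerFrameOn U u) (hx : x ∈ U) :
    (∀ a b, riem u a b 0 1 x = 0 ∧ riem u a b 2 3 x = 0 ∧ riem u a b 1 0 x = 0 ∧
      riem u a b 3 2 x = 0) ∧ (∀ a b c, riem u a b c c x = 0) ∧
    (∀ c d, riem u 1 2 c d x = 0 ∧ riem u 2 1 c d x = 0) ∧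
    riem u 0 0 0 3 x = riem u 1 0 0 2 x ∧ riem u 0 0 1 2 x = riem u 0 1 0 2 x ∧
    riem u 0 0 1 3 x = riem u 1 1 0 2 x ∧ riem u 1 0 1 2 x = riem u 0 1 0 3 x ∧
    riem u 1 0 1 3 x = riem u 1 1 0 3 x ∧ riem u 0 1 1 3 x = riem u 1 1 1 2 x ∧
    riem u 1 1 0 2 x = riem u 1 0 1 2 x := by
  have s := fun a b c d => riem_swap u a b c d x
  have l := fun c d => riem_lower u c d x
  have p := fun a b c d => F.riem_pair hx a b c d
  have z03 := fun c d => F.riem_zero_three hx c d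
  have z30 := fun c d => F.riem_three_zero hx c d
  have z12 : ∀ c d, riem u 1 2 c d x = 0 := fun c d => by
    rw [(l c d).2.2.2.2.2.2.2.2.1, z03, neg_zero]
  have z21 : ∀ c d, riem u 2 1 c d x = 0 := fun c d => by
    rw [(l c d).2.2.2.2.2.2.2.2.2, z30, neg_zero]
  -- Pair symmetry converts the vanishing of the off-block curvature forms Ω³₂ and Ω¹₄ into the
  -- absence of θ¹∧θ² and θ³∧θ⁴ components in every curvature form.
  have q01 : ∀ a b, riem u a b 0 1 x = 0 := fun a b => by
    have := p (flip4 a) b 0 1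
    rw [flip4_flip4] at this
    rw [this]; exact z21 _ _
  have q23 : ∀ a b, riem u a b 2 3 x = 0 := fun a b => by
    have := p (flip4 a) b 2 3
    rw [flip4_flip4] at this
    rw [this]; exact z03 _ _
  have c1 := F.riem_cyclic hx 1 0 1 2
  have c2 := q01 1 2
  refine ⟨fun a b => ⟨q01 a b, q23 a b, ?_, ?_⟩, fun a b c => ?_, fun c d => ⟨z12 c d, z21 c d⟩,
    ?_, ?_, ?_, ?_, ?_, ?_, ?_⟩
  · rw [s, q01, neg_zero]
  · rw [s, q23, neg_zero]
  · linarith [s a b c c]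
  · have := p 2 0 0 3; simp [flip4] at this
    linarith [(l 2 0).2.1, s 1 0 0 2]
  · have := p 2 0 1 2; simp [flip4] at this
    linarith [(l 2 0).2.2.1, s 0 1 0 2]
  · have := p 2 0 1 3; simp [flip4] at this
    linarith [(l 2 0).2.2.2.1, s 1 1 0 2]
  · have := p 3 0 1 2; simp [flip4] at this
    linarith [(l 3 0).2.2.1, s 0 1 0 3]
  · have := p 3 0 1 3; simp [flip4] at this
    linarith [(l 3 0).2.2.2.1, s 1 1 0 3]
  · have := p 2 1 1 3; simp [flip4] at this
    linarith [(l 2 1).2.2.2.1, s 1 1 1 2]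
  · linarith [s 1 1 0 2]

/-- The Ricci tensor of a para-Kähler coframe is given by the trace of the curvature forms. -/
theorem ricci_eq (F : IsKahlerFrameOn U u) (hx : x ∈ U) :
    ricci u 0 2 x = riem u 0 0 0 2 x + riem u 1 1 0 2 x ∧
    ricci u 0 3 x = riem u 0 0 0 3 x + riem u 1 1 0 3 x ∧
    ricci u 1 2 x = riem u 0 0 1 2 x + riem u 1 1 1 2 x ∧
    ricci u 1 3 x = riem u 0 0 1 3 x + riem u 1 1 1 3 x ∧
    (∀ a b, ricci u a b x = ricci u b a x) ∧ ricci u 0 0 x = 0 ∧ ricci u 0 1 x = 0 ∧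
    ricci u 1 1 x = 0 ∧ ricci u 2 2 x = 0 ∧ ricci u 2 3 x = 0 ∧ ricci u 3 3 x = 0 := by
  obtain ⟨q, d, z, e1, e2, e3, e4, e5, e6, e7⟩ := F.riem_symm hx
  have s := fun a b c d => riem_swap u a b c d x
  have l := fun c d => riem_lower u c d x
  have z03 := fun c d => F.riem_zero_three hx c d
  have z30 := fun c d => F.riem_three_zero hx c d
  have hs : ∀ a b, ricci u a b x = ricci u b a x := by
    intro a b
    have h : ∀ c, riem u c a c b x = riem u (flip4 c) b (flip4 c) a x := by
      intro c
      have := F.riem_pair hx (flip4 c) a c b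
      rwa [flip4_flip4] at this
    simp only [ricci, Fin.sum_univ_four]
    have h0 := h 0
    have h1 := h 1
    have h2 := h 2
    have h3 := h 3
    simp only [flip4, Matrix.cons_val] at h0 h1 h2 h3
    linarith
  refine ⟨?_, ?_, ?_, ?_, hs, ?_, ?_, ?_, ?_, ?_, ?_⟩ <;>
  simp only [ricci, Fin.sum_univ_four, d, z03, z30, (q _ _).1, (q _ _).2.1, (q _ _).2.2.1,
    (q _ _).2.2.2, (z _ _).1, (z _ _).2, (l _ _).2.2.2.2.1, (l _ _).2.2.2.2.2.1,
    (l _ _).2.2.2.2.2.2.1, (l _ _).2.2.2.2.2.2.2.1] <;> linarith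

end IsKahlerFrameOn

/-- The Einstein condition in a coframe. -/
def IsEinsteinAt (u : (x : M) → Coframe x) (x : M) : Prop :=
  ∀ a b, ricci u a b x - scal u x / 4 * eta a b = 0

/-- For an Einstein metric the Schouten tensor is (R/24) g, so the Weyl tensor differs from the
Riemann tensor by the constant-curvature term alone. -/
theorem IsEinsteinAt.weyl_eq (h : IsEinsteinAt u x) (a b c d : Fin 4) :
    weyl u a b c d x = riem u (flip4 a) b c d x
      + scal u x / 12 * (eta a d * eta b c - eta a c * eta b d) := by
  have he : ∑ e, eta a e * riem u e b c d x = riem u (flip4 a) b c d x := by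
    have := eta_mul_apply (Matrix.of fun e _ => riem u e b c d x) a 0
    rwa [Matrix.mul_apply] at this
  have hs : ∀ a b, eta a b = eta b a := fun a b => congrFun₂ eta_transpose b a
  have hp : ∀ a b, schouten u a b x = scal u x / 24 * eta a b := fun a b => by
    rw [schouten, sub_eq_zero.1 (h a b)]; ring
  rw [weyl, he, hp, hp, hp, hp, hs d b, hs d a, hs c b, hs c a]
  ring

namespace IsKahlerFrameOn

/-- The Riemann contribution to C₁₂₃₄ is a component of the off-block form Ω³₂ and vanishes; the
scalar curvature term is all that remains. -/
theorem psi2'_eq (F : IsKahlerFrameOn U u) (hx : x ∈ U) (h : IsEinsteinAt u x) :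
    psi2' u x = - scal u x / 12 := by
  rw [psi2', h.weyl_eq]
  have : riem u (flip4 0) 1 2 3 x = 0 := ((F.riem_symm hx).2.2.1 2 3).2
  rw [this]
  simp [eta]
  ring

/-- The components of the curvature of a para-Kähler-Einstein coframe. -/
theorem riem_eq_psi (F : IsKahlerFrameOn U u) (hx : x ∈ U) (h : IsEinsteinAt u x)
    (hP : psi2' u x = P) :
    (riem u 0 0 0 2 x = -2 * P - psi2 u x ∧ riem u 0 0 0 3 x = psi1 u x ∧
      riem u 0 0 1 2 x = - psi3 u x ∧ riem u 0 0 1 3 x = psi2 u x - P) ∧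
    (riem u 0 1 0 2 x = - psi3 u x ∧ riem u 0 1 0 3 x = psi2 u x - P ∧
      riem u 0 1 1 2 x = - psi4 u x ∧ riem u 0 1 1 3 x = psi3 u x) ∧
    (riem u 1 0 0 2 x = psi1 u x ∧ riem u 1 0 0 3 x = - psi0 u x ∧
      riem u 1 0 1 2 x = psi2 u x - P ∧ riem u 1 0 1 3 x = - psi1 u x) ∧
    (riem u 1 1 0 2 x = psi2 u x - P ∧ riem u 1 1 0 3 x = - psi1 u x ∧
      riem u 1 1 1 2 x = psi3 u x ∧ riem u 1 1 1 3 x = -2 * P - psi2 u x) := by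
  obtain ⟨q, d, z, e1, e2, e3, e4, e5, e6, e7⟩ := F.riem_symm hx
  obtain ⟨r02, r03, r12, r13, -⟩ := F.ricci_eq hx
  have l := fun c d => riem_lower u c d x
  have hs := F.psi2'_eq hx h
  have p0 : psi0 u x = - riem u 1 0 0 3 x := by
    rw [psi0, h.weyl_eq]; simp [eta, flip4, (l _ _).2.1]
  have p1 : psi1 u x = - riem u 1 1 0 3 x := by
    rw [psi1, h.weyl_eq]; simp [eta, flip4, (l _ _).2.2.2.1]
  have p2 : psi2 u x = riem u 1 0 1 2 x + P := by
    rw [psi2, h.weyl_eq]; simp [eta, flip4, (l _ _).2.1]; linarith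
  have p3 : psi3 u x = - riem u 0 1 0 2 x := by
    rw [psi3, h.weyl_eq]
    simp [eta, flip4, (l _ _).1]
    linarith
  have p4 : psi4 u x = - riem u 0 1 1 2 x := by
    rw [psi4, h.weyl_eq]; simp [eta, flip4, (l _ _).2.2.1]
  have t02 := h 0 2
  have t03 := h 0 3
  have t12 := h 1 2
  have t13 := h 1 3
  simp [eta] at t02 t03 t12 t13
  refine ⟨⟨?_, ?_, ?_, ?_⟩, ⟨?_, ?_, ?_, ?_⟩, ⟨?_, ?_, ?_, ?_⟩, ⟨?_, ?_, ?_, ?_⟩⟩ <;> linarith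

end IsKahlerFrameOn

end Kahler

section Adapted

variable {M : Type*} [TopologicalSpace M] [ChartedSpace E4 M] [IsManifold 𝓘(ℝ, E4) ∞ M]
variable {U V S : Set M} {f : M → ℝ} {X Y Z : VField M} {x : M} {u u' : (x : M) → Coframe x}
  {g : (x : M) → TangentSpace 𝓘(ℝ, E4) x →L[ℝ] TangentSpace 𝓘(ℝ, E4) x →L[ℝ] ℝ}
  {K : (x : M) → TangentSpace 𝓘(ℝ, E4) x →L[ℝ] TangentSpace 𝓘(ℝ, E4) x} {P : ℝ}

/-! ### Adapted coframes -/

/-- The eigenvalues of `K` on the dual frame of an adapted coframe. -/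
def sign4 (a : Fin 4) : ℝ := ![1, 1, -1, -1] a

namespace IsAdaptedAt

theorem metric_eq (h : IsAdaptedAt g K x (u x)) (v v' : TangentSpace 𝓘(ℝ, E4) x) :
    g x v v' = theta u 0 x v * theta u 2 x v' + theta u 2 x v * theta u 0 x v'
      + theta u 1 x v * theta u 3 x v' + theta u 3 x v * theta u 1 x v' := h.1 v v'

theorem theta_eq (h : IsAdaptedAt g K x (u x)) (a : Fin 4) (v : TangentSpace 𝓘(ℝ, E4) x) :
    theta u a x v = g x v (dualFrame u (flip4 a) x) := by
  rw [h.metric_eq]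
  simp only [theta_dualFrame]
  fin_cases a <;> simp [flip4, Matrix.one_apply]

theorem theta_K (h : IsAdaptedAt g K x (u x)) (a : Fin 4) (v : TangentSpace 𝓘(ℝ, E4) x) :
    theta u a x (K x v) = sign4 a * theta u a x v := by
  have := congrFun (h.2 v) a
  change (u x (K x v)) a = sign4 a * (u x v) a
  rw [this]
  fin_cases a <;> simp [sign4]

theorem K_dualFrame (h : IsAdaptedAt g K x (u x)) (a : Fin 4) :
    K x (dualFrame u a x) = sign4 a • dualFrame u a x := by
  rw [← sum_theta_smul_dualFrame u x (K x (dualFrame u a x))]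
  simp only [h.theta_K, theta_dualFrame, Matrix.one_apply]
  simp

end IsAdaptedAt

theorem IsAlmostParaHermitian.isFrameOn (H : IsAlmostParaHermitian S g K) (hU : IsOpen U)
    (hS : U ⊆ S) (hu : IsAdaptedOn g K U u) : IsFrameOn U u where
  isOpen := hU
  smooth := hu.1
  smooth_theta V hV hVo X hX a :=
    (H.smooth_g V hVo (hV.trans hS) X _ hX ((hu.1 (flip4 a)).mono hV)).congr
      fun x hx => (hu.2 x (hV hx)).theta_eq a (X x)

/-- Adapted coframes of a para-Kähler structure are para-Kähler coframes. -/
theorem IsParaKahler.isKahlerFrameOn (H : IsParaKahler S g K) (hU : IsOpen U)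
    (hS : U ⊆ S) (hu : IsAdaptedOn g K U u) : IsKahlerFrameOn U u := by
  have F := H.toIsAlmostParaHermitian.isFrameOn hU hS hu
  have E := fun z hz a => (hu.2 z hz).K_dualFrame a
  have T := fun z hz a v => (hu.2 z hz).theta_K a v
  have pos : ∀ x ∈ U, ∀ a, sign4 a = -1 → structFun u a 0 1 x = 0 := by
    intro x hx a ha
    have h := H.integrable_pos U hU hS _ _ (hu.1 0) (hu.1 1)
      (fun z hz => by rw [E z hz]; simp [sign4]) (fun z hz => by rw [E z hz]; simp [sign4]) x hx
    have h' := T x hx a (bracket (dualFrame u 0) (dualFrame u 1) x)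
    rw [h, ha] at h'
    rw [structFun]
    linarith
  have neg : ∀ x ∈ U, ∀ a, sign4 a = 1 → structFun u a 2 3 x = 0 := by
    intro x hx a ha
    have h := H.integrable_neg U hU hS _ _ (hu.1 2) (hu.1 3)
      (fun z hz => by rw [E z hz]; simp [sign4]) (fun z hz => by rw [E z hz]; simp [sign4]) x hx
    have h' := T x hx a (bracket (dualFrame u 2) (dualFrame u 3) x)
    rw [h, ha, map_neg] at h'
    rw [structFun]
    linarith
  -- In an adapted coframe the components of ρ are constant, so the derivative terms in dρ disappear
  -- and closedness becomes an algebraic relation between structure functions.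
  have closed : ∀ x ∈ U, ∀ a b c,
      g x (K x (bracket (dualFrame u a) (dualFrame u b) x)) (dualFrame u c x)
      + g x (K x (bracket (dualFrame u b) (dualFrame u c) x)) (dualFrame u a x)
      + g x (K x (bracket (dualFrame u c) (dualFrame u a) x)) (dualFrame u b x) = 0 := by
    intro x hx a b c
    have hc : ∀ a b c, derivAlong (dualFrame u a)
        (fun z => g z (K z (dualFrame u b z)) (dualFrame u c z)) x = 0 := by
      intro a b c
      have : ∀ z ∈ U, g z (K z (dualFrame u b z)) (dualFrame u c z)
          = sign4 b * (1 : Matrix (Fin 4) (Fin 4) ℝ) (flip4 c) b := by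
        intro z hz
        rw [← theta_dualFrame u (flip4 c) b z, (hu.2 z hz).theta_eq, flip4_flip4, E z hz, map_smul]
        rfl
      rw [derivAlong_congr hU hx this, derivAlong_const]
    have h := H.closed U hU hS _ _ _ (hu.1 a) (hu.1 b) (hu.1 c) x hx
    rw [hc, hc, hc] at h
    linarith
  have rho : ∀ x ∈ U, ∀ v c, g x (K x v) (dualFrame u c x)
      = sign4 (flip4 c) * theta u (flip4 c) x v := by
    intro x hx v c
    rw [← T x hx, (hu.2 x hx).theta_eq, flip4_flip4]
  have cyc : ∀ x ∈ U, ∀ a b c, sign4 (flip4 c) * structFun u (flip4 c) a b x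
      + sign4 (flip4 a) * structFun u (flip4 a) b c x
      + sign4 (flip4 b) * structFun u (flip4 b) c a x = 0 := by
    intro x hx a b c
    have := closed x hx a b c
    rwa [rho x hx, rho x hx, rho x hx] at this
  refine ⟨F, fun x hx c => ?_, fun x hx c => ?_⟩
  -- The Koszul expression for Γ¹₄(∂_c) is a closedness relation when ∂_c lies in the +1 eigenspace
  -- and an integrability condition when it lies in the −1 eigenspace. For Γ⁴₁ the roles are
  -- exchanged.
  · have n0 := neg x hx 0 (by simp [sign4])
    have n1 := neg x hx 1 (by simp [sign4])
    have s := fun a b c => structFun_swap u a b c x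
    have c0 := cyc x hx 0 2 3
    have c1 := cyc x hx 1 2 3
    fin_cases c <;> simp [gammaCoef, flip4, sign4] at * <;>
      linarith [s 0 3 0, s 2 3 2, s 1 2 0, s 1 0 2, s 0 3 1, s 3 3 2, s 1 2 1, s 0 3 2, s 0 2 3,
        s 1 2 2, s 1 3 3, s 0 3 3, s 1 3 2, s 1 2 3, s 2 2 3, s 3 2 3, s 0 1 3]
  · have n2 := pos x hx 2 (by simp [sign4])
    have n3 := pos x hx 3 (by simp [sign4])
    have s := fun a b c => structFun_swap u a b c x
    have c2 := cyc x hx 2 0 1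
    have c3 := cyc x hx 3 0 1
    fin_cases c <;> simp [gammaCoef, flip4, sign4] at * <;>
      linarith [s 3 0 0, s 3 0 1, s 2 1 0, s 2 1 1, s 2 0 1, s 3 0 2, s 0 0 1, s 2 1 2, s 3 0 3,
        s 1 0 1, s 2 1 3, s 1 1 0, s 0 1 0, s 3 2 0, s 2 2 1, s 3 3 0, s 2 3 1]

/-- Two smooth coframe fields that are adapted to the same almost para-Hermitian structure. -/
structure IsParaChange (U : Set M) (u u' : (x : M) → Coframe x) : Prop
    extends IsNullChange U u u' where
  block : ∀ x ∈ U, ∀ a b, sign4 a ≠ sign4 b → transMat u u' x a b = 0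

theorem IsAlmostParaHermitian.isParaChange (H : IsAlmostParaHermitian S g K) (hU : IsOpen U)
    (hS : U ⊆ S) (hu : IsAdaptedOn g K U u) (hu' : IsAdaptedOn g K U u') :
    IsParaChange U u u' where
  left := H.isFrameOn hU hS hu
  right := H.isFrameOn hU hS hu'
  metric x hx := by
    ext b c
    have h1 : ((transMat u u' x).transpose * eta * transMat u u' x) b c
        = g x (dualFrame u' b x) (dualFrame u' c x) := by
      rw [(hu.2 x hx).metric_eq]
      simp [Matrix.mul_apply, Fin.sum_univ_four, eta, transMat]
      ring
    rw [h1, (hu'.2 x hx).metric_eq]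
    simp only [theta_dualFrame]
    fin_cases b <;> fin_cases c <;> simp [eta, Matrix.one_apply]
  block x hx a b hab := by
    have h := (hu.2 x hx).theta_K a (dualFrame u' b x)
    rw [(hu'.2 x hx).K_dualFrame, map_smul, smul_eq_mul] at h
    have h' : (sign4 a - sign4 b) * transMat u u' x a b = 0 := by
      simp only [transMat, Matrix.of_apply]
      linarith
    exact (mul_eq_zero.1 h').resolve_left (sub_ne_zero.2 hab)

namespace IsNullChange

theorem trans_apply (H : IsNullChange U u u') (hx : x ∈ U) (a b : Fin 4) :
    transMat u' u x a b = transMat u u' x (flip4 b) (flip4 a) := by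
  have h := congrFun₂ (H.eta_mul hx) (flip4 a) b
  have h2 : (transMat u u' x).transpose * eta = (eta * transMat u u' x).transpose := by
    rw [Matrix.transpose_mul, eta_transpose]
  rwa [eta_mul_apply, flip4_flip4, h2, Matrix.transpose_apply, eta_mul_apply] at h

/-- The Ricci tensor transforms tensorially. -/
theorem ricci_eq (H : IsNullChange U u u') (hx : x ∈ U) (a b : Fin 4) :
    ricci u' a b x
      = ∑ f, ∑ h, transMat u u' x f a * transMat u u' x h b * ricci u f h x := by
  set β := transMat u u' x with hβ
  set B := transMat u' u x with hB
  have h1 : ∀ c, riem u' c a c b x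
      = ∑ g, β g c * (B * curvMat u (dualFrame u g) (dualFrame u' b) x * β) c a := by
    intro c
    rw [riem_eq_curvMat, H.curvMat_eq hx (H.right.smooth c) (H.right.smooth b),
      H.left.curvMat_expand_left hx (H.right.smooth c) (H.right.smooth b)]
    simp only [Matrix.mul_sum, Matrix.sum_mul, mul_smul_comm, smul_mul_assoc, Matrix.sum_apply,
      Matrix.smul_apply, smul_eq_mul]
    rfl
  have h2 : ∀ g, ∑ c, β g c * (B * curvMat u (dualFrame u g) (dualFrame u' b) x * β) c a
      = (curvMat u (dualFrame u g) (dualFrame u' b) x * β) g a := by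
    intro g
    rw [← Matrix.mul_apply, ← mul_assoc, ← mul_assoc, transMat_mul_transMat, one_mul]
  simp only [ricci, h1]
  rw [Finset.sum_comm]
  simp only [h2]
  simp only [Matrix.mul_apply]
  have h3 : ∀ g f, curvMat u (dualFrame u g) (dualFrame u' b) x g f
      = ∑ h, β h b * riem u g f g h x := by
    intro g f
    rw [H.left.curvMat_expand_right hx (H.left.smooth g) (H.right.smooth b)]
    simp only [Matrix.sum_apply, Matrix.smul_apply, smul_eq_mul, riem_eq_curvMat]
    rfl
  simp only [h3, Finset.sum_mul, Finset.mul_sum]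
  rw [Finset.sum_comm]
  refine Finset.sum_congr rfl fun f _ => ?_
  rw [Finset.sum_comm]
  exact Finset.sum_congr rfl fun h _ => Finset.sum_congr rfl fun g _ => by ring

theorem einstein (H : IsNullChange U u u') (hx : x ∈ U) (h : IsEinsteinAt u x) :
    IsEinsteinAt u' x ∧ scal u' x = scal u x := by
  have hr : ∀ a b, ricci u' a b x = scal u x / 4 * eta a b := by
    intro a b
    rw [H.ricci_eq hx, ← congrFun₂ (H.metric x hx) a b]
    simp only [sub_eq_zero.1 (h _ _), Matrix.mul_apply, Matrix.transpose_apply, Fin.sum_univ_four]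
    ring
  have hs : scal u' x = scal u x := by
    simp only [scal, hr]
    simp [Fin.sum_univ_four, eta]
    ring
  exact ⟨fun a b => by rw [hr, hs, sub_self], hs⟩

end IsNullChange

/-- The biquadratic form `g(V, R(V, A) A)` of the curvature. -/
def curvForm (u : (x : M) → Coframe x) (V A : VField M) (x : M) : ℝ :=
  dotProduct (fun a => theta u a x (V x))
    (Matrix.mulVec (eta * curvMat u V A x) fun b => theta u b x (A x))

theorem IsNullChange.curvForm_eq (H : IsNullChange U u u') (hx : x ∈ U) {V A : VField M}
    (hV : SmoothFieldOn V U) (hA : SmoothFieldOn A U) : curvForm u' V A x = curvForm u V A x := by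
  have h : ∀ X : VField M, (fun a => theta u a x (X x))
      = Matrix.mulVec (transMat u u' x) fun a => theta u' a x (X x) := by
    intro X
    funext a
    exact theta_eq_sum_transMat u u' a x (X x)
  rw [curvForm, curvForm, H.curvMat_eq hx hV hA, h V, h A, ← mul_assoc, ← mul_assoc, H.eta_mul hx,
    Matrix.mulVec_mulVec, Matrix.dotProduct_mulVec, Matrix.dotProduct_mulVec,
    ← Matrix.vecMul_transpose, Matrix.vecMul_vecMul]
  simp only [mul_assoc]

/-- V lies in the span of the first two frame vectors, and A is the vector in the span of the last
two that is orthogonal to V, determined up to the factor k. On such a pair the scalar curvature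
terms cancel and only Ψ₀, …, Ψ₄ remain. This describes the quartic without reference to a coframe,
and hence yields its transformation law. -/
theorem IsKahlerFrameOn.curvForm_eq (F : IsKahlerFrameOn U u) (hx : x ∈ U) (h : IsEinsteinAt u x)
    (hP : psi2' u x = P) {V A : VField M} (hV : SmoothFieldOn V U) (hA : SmoothFieldOn A U)
    {s t k : ℝ} (eV : (fun a => theta u a x (V x)) = ![s, t, 0, 0])
    (eA : (fun a => theta u a x (A x)) = ![0, 0, - (k * t), k * s]) :
    curvForm u V A x = k ^ 2 * weylQuartic u x s t := by
  obtain ⟨⟨a1, a2, a3, a4⟩, ⟨b1, b2, b3, b4⟩, ⟨c1, c2, c3, c4⟩, ⟨d1, d2, d3, d4⟩⟩ :=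
    F.riem_eq_psi hx h hP
  have l := fun c d => riem_lower u c d x
  have ec : ∀ i j, curvMat u V A x i j = s * -(k * t) * riem u i j 0 2 x
      + s * (k * s) * riem u i j 0 3 x + t * -(k * t) * riem u i j 1 2 x
      + t * (k * s) * riem u i j 1 3 x := by
    intro i j
    rw [F.curvMat_expand hx hV hA]
    have v : ∀ a, theta u a x (V x) = ![s, t, 0, 0] a := fun a => congrFun eV a
    have w : ∀ a, theta u a x (A x) = ![0, 0, - (k * t), k * s] a := fun a => congrFun eA a
    simp only [v, w, Fin.sum_univ_four]
    simp
    ring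
  rw [curvForm, eV, eA]
  simp only [Matrix.mulVec, dotProduct, Fin.sum_univ_four, eta_mul_apply, ec]
  simp [flip4]
  simp only [(l _ _).1, (l _ _).2.1, (l _ _).2.2.1, (l _ _).2.2.2.1, a1, a2, a3, a4, b1, b2, b3, b4,
    c1, c2, c3, c4, d1, d2, d3, d4, weylQuartic]
  ring

theorem sign4_ne : ∀ a b : Fin 4, (a < 2 ↔ ¬ b < 2) → sign4 a ≠ sign4 b := by
  intro a b h
  fin_cases a <;> fin_cases b <;> simp [sign4] at h ⊢ <;> norm_num

namespace IsParaChange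

/-- The metric identifies each null plane with the dual of the other, so the lower block of β is the
inverse transpose of the upper one, written here by cofactors. -/
theorem trans_entries (H : IsParaChange U u u') (hx : x ∈ U) {β : Matrix (Fin 4) (Fin 4) ℝ}
    (hβ : transMat u u' x = β) :
    β 0 0 * β 1 1 - β 0 1 * β 1 0 ≠ 0 ∧
    β 2 2 = (β 0 0 * β 1 1 - β 0 1 * β 1 0)⁻¹ * β 1 1 ∧
    β 2 3 = - ((β 0 0 * β 1 1 - β 0 1 * β 1 0)⁻¹ * β 1 0) ∧
    β 3 2 = - ((β 0 0 * β 1 1 - β 0 1 * β 1 0)⁻¹ * β 0 1) ∧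
    β 3 3 = (β 0 0 * β 1 1 - β 0 1 * β 1 0)⁻¹ * β 0 0 := by
  have b := fun a b h => H.block x hx a b h
  have m := fun a b => congrFun₂ (H.metric x hx) a b
  rw [hβ] at b m
  have m02 := m 0 2
  have m03 := m 0 3
  have m12 := m 1 2
  have m13 := m 1 3
  have z1 := b 2 0 (sign4_ne _ _ (by decide))
  have z2 := b 3 0 (sign4_ne _ _ (by decide))
  have z3 := b 2 1 (sign4_ne _ _ (by decide))
  have z4 := b 3 1 (sign4_ne _ _ (by decide))
  simp [Matrix.mul_apply, Fin.sum_univ_four, eta, z1, z2, z3, z4] at m02 m03 m12 m13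
  have hδ : β 0 0 * β 1 1 - β 0 1 * β 1 0 ≠ 0 := by
    intro h0
    -- The determinants of the two mutually dual blocks multiply to 1.
    have : (β 0 0 * β 1 1 - β 0 1 * β 1 0) * (β 2 2 * β 3 3 - β 2 3 * β 3 2) = 1 := by
      linear_combination (β 0 1 * β 2 3 + β 1 1 * β 3 3) * m02 + m13
        - (β 0 1 * β 2 2 + β 1 1 * β 3 2) * m03
    rw [h0, zero_mul] at this
    exact zero_ne_one this
  refine ⟨hδ, ?_, ?_, ?_, ?_⟩ <;> field_simp
  · linear_combination β 1 1 * m02 - β 1 0 * m12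
  · linear_combination β 1 1 * m03 - β 1 0 * m13
  · linear_combination β 0 0 * m12 - β 0 1 * m02
  · linear_combination β 0 0 * m13 - β 0 1 * m03

/-- The transformation law of the quartic that represents the anti-self-dual Weyl tensor. -/
theorem weylQuartic_eq (H : IsParaChange U u u') (F : IsKahlerFrameOn U u)
    (F' : IsKahlerFrameOn U u') (hx : x ∈ U) (h : IsEinsteinAt u x) (h' : IsEinsteinAt u' x)
    {β : Matrix (Fin 4) (Fin 4) ℝ} (hβ : transMat u u' x = β) (s t : ℝ) :
    weylQuartic u' x s t = (β 0 0 * β 1 1 - β 0 1 * β 1 0)⁻¹ ^ 2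
      * weylQuartic u x (s * β 0 0 + t * β 0 1) (s * β 1 0 + t * β 1 1) := by
  have V := SmoothFieldOn.add (SmoothFieldOn.smul (.const s) (F'.smooth 0))
    (SmoothFieldOn.smul (.const t) (F'.smooth 1))
  have A := SmoothFieldOn.add (SmoothFieldOn.smul (.const (-t)) (F'.smooth 2))
    (SmoothFieldOn.smul (.const s) (F'.smooth 3))
  obtain ⟨hδ, e22, e23, e32, e33⟩ := H.trans_entries hx hβ
  have b := fun a b h => H.block x hx a b h
  have hb : ∀ a b, theta u a x (dualFrame u' b x) = β a b := fun a b => by rw [← hβ]; rfl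
  rw [hβ] at b
  have h1 := F'.curvForm_eq hx h' rfl V A (s := s) (t := t) (k := 1)
    (by funext a; fin_cases a <;> simp [theta_dualFrame])
    (by funext a; fin_cases a <;> simp [theta_dualFrame])
  -- In the coframe u the field A is still orthogonal to V, and the inverse transpose block gives it
  -- the factor k = δ⁻¹, with δ the determinant of the upper block. This is the origin of the weight
  -- δ⁻².
  have h2 := F.curvForm_eq hx h rfl V A (s := s * β 0 0 + t * β 0 1)
    (t := s * β 1 0 + t * β 1 1) (k := (β 0 0 * β 1 1 - β 0 1 * β 1 0)⁻¹)
    (by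
      funext a
      simp only [map_add, map_smul, hb, smul_eq_mul]
      fin_cases a
      · simp
      · simp
      · simp [b 2 0 (sign4_ne _ _ (by decide)), b 2 1 (sign4_ne _ _ (by decide))]
      · simp [b 3 0 (sign4_ne _ _ (by decide)), b 3 1 (sign4_ne _ _ (by decide))])
    (by
      funext a
      simp only [map_add, map_smul, hb, smul_eq_mul]
      fin_cases a
      · simp [b 0 2 (sign4_ne _ _ (by decide)), b 0 3 (sign4_ne _ _ (by decide))]
      · simp [b 1 2 (sign4_ne _ _ (by decide)), b 1 3 (sign4_ne _ _ (by decide))]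
      · simp [e22, e23]; ring
      · simp [e32, e33]; ring)
  rw [← h2, ← H.curvForm_eq hx V A, h1]
  ring

/-- The transformation law of `Γ²₁` under changes of coframe with `β²₁ = 0`. -/
theorem gammaCoef_one_zero (H : IsParaChange U u u') (hx : x ∈ U)
    (h0 : ∀ z ∈ U, transMat u u' z 1 0 = 0) (c : Fin 4) :
    gammaCoef u' 1 0 c x = (transMat u u' x 1 1)⁻¹ * transMat u u' x 0 0
      * ∑ d, gammaCoef u 1 0 d x * transMat u u' x d c := by
  have h := congrFun₂ (H.gamMat_eq hx (dualFrame u' c)) 1 0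
  have b := fun a b h => H.block x hx a b h
  obtain ⟨hδ, e22, e23, e32, e33⟩ := H.trans_entries hx rfl
  have z := h0 x hx
  have t := fun b => H.trans_apply hx 1 b
  have t0 := t 0
  have t1 := t 1
  have t2 := t 2
  have t3 := t 3
  simp only [flip4, Matrix.cons_val] at t0 t1 t2 t3
  rw [e23, z, mul_zero, neg_zero] at t0
  rw [b 0 3 (sign4_ne _ _ (by decide))] at t2
  rw [b 1 3 (sign4_ne _ _ (by decide))] at t3
  rw [e33, z, mul_zero, sub_zero] at t1
  rw [z, mul_zero, sub_zero] at hδ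
  have h00 := left_ne_zero_of_mul hδ
  have h11 := right_ne_zero_of_mul hδ
  -- The relevant row of β⁻¹ has a single non-zero entry, so the inhomogeneous term involves only
  -- dβ²₁. It vanishes because β²₁ is zero on all of U, not merely at x.
  have hd : derivMat (dualFrame u' c) (transMat u u') x 1 0 = 0 := by
    have := derivAlong_congr (X := dualFrame u' c) H.left.isOpen hx h0
    rw [derivAlong_const] at this
    exact this
  have hG : gamMat u (dualFrame u' c) x 1 0
      = ∑ d, gammaCoef u 1 0 d x * transMat u u' x d c := Gam_apply u 1 0 x _
  have hG' : gamMat u' (dualFrame u' c) x 1 0 = gammaCoef u' 1 0 c x := Gam_dualFrame u' 1 0 c x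
  rw [hG', Matrix.add_apply, Matrix.mul_apply, Matrix.mul_apply] at h
  simp only [Matrix.mul_apply, Fin.sum_univ_four, t0, t1, t2, t3, z,
    b 2 0 (sign4_ne _ _ (by decide)), b 3 0 (sign4_ne _ _ (by decide)), hd] at h
  rw [h, hG]
  field_simp
  simp

end IsParaChange

end Adapted

section AdaptedExistence

variable {M : Type*} [TopologicalSpace M] [ChartedSpace E4 M] [IsManifold 𝓘(ℝ, E4) ∞ M]
variable {U V S : Set M} {f : M → ℝ} {X Y Z : VField M} {x : M} {u u' : (x : M) → Coframe x}
  {g : (x : M) → TangentSpace 𝓘(ℝ, E4) x →L[ℝ] TangentSpace 𝓘(ℝ, E4) x →L[ℝ] ℝ}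
  {K : (x : M) → TangentSpace 𝓘(ℝ, E4) x →L[ℝ] TangentSpace 𝓘(ℝ, E4) x} {P : ℝ}

/-! ### Construction of adapted coframes -/

/-- Every tangent vector extends to a smooth local vector field. -/
theorem exists_smoothFieldOn (x : M) (v : TangentSpace 𝓘(ℝ, E4) x) :
    ∃ X : VField M, SmoothFieldOn X (trivializationAt E4 (TangentSpace 𝓘(ℝ, E4)) x).baseSet ∧
      X x = v := by
  set e := trivializationAt E4 (TangentSpace 𝓘(ℝ, E4)) x
  have b : Module.Basis (Fin 4) ℝ E4 := (EuclideanSpace.basisFun (Fin 4) ℝ).toBasis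
  have h := e.isLocalFrameOn_localFrame_baseSet 𝓘(ℝ, E4) ∞ b
  have hx : x ∈ e.baseSet := FiberBundle.mem_baseSet_trivializationAt' x
  refine ⟨fun y => ∑ i, (h.toBasisAt hx).repr v i • e.localFrame b i y,
    SmoothFieldOn.sum fun i _ => .smul (.const _) (h.contMDiffOn i), ?_⟩
  conv_rhs => rw [← (h.toBasisAt hx).sum_repr v]
  simp [h.toBasisAt_coe]

theorem finrank_tangentSpace (x : M) :
    Fintype.card (Fin 4) = Module.finrank ℝ (TangentSpace 𝓘(ℝ, E4) x) :=
  (finrank_euclideanSpace (𝕜 := ℝ) (ι := Fin 4)).symm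

instance (x : M) : T2Space (TangentSpace 𝓘(ℝ, E4) x) := inferInstanceAs (T2Space E4)

/-- The coframe field whose dual frame consists of given vector fields. -/
def coframeOf (E : Fin 4 → VField M) (x : M) : Coframe x :=
  open Classical in
  if h : LinearIndependent ℝ (fun a => E a x) then
    (basisOfLinearIndependentOfCardEqFinrank h (finrank_tangentSpace x)).equivFunL
  else EuclideanSpace.equiv (Fin 4) ℝ

theorem dualFrame_coframeOf {E : Fin 4 → VField M} (h : LinearIndependent ℝ (fun a => E a x))
    (a : Fin 4) : dualFrame (coframeOf E) a x = E a x := by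
  have h1 : coframeOf E x
      = (basisOfLinearIndependentOfCardEqFinrank h (finrank_tangentSpace x)).equivFunL := dif_pos h
  rw [dualFrame, h1]
  change (basisOfLinearIndependentOfCardEqFinrank h (finrank_tangentSpace x)).equivFun.symm
    (Pi.single a 1) = E a x
  simp

/-- The `1`-form `v ↦ B(v, w)` of a bilinear form `B`. -/
def pairRight (B : TangentSpace 𝓘(ℝ, E4) x →L[ℝ] TangentSpace 𝓘(ℝ, E4) x →L[ℝ] ℝ)
    (w : TangentSpace 𝓘(ℝ, E4) x) : TangentSpace 𝓘(ℝ, E4) x →L[ℝ] ℝ :=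
  ContinuousLinearMap.flip (E := E4) (F := E4) B w

theorem isAdaptedAt_of_dualFrame (hg : ∀ a b, g x (dualFrame u a x) (dualFrame u b x) = eta a b)
    (hK : ∀ a, K x (dualFrame u a x) = sign4 a • dualFrame u a x) : IsAdaptedAt g K x (u x) := by
  have key : ∀ v a, u x v a = theta u a x v := fun _ _ => rfl
  constructor
  · intro v v'
    have h1 : g x v v' = ∑ c, theta u c x v * g x (dualFrame u c x) v' :=
      linear_expand u x (pairRight (g x) v').toLinearMap v
    have h2 : ∀ c, g x (dualFrame u c x) v'
        = ∑ d, theta u d x v' * g x (dualFrame u c x) (dualFrame u d x) := fun c =>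
      linear_expand u x (g x (dualFrame u c x)).toLinearMap v'
    simp only [h1, h2, hg, key, Fin.sum_univ_four]
    simp [eta]
    ring
  · intro v
    have h := linear_expand u x (K x).toLinearMap v
    simp only [ContinuousLinearMap.coe_coe, hK] at h
    funext a
    rw [key, h]
    simp only [map_sum, map_smul, theta_dualFrame, key]
    fin_cases a <;> simp [sign4, Matrix.one_apply]

theorem exists_isAdaptedOn {E : Fin 4 → VField M} (hE : ∀ a, SmoothFieldOn (E a) U)
    (hg : ∀ x ∈ U, ∀ a b, g x (E a x) (E b x) = eta a b)
    (hK : ∀ x ∈ U, ∀ a, K x (E a x) = sign4 a • E a x) :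
    ∃ u : (x : M) → Coframe x, IsAdaptedOn g K U u ∧ ∀ x ∈ U, ∀ a, dualFrame u a x = E a x := by
  have hi : ∀ x ∈ U, LinearIndependent ℝ (fun a => E a x) := by
    intro x hx
    rw [Fintype.linearIndependent_iff]
    intro c hc i
    have hL : ∀ L : TangentSpace 𝓘(ℝ, E4) x →L[ℝ] ℝ, ∑ a, c a * L (E a x) = 0 := by
      intro L
      have := congrArg L hc
      simpa using this
    -- Pairing a linear relation with `E (flip4 i)` isolates the coefficient `c i`, since the Gram
    -- matrix is η.
    have h1 : ∑ a, c a * g x (E a x) (E (flip4 i) x) = 0 := hL (pairRight (g x) (E (flip4 i) x))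
    simp only [hg x hx, Fin.sum_univ_four] at h1
    fin_cases i <;> simpa [eta, flip4] using h1
  have hd : ∀ x ∈ U, ∀ a, dualFrame (coframeOf E) a x = E a x := fun x hx a =>
    dualFrame_coframeOf (hi x hx) a
  refine ⟨coframeOf E, ⟨fun a => (hE a).congr fun x hx => hd x hx a, fun x hx =>
    isAdaptedAt_of_dualFrame (fun a b => ?_) fun a => ?_⟩, hd⟩
  · rw [hd x hx, hd x hx, hg x hx]
  · rw [hd x hx, hK x hx]

theorem exists_isAdaptedOn_of_fields {E₀ E₁ E₂ E₃ : VField M} (h₀ : SmoothFieldOn E₀ U)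
    (h₁ : SmoothFieldOn E₁ U) (h₂ : SmoothFieldOn E₂ U) (h₃ : SmoothFieldOn E₃ U)
    (hs : ∀ x ∈ U, ∀ v w, g x v w = g x w v)
    (hn : ∀ x ∈ U, g x (E₀ x) (E₀ x) = 0 ∧ g x (E₀ x) (E₁ x) = 0 ∧ g x (E₁ x) (E₁ x) = 0 ∧
      g x (E₂ x) (E₂ x) = 0 ∧ g x (E₂ x) (E₃ x) = 0 ∧ g x (E₃ x) (E₃ x) = 0)
    (hg : ∀ x ∈ U, g x (E₀ x) (E₂ x) = 1 ∧ g x (E₀ x) (E₃ x) = 0 ∧ g x (E₁ x) (E₂ x) = 0 ∧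
      g x (E₁ x) (E₃ x) = 1)
    (hK : ∀ x ∈ U, K x (E₀ x) = E₀ x ∧ K x (E₁ x) = E₁ x ∧ K x (E₂ x) = - E₂ x ∧
      K x (E₃ x) = - E₃ x) :
    ∃ u : (x : M) → Coframe x, IsAdaptedOn g K U u ∧ ∀ x ∈ U, dualFrame u 0 x = E₀ x ∧
      dualFrame u 1 x = E₁ x ∧ dualFrame u 2 x = E₂ x ∧ dualFrame u 3 x = E₃ x := by
  have main := exists_isAdaptedOn (g := g) (K := K) (U := U) (E := ![E₀, E₁, E₂, E₃])
  obtain ⟨u, h, hd⟩ := main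
    (by
      intro a
      fin_cases a
      exacts [h₀, h₁, h₂, h₃])
    (by
      intro x hx a b
      obtain ⟨n1, n2, n3, n4, n5, n6⟩ := hn x hx
      obtain ⟨g1, g2, g3, g4⟩ := hg x hx
      have s := hs x hx
      fin_cases a <;> fin_cases b
      exacts [n1, n2, g1, g2, (s _ _).trans n2, n3, g3, g4, (s _ _).trans g1, (s _ _).trans g3,
        n4, n5, (s _ _).trans g2, (s _ _).trans g4, (s _ _).trans n5, n6])
    (by
      intro x hx a
      obtain ⟨k0, k1, k2, k3⟩ := hK x hx
      fin_cases a
      exacts [k0.trans (one_smul ℝ _).symm, k1.trans (one_smul ℝ _).symm,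
        k2.trans (neg_one_smul ℝ _).symm, k3.trans (neg_one_smul ℝ _).symm])
  exact ⟨u, h, fun x hx => ⟨hd x hx 0, hd x hx 1, hd x hx 2, hd x hx 3⟩⟩

/-- The change of adapted coframe with given coefficients. -/
theorem IsAdaptedOn.exists_change (hu : IsAdaptedOn g K U u) {p q r m : M → ℝ}
    (hp : SmoothFunOn p U) (hq : SmoothFunOn q U) (hr : SmoothFunOn r U) (hm : SmoothFunOn m U)
    (h0 : ∀ x ∈ U, p x * m x - q x * r x ≠ 0) :
    ∃ u' : (x : M) → Coframe x, IsAdaptedOn g K U u' ∧ ∀ x ∈ U, transMat u u' x 0 0 = p x ∧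
      transMat u u' x 0 1 = q x ∧ transMat u u' x 1 0 = r x ∧ transMat u u' x 1 1 = m x := by
  obtain ⟨d, hd, hd1⟩ : ∃ d : M → ℝ, SmoothFunOn d U ∧ ∀ x ∈ U, (p x * m x - q x * r x) * d x = 1 :=
    ⟨fun x => (p x * m x - q x * r x)⁻¹, ((hp.mul hm).sub (hq.mul hr)).inv h0,
      fun x hx => mul_inv_cancel₀ (h0 x hx)⟩
  have hgab : ∀ x ∈ U, ∀ a b, g x (dualFrame u a x) (dualFrame u b x) = eta a b := by
    intro x hx a b
    rw [(hu.2 x hx).metric_eq]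
    fin_cases a <;> fin_cases b <;> simp [theta_dualFrame, eta]
  -- E₂ and E₃ form the basis of the −1 eigenspace that is dual under g to E₀ and E₁: their
  -- coefficients are the inverse transpose of the upper block, with d the inverse of its
  -- determinant.
  have main := exists_isAdaptedOn_of_fields (g := g) (K := K) (U := U)
    (E₀ := fun x => p x • dualFrame u 0 x + r x • dualFrame u 1 x)
    (E₁ := fun x => q x • dualFrame u 0 x + m x • dualFrame u 1 x)
    (E₂ := fun x => (d x * m x) • dualFrame u 2 x + (d x * - q x) • dualFrame u 3 x)
    (E₃ := fun x => (d x * - r x) • dualFrame u 2 x + (d x * p x) • dualFrame u 3 x)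
    ((SmoothFieldOn.smul hp (hu.1 0)).add (SmoothFieldOn.smul hr (hu.1 1)))
    ((SmoothFieldOn.smul hq (hu.1 0)).add (SmoothFieldOn.smul hm (hu.1 1)))
    ((SmoothFieldOn.smul (hd.mul hm) (hu.1 2)).add (SmoothFieldOn.smul (hd.mul hq.neg) (hu.1 3)))
    ((SmoothFieldOn.smul (hd.mul hr.neg) (hu.1 2)).add (SmoothFieldOn.smul (hd.mul hp) (hu.1 3)))
    (fun x hx v w => by rw [(hu.2 x hx).metric_eq, (hu.2 x hx).metric_eq]; ring)
    (fun x hx => by simp [hgab x hx, eta])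
    (fun x hx => by
      have h := hd1 x hx
      simp only [map_add, map_smul, add_apply, smul_apply,
        hgab x hx, smul_eq_mul]
      simp [eta]
      refine ⟨?_, ?_, ?_, ?_⟩
      · linear_combination h
      · ring
      · ring
      · linear_combination h)
    (fun x hx => by
      simp only [map_add, map_smul, (hu.2 x hx).K_dualFrame]
      simp [sign4]
      constructor <;> abel)
  obtain ⟨u', h1, h2⟩ := main
  refine ⟨u', h1, fun x hx => ?_⟩
  obtain ⟨e0, e1, -⟩ := h2 x hx
  simp only [transMat, Matrix.of_apply, e0, e1, map_add, map_smul, theta_dualFrame]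
  simp

theorem IsAdaptedOn.mono (hu : IsAdaptedOn g K U u) (h : V ⊆ U) : IsAdaptedOn g K V u :=
  ⟨fun a => (hu.1 a).mono h, fun x hx => hu.2 x (h hx)⟩

instance (x : M) : FiniteDimensional ℝ (TangentSpace 𝓘(ℝ, E4) x) :=
  inferInstanceAs (FiniteDimensional ℝ E4)

theorem exists_eigenbasis {A : TangentSpace 𝓘(ℝ, E4) x →L[ℝ] TangentSpace 𝓘(ℝ, E4) x} {c : ℝ}
    (h : Module.finrank ℝ (Module.End.eigenspace
      (A : TangentSpace 𝓘(ℝ, E4) x →ₗ[ℝ] TangentSpace 𝓘(ℝ, E4) x) c) = 2) :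
    ∃ p q, A p = c • p ∧ A q = c • q ∧ (∀ v, A v = c • v → ∃ a b : ℝ, v = a • p + b • q) ∧
      ∀ a b : ℝ, a • p + b • q = 0 → a = 0 ∧ b = 0 := by
  set b := Module.finBasisOfFinrankEq ℝ _ h
  have hm : ∀ i, A (b i) = c • (b i : TangentSpace 𝓘(ℝ, E4) x) := fun i =>
    Module.End.mem_eigenspace_iff.1 (b i).2
  refine ⟨b 0, b 1, hm 0, hm 1, fun v hv => ?_, fun s t hst => ?_⟩
  · have h1 := b.sum_repr ⟨v, Module.End.mem_eigenspace_iff.2 hv⟩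
    rw [Fin.sum_univ_two] at h1
    exact ⟨_, _, (congrArg Subtype.val h1).symm⟩
  · have h1 := Fintype.linearIndependent_iff.1 b.linearIndependent ![s, t]
      (Subtype.ext (by simpa using hst))
    exact ⟨by simpa using h1 0, by simpa using h1 1⟩

namespace IsAlmostParaHermitian

/-- Any smooth extension of p can be pushed into the eigendistribution by the projector (1 + cK)/2,
which fixes p. -/
theorem exists_eigenfield (H : IsAlmostParaHermitian S g K) (hS : IsOpen S) (x : M) {c : ℝ}
    (hc : c * c = 1) {p : TangentSpace 𝓘(ℝ, E4) x} (hp : K x p = c • p) :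
    ∃ Y : VField M, SmoothFieldOn Y
        (S ∩ (trivializationAt E4 (TangentSpace 𝓘(ℝ, E4)) x).baseSet) ∧ Y x = p ∧
      ∀ y ∈ S ∩ (trivializationAt E4 (TangentSpace 𝓘(ℝ, E4)) x).baseSet,
        K y (Y y) = c • Y y := by
  obtain ⟨X, h1, h2⟩ := exists_smoothFieldOn x p
  replace h1 := SmoothFieldOn.mono h1 (Set.inter_subset_right (s := S))
  refine ⟨fun y => (1 / 2 : ℝ) • X y + (c / 2) • K y (X y), ?_, ?_, fun y hy => ?_⟩
  · exact (SmoothFieldOn.smul (.const _) h1).add (SmoothFieldOn.smul (.const _)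
      (H.smooth_K _ (hS.inter (trivializationAt E4 _ x).open_baseSet) Set.inter_subset_left _ h1))
  · change (1 / 2 : ℝ) • X x + (c / 2) • K x (X x) = p
    rw [h2, hp, smul_smul, ← add_smul]
    convert one_smul ℝ p
    linear_combination hc / 2
  · change K y ((1 / 2 : ℝ) • X y + (c / 2) • K y (X y)) = _
    rw [map_add, map_smul, map_smul, H.K_sq y hy.1, smul_add, smul_smul, smul_smul,
      show c * (c / 2) = 1 / 2 by linear_combination hc / 2]
    module

/-- Here g(Kv, Kw) = c² g(v, w) = g(v, w), whereas compatibility makes it −g(v, w). -/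
theorem null (H : IsAlmostParaHermitian S g K) (hx : x ∈ S) {c : ℝ} (hc : c * c = 1)
    {v w : TangentSpace 𝓘(ℝ, E4) x} (hv : K x v = c • v) (hw : K x w = c • w) : g x v w = 0 := by
  have h1 := H.compatible x hx v w
  have h2 : g x (c • v) (c • w) = c * (c * g x v w) := by simp
  rw [hv, hw, h2] at h1
  linear_combination (h1 - g x v w * hc) / 2

/-- Adapted coframes exist locally. -/
theorem exists_adapted (H : IsAlmostParaHermitian S g K) (hS : IsOpen S) (hx : x ∈ S) :
    ∃ U : Set M, IsOpen U ∧ x ∈ U ∧ U ⊆ S ∧ ∃ u : (x : M) → Coframe x, IsAdaptedOn g K U u := by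
  obtain ⟨p, q, hp, hq, hpq, ipq⟩ := exists_eigenbasis (H.rank_pos x hx)
  obtain ⟨r, s, hr, hs, hrs, -⟩ := exists_eigenbasis (H.rank_neg x hx)
  have c1 : (1 : ℝ) * 1 = 1 := by norm_num
  have c2 : (-1 : ℝ) * -1 = 1 := by norm_num
  obtain ⟨Y0, s0, e0, k0⟩ := H.exists_eigenfield hS x c1 hp
  obtain ⟨Y1, s1, e1, k1⟩ := H.exists_eigenfield hS x c1 hq
  obtain ⟨Y2, s2, e2, k2⟩ := H.exists_eigenfield hS x c2 hr
  obtain ⟨Y3, s3, e3, k3⟩ := H.exists_eigenfield hS x c2 hs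
  set B := S ∩ (trivializationAt E4 (TangentSpace 𝓘(ℝ, E4)) x).baseSet
  have hB : IsOpen B := hS.inter (trivializationAt E4 _ x).open_baseSet
  have hxB : x ∈ B := ⟨hx, FiberBundle.mem_baseSet_trivializationAt' x⟩
  have hBS : B ⊆ S := Set.inter_subset_left
  have m02 := H.smooth_g B hB hBS _ _ s0 s2
  have m03 := H.smooth_g B hB hBS _ _ s0 s3
  have m12 := H.smooth_g B hB hBS _ _ s1 s2
  have m13 := H.smooth_g B hB hBS _ _ s1 s3
  have hD := (m02.mul m13).sub (m03.mul m12)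
  -- A combination of p and q orthogonal to r and s is orthogonal to every w: w splits into its two
  -- eigencomponents, and the plane of p and q is null.
  have key : ∀ a b : ℝ, a * g x p r + b * g x q r = 0 → a * g x p s + b * g x q s = 0 →
      a = 0 ∧ b = 0 := by
    intro a b h2 h3
    refine ipq a b (H.nondegenerate x hx _ fun w => ?_)
    obtain ⟨a1, a2, ha⟩ := hpq ((1 / 2 : ℝ) • (w + K x w)) (by
      rw [map_smul, map_add, H.K_sq x hx]; module)
    obtain ⟨b1, b2, hb⟩ := hrs ((1 / 2 : ℝ) • (w - K x w)) (by
      rw [map_smul, map_sub, H.K_sq x hx]; module)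
    have hw : w = (a1 • p + a2 • q) + (b1 • r + b2 • s) := by
      rw [← ha, ← hb]; module
    rw [hw]
    simp [H.null hx c1 hp hp, H.null hx c1 hp hq, H.null hx c1 hq hp, H.null hx c1 hq hq]
    linear_combination b1 * h2 + b2 * h3
  set D := fun y => g y (Y0 y) (Y2 y) * g y (Y1 y) (Y3 y)
    - g y (Y0 y) (Y3 y) * g y (Y1 y) (Y2 y) with hDd
  have hDx : D x ≠ 0 := by
    intro h0
    simp only [hDd, e0, e1, e2, e3] at h0
    -- If the determinant of the pairing vanished, the cofactor vectors would satisfy the relations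
    -- of `key`, so every entry of the pairing would be zero. Then (1, 0) would satisfy them too,
    -- which is absurd.
    obtain ⟨z1, z2⟩ := key (g x q r) (- g x p r) (by ring) (by linear_combination - h0)
    obtain ⟨z3, z4⟩ := key (g x q s) (- g x p s) (by linear_combination h0) (by ring)
    have := (key 1 0 (by linear_combination - z2) (by linear_combination - z4)).1
    norm_num at this
  have hUo := hD.isOpen_ne_zero hB
  have hUB : {y | y ∈ B ∧ D y ≠ 0} ⊆ B := fun y hy => hy.1
  have hDi : SmoothFunOn (fun y => (D y)⁻¹) {y | y ∈ B ∧ D y ≠ 0} :=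
    (hD.mono hUB).inv fun y hy => hy.2
  replace m02 := m02.mono hUB
  replace m03 := m03.mono hUB
  replace m12 := m12.mono hUB
  replace m13 := m13.mono hUB
  replace s0 := s0.mono hUB
  replace s1 := s1.mono hUB
  replace s2 := s2.mono hUB
  replace s3 := s3.mono hUB
  -- The inverse of the 2×2 pairing matrix replaces Y2, Y3 by the basis dual to Y0, Y1. It is smooth
  -- where the determinant D is non-zero, a neighbourhood of x.
  have main := exists_isAdaptedOn_of_fields (g := g) (K := K) (U := {y | y ∈ B ∧ D y ≠ 0})
    (E₂ := fun y => ((D y)⁻¹ * g y (Y1 y) (Y3 y)) • Y2 y + ((D y)⁻¹ * - g y (Y1 y) (Y2 y)) • Y3 y)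
    (E₃ := fun y => ((D y)⁻¹ * - g y (Y0 y) (Y3 y)) • Y2 y + ((D y)⁻¹ * g y (Y0 y) (Y2 y)) • Y3 y)
    s0 s1
    ((SmoothFieldOn.smul (hDi.mul m13) s2).add (SmoothFieldOn.smul (hDi.mul m12.neg) s3))
    ((SmoothFieldOn.smul (hDi.mul m03.neg) s2).add (SmoothFieldOn.smul (hDi.mul m02) s3))
    (fun y hy => H.symm y (hBS hy.1))
    (fun y hy => by
      have hyS := hBS hy.1
      have e2 := k2 y hy.1
      have e3 := k3 y hy.1
      refine ⟨H.null hyS c1 (k0 y hy.1) (k0 y hy.1), H.null hyS c1 (k0 y hy.1) (k1 y hy.1),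
        H.null hyS c1 (k1 y hy.1) (k1 y hy.1), H.null hyS c2 ?_ ?_, H.null hyS c2 ?_ ?_,
        H.null hyS c2 ?_ ?_⟩ <;>
      · rw [map_add, map_smul, map_smul, e2, e3]
        module)
    (fun y hy => by
      have h : (D y)⁻¹ * (g y (Y0 y) (Y2 y) * g y (Y1 y) (Y3 y)
        - g y (Y0 y) (Y3 y) * g y (Y1 y) (Y2 y)) = 1 := inv_mul_cancel₀ hy.2
      simp only [map_add, map_smul, smul_eq_mul]
      refine ⟨?_, ?_, ?_, ?_⟩
      · linear_combination h
      · ring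
      · ring
      · linear_combination h)
    (fun y hy => by
      have e0 := k0 y hy.1
      have e1 := k1 y hy.1
      have e2 := k2 y hy.1
      have e3 := k3 y hy.1
      rw [one_smul] at e0 e1
      rw [neg_one_smul] at e2 e3
      refine ⟨e0, e1, ?_, ?_⟩ <;>
      · rw [map_add, map_smul, map_smul, e2, e3]
        module)
  obtain ⟨u, hu, -⟩ := main
  exact ⟨_, hUo, ⟨hxB, hDx⟩, fun y hy => hBS hy.1, u, hu⟩

end IsAlmostParaHermitian

end AdaptedExistence

section TripleRoot

variable {M : Type*} [TopologicalSpace M] [ChartedSpace E4 M] [IsManifold 𝓘(ℝ, E4) ∞ M]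
variable {U V S : Set M} {f : M → ℝ} {X Y Z : VField M} {x : M} {u u' : (x : M) → Coframe x}
  {g : (x : M) → TangentSpace 𝓘(ℝ, E4) x →L[ℝ] TangentSpace 𝓘(ℝ, E4) x →L[ℝ] ℝ}
  {K : (x : M) → TangentSpace 𝓘(ℝ, E4) x →L[ℝ] TangentSpace 𝓘(ℝ, E4) x} {P : ℝ}

/-! ### Coframes adapted to the triple root -/

/-- A binary quartic has five coefficients and is determined by its values at five pairwise
non-proportional points. -/
theorem quartic_coeff {a₀ a₁ a₂ a₃ a₄ b₀ b₁ b₂ b₃ b₄ : ℝ}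
    (h : ∀ s t : ℝ, a₄ * t ^ 4 + 4 * a₃ * (t ^ 3 * s) + 6 * a₂ * (t ^ 2 * s ^ 2)
        + 4 * a₁ * (t * s ^ 3) + a₀ * s ^ 4
      = b₄ * t ^ 4 + 4 * b₃ * (t ^ 3 * s) + 6 * b₂ * (t ^ 2 * s ^ 2)
        + 4 * b₁ * (t * s ^ 3) + b₀ * s ^ 4) :
    a₀ = b₀ ∧ a₁ = b₁ ∧ a₂ = b₂ ∧ a₃ = b₃ ∧ a₄ = b₄ := by
  have h1 := h 1 0
  have h2 := h 0 1
  have h3 := h 1 1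
  have h4 := h 1 (-1)
  have h5 := h 1 2
  norm_num at h1 h2 h3 h4 h5
  refine ⟨?_, ?_, ?_, ?_, ?_⟩ <;> linarith

namespace IsFrameOn

theorem ricci_smooth (F : IsFrameOn U u) (a b : Fin 4) : SmoothFunOn (ricci u a b) U :=
  SmoothFunOn.sum fun _ _ => F.riem_smooth _ _ _ _

theorem scal_smooth (F : IsFrameOn U u) : SmoothFunOn (scal u) U :=
  SmoothFunOn.sum fun _ _ => SmoothFunOn.sum fun _ _ => (SmoothFunOn.const _).mul (F.ricci_smooth _ _)

theorem schouten_smooth (F : IsFrameOn U u) (a b : Fin 4) : SmoothFunOn (schouten u a b) U :=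
  ((F.ricci_smooth a b).mul (.const (1 / 2))).sub ((F.scal_smooth.mul (.const (1 / 12))).mul (.const _))
    |>.congr fun x _ => by simp only [schouten]; ring

theorem weyl_smooth (F : IsFrameOn U u) (a b c d : Fin 4) : SmoothFunOn (weyl u a b c d) U :=
  ((((SmoothFunOn.sum fun _ _ => (SmoothFunOn.const _).mul (F.riem_smooth _ _ _ _)).add
    ((SmoothFunOn.const _).mul (F.schouten_smooth _ _))).sub
    ((SmoothFunOn.const _).mul (F.schouten_smooth _ _))).add
    ((SmoothFunOn.const _).mul (F.schouten_smooth _ _))).sub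
    ((SmoothFunOn.const _).mul (F.schouten_smooth _ _))

end IsFrameOn

namespace IsPKE

theorem einsteinAt (H : IsPKE S g K P) (hU : IsOpen U) (hS : U ⊆ S) (hu : IsAdaptedOn g K U u)
    (hx : x ∈ U) : IsEinsteinAt u x := H.einstein U hU hS u hu x hx

/-- The transformation law of the quartic under a change of adapted coframe. -/
theorem weylQuartic_eq (H : IsPKE S g K P) (hU : IsOpen U) (hS : U ⊆ S)
    (hu : IsAdaptedOn g K U u) (hu' : IsAdaptedOn g K U u') (hx : x ∈ U)
    {β : Matrix (Fin 4) (Fin 4) ℝ} (hβ : transMat u u' x = β) (s t : ℝ) :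
    weylQuartic u' x s t = (β 0 0 * β 1 1 - β 0 1 * β 1 0)⁻¹ ^ 2
      * weylQuartic u x (s * β 0 0 + t * β 0 1) (s * β 1 0 + t * β 1 1) :=
  (H.isParaChange hU hS hu hu').weylQuartic_eq (H.isKahlerFrameOn hU hS hu)
    (H.isKahlerFrameOn hU hS hu') hx (H.einsteinAt hU hS hu hx) (H.einsteinAt hU hS hu' hx) hβ s t

/-- Coframes that are adapted to the triple root exist locally. -/
theorem exists_tripleRoot (H : IsPKE S g K P) (h3 : IsPetrovIII S g K) (hS : IsOpen S)
    (hx : x ∈ S) : ∃ U : Set M, IsOpen U ∧ x ∈ U ∧ U ⊆ S ∧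
      ∃ u : (x : M) → Coframe x, IsTripleRootAdaptedOn g K U u := by
  obtain ⟨U, hU, hxU, hUS, u, hu⟩ := H.exists_adapted hS hx
  have F := H.isFrameOn hU hUS hu
  have s0 : SmoothFunOn (psi0 u) U := F.weyl_smooth _ _ _ _
  have s1 : SmoothFunOn (psi1 u) U := F.weyl_smooth _ _ _ _
  have s2 : SmoothFunOn (psi2 u) U := (F.weyl_smooth _ _ _ _).neg
  have s3 : SmoothFunOn (psi3 u) U := F.weyl_smooth _ _ _ _
  have s4 : SmoothFunOn (psi4 u) U := F.weyl_smooth _ _ _ _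
  have root : ∀ y ∈ U, ∃ a b c d : ℝ, a * d - b * c ≠ 0 ∧ psi0 u y = a ^ 3 * c ∧
      psi1 u y = a ^ 2 * (3 * b * c + a * d) / 4 ∧ psi2 u y = a * b * (b * c + a * d) / 2 ∧
      psi3 u y = b ^ 2 * (b * c + 3 * a * d) / 4 ∧ psi4 u y = b ^ 3 * d := by
    intro y hy
    obtain ⟨a, b, c, d, h0, h⟩ := h3 U hU hUS u hu y hy
    refine ⟨a, b, c, d, h0, quartic_coeff fun s t => ?_⟩
    have := h s t
    rw [weylQuartic] at this
    rw [this]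
    ring
  have tri : ∀ V : Set M, V ⊆ U → ∀ u' : (x : M) → Coframe x, IsOpen V → IsAdaptedOn g K V u' →
      (∀ y ∈ V, ∃ k₃ k₄ : ℝ, k₃ ≠ 0 ∧ ∀ s t, weylQuartic u y (s * transMat u u' y 0 0
        + t * transMat u u' y 0 1) (s * transMat u u' y 1 0 + t * transMat u u' y 1 1)
        = t ^ 3 * (k₃ * s + k₄ * t)) → IsTripleRootAdaptedOn g K V u' := by
    intro V hV u' hVo hu' hq
    refine ⟨hu', fun y hy => ?_⟩
    obtain ⟨k₃, k₄, h0, hk⟩ := hq y hy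
    have hδ := ((H.isParaChange hVo (hV.trans hUS) (hu.mono hV) hu').trans_entries hy rfl).1
    set δ := transMat u u' y 0 0 * transMat u u' y 1 1 - transMat u u' y 0 1 * transMat u u' y 1 0
    obtain ⟨e0, e1, e2, e3, -⟩ := quartic_coeff (a₀ := psi0 u' y) (a₁ := psi1 u' y)
      (a₂ := psi2 u' y) (a₃ := psi3 u' y) (a₄ := psi4 u' y) (b₀ := 0) (b₁ := 0) (b₂ := 0)
      (b₃ := δ⁻¹ ^ 2 * k₃ / 4) (b₄ := δ⁻¹ ^ 2 * k₄) (fun s t => by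
        have := H.weylQuartic_eq hVo (hV.trans hUS) (hu.mono hV) hu' hy rfl s t
        rw [hk, weylQuartic] at this
        rw [this]
        ring)
    refine ⟨e0, e1, e2, ?_⟩
    rw [e3]
    have := inv_ne_zero hδ
    positivity
  obtain ⟨a, b, c, d, h0, r0, r1, r2, r3, r4⟩ := root x hxU
  -- For the quartic (as + bt)³(cs + dt) the Hessian is −((ad − bc)²/16)(as + bt)⁴. Its coefficients
  -- are quadratic in the Ψ's, so a quotient of two of them gives a/b or b/a as a smooth function.
  -- The extreme Hessian coefficient D used as denominator is a multiple of b⁴ or of a⁴, according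
  -- to the case at x.
  by_cases ha : a = 0
  · have hD := (s2.mul s4).sub (s3.mul s3)
    set D := fun y => psi2 u y * psi4 u y - psi3 u y * psi3 u y with hDd
    have hVU : {y | y ∈ U ∧ D y ≠ 0} ⊆ U := fun y hy => hy.1
    have hρ := SmoothFunOn.div (((s1.mul s4).sub (s2.mul s3)).mono hVU)
      (((SmoothFunOn.const 2).mul hD).mono hVU) fun y hy => mul_ne_zero two_ne_zero hy.2
    obtain ⟨u', hu', hβ⟩ := (hu.mono hVU).exists_change (.const 1) (.const 0) hρ.neg (.const 1)
      (fun y _ => by norm_num)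
    have hDx : D x ≠ 0 := by
      have : D x = -(b ^ 4 * (a * d - b * c) ^ 2 / 16) := by simp only [hDd]; rw [r2, r3, r4]; ring
      rw [this]
      have hb : b ≠ 0 := by
        rintro rfl
        simp [ha] at h0
      exact neg_ne_zero.2 (by positivity)
    refine ⟨_, hD.isOpen_ne_zero hU, ⟨hxU, hDx⟩, hVU.trans hUS, u',
      tri _ hVU u' (hD.isOpen_ne_zero hU) hu' fun y hy => ?_⟩
    obtain ⟨e00, e01, e10, e11⟩ := hβ y hy
    obtain ⟨a, b, c, d, h0, r0, r1, r2, r3, r4⟩ := root y hy.1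
    have hDy : D y = -(b ^ 4 * (a * d - b * c) ^ 2 / 16) := by simp only [hDd]; rw [r2, r3, r4]; ring
    have hr : (psi1 u y * psi4 u y - psi2 u y * psi3 u y) / (2 * D y) * b = a := by
      rw [div_mul_eq_mul_div, div_eq_iff (mul_ne_zero two_ne_zero hy.2), hDy, r1, r2, r3, r4]
      ring
    have hb : b ≠ 0 := by
      rintro rfl
      apply hy.2
      rw [hDy]
      ring
    set ρ := (psi1 u y * psi4 u y - psi2 u y * psi3 u y) / (2 * D y)
    refine ⟨- (b ^ 2 * (a * d - b * c)), b ^ 3 * d, by simp [hb, h0], fun s t => ?_⟩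
    rw [e00, e01, e10, e11, weylQuartic, r0, r1, r2, r3, r4, ← hr]
    ring
  · have hD := (s0.mul s2).sub (s1.mul s1)
    set D := fun y => psi0 u y * psi2 u y - psi1 u y * psi1 u y with hDd
    have hVU : {y | y ∈ U ∧ D y ≠ 0} ⊆ U := fun y hy => hy.1
    have hρ := SmoothFunOn.div (((s0.mul s3).sub (s1.mul s2)).mono hVU)
      (((SmoothFunOn.const 2).mul hD).mono hVU) fun y hy => mul_ne_zero two_ne_zero hy.2
    -- The new first frame vector is −ρ ∂₁ + ∂₂ with ρ = b/a, on which as + bt vanishes. In the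
    -- other case it was ∂₁ − ρ ∂₂ with ρ = a/b.
    obtain ⟨u', hu', hβ⟩ := (hu.mono hVU).exists_change hρ.neg (.const 1) (.const 1) (.const 0)
      (fun y _ => by norm_num)
    have hDx : D x ≠ 0 := by
      have : D x = -(a ^ 4 * (a * d - b * c) ^ 2 / 16) := by simp only [hDd]; rw [r0, r1, r2]; ring
      rw [this]
      exact neg_ne_zero.2 (by positivity)
    refine ⟨_, hD.isOpen_ne_zero hU, ⟨hxU, hDx⟩, hVU.trans hUS, u',
      tri _ hVU u' (hD.isOpen_ne_zero hU) hu' fun y hy => ?_⟩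
    obtain ⟨e00, e01, e10, e11⟩ := hβ y hy
    obtain ⟨a, b, c, d, h0, r0, r1, r2, r3, r4⟩ := root y hy.1
    have hDy : D y = -(a ^ 4 * (a * d - b * c) ^ 2 / 16) := by simp only [hDd]; rw [r0, r1, r2]; ring
    have hr : (psi0 u y * psi3 u y - psi1 u y * psi2 u y) / (2 * D y) * a = b := by
      rw [div_mul_eq_mul_div, div_eq_iff (mul_ne_zero two_ne_zero hy.2), hDy, r0, r1, r2, r3]
      ring
    have ha : a ≠ 0 := by
      rintro rfl
      apply hy.2
      rw [hDy]
      ring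
    set ρ := (psi0 u y * psi3 u y - psi1 u y * psi2 u y) / (2 * D y)
    refine ⟨a ^ 2 * (a * d - b * c), a ^ 3 * c, by simp [ha, h0], fun s t => ?_⟩
    rw [e00, e01, e10, e11, weylQuartic, r0, r1, r2, r3, r4, ← hr]
    ring

/-- For coframes adapted to the triple root, `Γ²₁` is a combination of `θ²` and `θ³`. -/
theorem gammaCoef_tripleRoot (H : IsPKE S g K P) (hU : IsOpen U) (hS : U ⊆ S)
    (hu : IsTripleRootAdaptedOn g K U u) (hx : x ∈ U) :
    gammaCoef u 1 0 0 x = 0 ∧ gammaCoef u 1 0 3 x = 0 := by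
  have F := H.isKahlerFrameOn hU hS hu.1
  have hc : ∀ c d, ∃ k : ℝ, ∀ y ∈ U, riem u 1 0 c d y = k := by
    intro c d
    -- The components of Ω²₁ = −P θ²∧θ³, to which Ψ₀ = Ψ₁ = Ψ₂ = 0 reduces the curvature equation.
    refine ⟨!![0, 0, 0, 0; 0, 0, -P, 0; 0, P, 0, 0; 0, 0, 0, 0] c d, fun y hy => ?_⟩
    obtain ⟨h0, h1, h2, -⟩ := hu.2 y hy
    obtain ⟨-, -, ⟨r1, r2, r3, r4⟩, -⟩ := F.riem_eq_psi hy (H.einsteinAt hU hS hu.1 hy)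
      (H.psi2'_eq U hU hS u hu.1 y hy)
    obtain ⟨q, dd, -⟩ := F.riem_symm hy
    have s := fun c d => riem_swap u 1 0 c d y
    fin_cases c <;> fin_cases d <;>
      simp [r1, r2, r3, r4, q, dd, s 2 0, s 2 1, s 3 0, s 3 1, h0, h1, h2]
  have hd : ∀ c d e, derivAlong (dualFrame u c) (riem u 1 0 d e) x = 0 := by
    intro c d e
    obtain ⟨k, hk⟩ := hc d e
    rw [derivAlong_congr hU hx hk, derivAlong_const]
  -- Since the components of Ω²₁ are constant, its Bianchi identity is algebraic. On (∂₁, ∂₂, ∂₃)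
  -- and (∂₂, ∂₃, ∂₄) the Ψ₂' terms cancel and, up to sign, 2Ψ₃ Γ²₁(∂₁) and 2Ψ₃ Γ²₁(∂₄) are left.
  have B1 := F.riem_bianchi hx 1 0 0 1 2
  have B2 := F.riem_bianchi hx 1 0 1 2 3
  obtain ⟨q, dd, z, -⟩ := F.riem_symm hx
  obtain ⟨h0, h1, h2, h3⟩ := hu.2 x hx
  obtain ⟨⟨a1, a2, a3, a4⟩, ⟨b1, b2, b3, b4⟩, ⟨c1, c2, c3, c4⟩, ⟨d1, d2, d3, d4⟩⟩ :=
    F.riem_eq_psi hx (H.einsteinAt hU hS hu.1 hx) (H.psi2'_eq U hU hS u hu.1 x hx)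
  have s := fun a b c d => riem_swap u a b c d x
  have l := fun c => gammaCoef_lower u c x
  have lr := fun c d => riem_lower u c d x
  simp only [hd, Fin.sum_univ_four, gammaCoef_torsionFree, (q _ _).1, (q _ _).2.1, (q _ _).2.2.1,
    (q _ _).2.2.2, dd, (z _ _).1, (lr _ _).2.2.2.2.2.1,
    (lr _ _).2.2.2.2.2.2.1,
    F.riem_three_zero hx, s _ _ 2 0, s _ _ 2 1, s _ _ 3 0, s _ _ 3 1, a1,
    a3, a4, c1, c2, c3, c4,
    d1, d3, d4, h0, h1, h2, (l _).1, (l _).2.1, (l _).2.2.1, (l _).2.2.2.1,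
    (l _).2.2.2.2.1, (l _).2.2.2.2.2.1, (l _).2.2.2.2.2.2.1, (l _).2.2.2.2.2.2.2.1,
    F.gamma_zero_three x hx, F.gamma_three_zero x hx, F.gamma_one_two hx, F.gamma_two_one hx]
    at B1 B2
  constructor
  · have : psi3 u x * gammaCoef u 1 0 0 x = 0 := by linear_combination - B1 / 2
    exact (mul_eq_zero.1 this).resolve_left h3
  · have : psi3 u x * gammaCoef u 1 0 3 x = 0 := by linear_combination - B2 / 2
    exact (mul_eq_zero.1 this).resolve_left h3

/-- If moreover `Ψ₃` is constant, then `J₁` and `J₂` determine two coefficients of `Γ¹₁`. -/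
theorem gammaCoef_psi3_const (H : IsPKE S g K P) (hU : IsOpen U) (hS : U ⊆ S)
    (hu : IsTripleRootAdaptedOn g K U u) {c₃ : ℝ} (hc₃ : ∀ y ∈ U, psi3 u y = c₃)
    (hx : x ∈ U) :
    gammaCoef u 0 0 0 x = gammaCoef u 1 1 0 x - 2 * gammaCoef u 1 0 1 x ∧
      gammaCoef u 0 0 3 x = gammaCoef u 1 1 3 x + 2 * gammaCoef u 1 0 2 x := by
  have F := H.isKahlerFrameOn hU hS hu.1
  have hc : ∀ c d, ∃ k : ℝ, ∀ y ∈ U, riem u 0 0 c d y = k := by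
    intro c d
    -- The components of Ω¹₁ = −2P θ¹∧θ³ − c₃ θ²∧θ³ − P θ²∧θ⁴, constant now that Ψ₃ is.
    refine ⟨!![0, 0, -2 * P, 0; 0, 0, -c₃, -P; 2 * P, c₃, 0, 0; 0, P, 0, 0] c d, fun y hy => ?_⟩
    obtain ⟨h0, h1, h2, -⟩ := hu.2 y hy
    have h3 := hc₃ y hy
    obtain ⟨⟨r1, r2, r3, r4⟩, -⟩ := F.riem_eq_psi hy (H.einsteinAt hU hS hu.1 hy)
      (H.psi2'_eq U hU hS u hu.1 y hy)
    rw [h2, sub_zero] at r1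
    rw [h1] at r2
    rw [h3] at r3
    rw [h2, zero_sub] at r4
    obtain ⟨q, dd, -⟩ := F.riem_symm hy
    have s := fun c d => riem_swap u 0 0 c d y
    fin_cases c <;> fin_cases d <;>
      simp [r1, r2, r3, r4, q, dd, s 2 0, s 2 1, s 3 0, s 3 1]
  have hd : ∀ c d e, derivAlong (dualFrame u c) (riem u 0 0 d e) x = 0 := by
    intro c d e
    obtain ⟨k, hk⟩ := hc d e
    rw [derivAlong_congr hU hx hk, derivAlong_const]
  -- The same argument for Ω¹₁: after the vanishing coefficients of Γ²₁ are removed, each identity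
  -- is Ψ₃ times a linear relation between coefficients of Γ¹₁, Γ²₂ and Γ²₁.
  have B1 := F.riem_bianchi hx 0 0 0 1 2
  have B2 := F.riem_bianchi hx 0 0 1 2 3
  obtain ⟨q, dd, z, -⟩ := F.riem_symm hx
  obtain ⟨h0, h1, h2, h3⟩ := hu.2 x hx
  obtain ⟨⟨a1, a2, a3, a4⟩, ⟨b1, b2, b3, b4⟩, ⟨c1, c2, c3, c4⟩, ⟨d1, d2, d3, d4⟩⟩ :=
    F.riem_eq_psi hx (H.einsteinAt hU hS hu.1 hx) (H.psi2'_eq U hU hS u hu.1 x hx)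
  have s := fun a b c d => riem_swap u a b c d x
  have l := fun c => gammaCoef_lower u c x
  have lr := fun c d => riem_lower u c d x
  simp only [hd, Fin.sum_univ_four, gammaCoef_torsionFree, (q _ _).1, (q _ _).2.1, (q _ _).2.2.1,
    (q _ _).2.2.2, dd, (lr _ _).2.2.2.2.1,
    (lr _ _).2.2.2.2.2.2.1,
    F.riem_three_zero hx, F.riem_zero_three hx, s _ _ 2 0, s _ _ 2 1, s _ _ 3 0, s _ _ 3 1, a1, a2,
    a3, a4, b1, b3, b4, c1, c3, c4,
    h1, h2, (l _).1, (l _).2.1, (l _).2.2.1, (l _).2.2.2.1,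
    (l _).2.2.2.2.1, (l _).2.2.2.2.2.1, (l _).2.2.2.2.2.2.1, (l _).2.2.2.2.2.2.2.1,
    F.gamma_zero_three x hx, F.gamma_three_zero x hx, F.gamma_one_two hx, F.gamma_two_one hx]
    at B1 B2
  obtain ⟨t0, t3⟩ := H.gammaCoef_tripleRoot hU hS hu hx
  simp only [t0, t3] at B1 B2
  constructor <;> refine mul_left_cancel₀ h3 ?_
  · linear_combination - B1
  · linear_combination - B2

/-- If `J₂` is constant, then `J₁` and `J₂` determine two coefficients of `Γ²₂`. -/
theorem gammaCoef_Jtwo_const (H : IsPKE S g K P) (hU : IsOpen U) (hS : U ⊆ S)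
    (hu : IsTripleRootAdaptedOn g K U u) {c₃ c₂ : ℝ} (hc₃ : ∀ y ∈ U, psi3 u y = c₃)
    (hc₂ : ∀ y ∈ U, Jtwo u y = c₂) (h₂ : c₂ ≠ 0) (hx : x ∈ U) :
    gammaCoef u 1 1 0 x = - gammaCoef u 1 0 1 x ∧ gammaCoef u 1 1 3 x = c₂ := by
  have F := H.isKahlerFrameOn hU hS hu.1
  have d0 : ∀ c, derivAlong (dualFrame u c) (gammaCoef u 1 0 0) x = 0 := fun c => by
    rw [derivAlong_congr hU hx fun y hy => (H.gammaCoef_tripleRoot hU hS hu hy).1,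
      derivAlong_const]
  have d3 : ∀ c, derivAlong (dualFrame u c) (gammaCoef u 1 0 3) x = 0 := fun c => by
    rw [derivAlong_congr hU hx fun y hy => (H.gammaCoef_tripleRoot hU hS hu hy).2,
      derivAlong_const]
  have d2 : ∀ c, derivAlong (dualFrame u c) (gammaCoef u 1 0 2) x = 0 := fun c => by
    exact (derivAlong_congr hU hx hc₂).trans (derivAlong_const _)
  have e2 : gammaCoef u 1 0 2 x = c₂ := hc₂ x hx
  obtain ⟨e0, e3⟩ := H.gammaCoef_tripleRoot hU hS hu hx
  obtain ⟨f0, f3⟩ := H.gammaCoef_psi3_const hU hS hu hc₃ hx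
  obtain ⟨q, -⟩ := F.riem_symm hx
  obtain ⟨h0, h1, h2, h3⟩ := hu.2 x hx
  obtain ⟨-, -, ⟨c1, -⟩, -⟩ :=
    F.riem_eq_psi hx (H.einsteinAt hU hS hu.1 hx) (H.psi2'_eq U hU hS u hu.1 x hx)
  -- These are the two components of Ω²₁ in which J₁ is not differentiated. Both vanish, so the
  -- structure equation becomes J₂ times a linear relation.
  have R1 := IsFrameOn.riem_eq (u := u) (x := x) 1 0 0 2
  have R2 := IsFrameOn.riem_eq (u := u) (x := x) 1 0 2 3
  have l := fun c => gammaCoef_lower u c x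
  simp only [d0, d2, d3, e0, e2, e3, f0, f3, Fin.sum_univ_four, gammaCoef_torsionFree, c1, h1,
    (q _ _).2.1, (l _).1, (l _).2.1, (l _).2.2.1, (l _).2.2.2.1,
    (l _).2.2.2.2.1, (l _).2.2.2.2.2.1, (l _).2.2.2.2.2.2.1,
    F.gamma_zero_three x hx, F.gamma_three_zero x hx, F.gamma_one_two hx]
    at R1 R2
  constructor <;> refine mul_left_cancel₀ h₂ ?_
  · linear_combination - R1
  · linear_combination R2

/-- Coframes adapted to the triple root differ by triangular transformations. -/
theorem transMat_one_zero (H : IsPKE S g K P) (hU : IsOpen U) (hS : U ⊆ S)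
    (hu : IsTripleRootAdaptedOn g K U u) (hu' : IsTripleRootAdaptedOn g K U u') (hx : x ∈ U) :
    transMat u u' x 1 0 = 0 ∧ transMat u u' x 0 0 ≠ 0 ∧ transMat u u' x 1 1 ≠ 0 ∧
      psi3 u' x * transMat u u' x 0 0 = transMat u u' x 1 1 * psi3 u x := by
  have h := H.weylQuartic_eq hU hS hu.1 hu'.1 hx (β := transMat u u' x) rfl
  have hδ := ((H.isParaChange hU hS hu.1 hu'.1).trans_entries hx rfl).1
  obtain ⟨z0, z1, z2, z3⟩ := hu.2 x hx
  obtain ⟨z0', z1', z2', z3'⟩ := hu'.2 x hx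
  set p := transMat u u' x 0 0
  set q := transMat u u' x 0 1
  set r := transMat u u' x 1 0
  set m := transMat u u' x 1 1
  obtain ⟨k, hk, hk'⟩ : ∃ k, k = (p * m - q * r)⁻¹ ∧ k ≠ 0 := ⟨_, rfl, inv_ne_zero hδ⟩
  have hkδ : k * (p * m - q * r) = 1 := by rw [hk, inv_mul_cancel₀ hδ]
  rw [← hk] at h
  simp only [weylQuartic, z0, z1, z2, z0', z1', z2'] at h
  obtain ⟨q0, q1, -, q3, -⟩ := quartic_coeff (a₀ := 0) (a₁ := 0) (a₂ := 0) (a₃ := psi3 u' x)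
    (a₄ := psi4 u' x) (b₀ := k ^ 2 * (r ^ 3 * (psi4 u x * r + 4 * psi3 u x * p)))
    (b₁ := k ^ 2 * (r ^ 2 * (psi4 u x * r * m + 3 * psi3 u x * m * p + psi3 u x * r * q)))
    (b₂ := k ^ 2 * (r * (psi4 u x * r * m ^ 2 + 2 * psi3 u x * m * (m * p + r * q))))
    (b₃ := k ^ 2 * (psi4 u x * r * m ^ 3 + psi3 u x * (m ^ 3 * p + 3 * r * m ^ 2 * q)))
    (b₄ := k ^ 2 * (psi4 u x * m ^ 4 + 4 * psi3 u x * m ^ 3 * q)) (fun s t => by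
      linear_combination h s t)
  -- The coefficients of s⁴ and s³t in the transformed quartic are zero. If r ≠ 0, their cofactors
  -- `w0` and `w1` vanish, and eliminating Ψ₄ between them leaves Ψ₃ (pm − qr) = 0.
  have hr : r = 0 := by
    by_contra hr
    have hk2 : k ^ 2 ≠ 0 := by positivity
    have w0 := (mul_eq_zero.1 ((mul_eq_zero.1 q0.symm).resolve_left hk2)).resolve_left (by positivity)
    have w1 := (mul_eq_zero.1 ((mul_eq_zero.1 q1.symm).resolve_left hk2)).resolve_left (by positivity)
    have : psi3 u x * (p * m - q * r) = 0 := by linear_combination m * w0 - w1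
    exact (mul_ne_zero z3 hδ) this
  rw [hr] at hδ q3 hkδ
  have hp : p ≠ 0 := by rintro h; simp [h] at hδ
  have hm : m ≠ 0 := by rintro h; simp [h] at hδ
  refine ⟨hr, hp, hm, ?_⟩
  rw [q3]
  linear_combination psi3 u x * m * (k * (p * m) + 1) * hkδ

/-- With β triangular of diagonal (p, m), Γ²₁ is multiplied by p/m. As it has no θ¹ or θ⁴ component,
only the entry β³₃ = 1/p contributes to its value on the new ∂₃, so J₂ is divided by m. -/
theorem Jtwo_change (H : IsPKE S g K P) (hU : IsOpen U) (hS : U ⊆ S)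
    (hu : IsTripleRootAdaptedOn g K U u) (hu' : IsTripleRootAdaptedOn g K U u') (hx : x ∈ U) :
    Jtwo u' x * transMat u u' x 1 1 = Jtwo u x := by
  have C := H.isParaChange hU hS hu.1 hu'.1
  obtain ⟨hr, hp, hm, -⟩ := H.transMat_one_zero hU hS hu hu' hx
  obtain ⟨-, b22, -⟩ := C.trans_entries hx rfl
  obtain ⟨t0, t3⟩ := H.gammaCoef_tripleRoot hU hS hu hx
  have h := C.gammaCoef_one_zero hx (fun z hz => (H.transMat_one_zero hU hS hu hu' hz).1) 2
  rw [Fin.sum_univ_four, t0, t3, C.block x hx 1 2 (sign4_ne _ _ (by decide)), b22, hr] at h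
  rw [Jtwo, h, Jtwo]
  field_simp
  ring

end IsPKE

end TripleRoot

section Reduction

variable {M : Type*} [TopologicalSpace M] [ChartedSpace E4 M] [IsManifold 𝓘(ℝ, E4) ∞ M]
variable {U V S : Set M} {f : M → ℝ} {X Y Z : VField M} {x : M} {u u' : (x : M) → Coframe x}
  {g : (x : M) → TangentSpace 𝓘(ℝ, E4) x →L[ℝ] TangentSpace 𝓘(ℝ, E4) x →L[ℝ] ℝ}
  {K : (x : M) → TangentSpace 𝓘(ℝ, E4) x →L[ℝ] TangentSpace 𝓘(ℝ, E4) x} {P c₃ c₂ : ℝ}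

/-! ### The reduction of the bundle of adapted coframes to a line bundle -/

theorem IsTripleRootAdaptedOn.mono (hu : IsTripleRootAdaptedOn g K U u) (h : V ⊆ U) :
    IsTripleRootAdaptedOn g K V u := ⟨hu.1.mono h, fun x hx => hu.2 x (h hx)⟩

/-- β expresses the old coframe through the new one, so the new coframe is obtained by β⁻¹; this is
the source of the sign of the shear parameter. -/
theorem IsParaChange.eq_shear (C : IsParaChange U u u') (hx : x ∈ U)
    (h00 : transMat u u' x 0 0 = 1) (h10 : transMat u u' x 1 0 = 0)
    (h11 : transMat u u' x 1 1 = 1) (v : TangentSpace 𝓘(ℝ, E4) x) :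
    u' x v = shear (- transMat u u' x 0 1) (u x v) := by
  obtain ⟨-, b22, b23, b32, b33⟩ := C.trans_entries hx rfl
  rw [h00, h10, h11] at b22 b23 b32 b33
  have key : ∀ a, u' x v a = ∑ b, transMat u u' x (flip4 b) (flip4 a) * u x v b := by
    intro a
    have := theta_eq_sum_transMat u' u a x v
    simp only [C.trans_apply hx] at this
    exact this
  have b := C.block x hx
  funext a
  rw [key, Fin.sum_univ_four]
  fin_cases a <;> simp [flip4, shear, h00, h10, h11, b22, b23, b32, b33,
    b 0 2 (sign4_ne _ _ (by decide)), b 1 2 (sign4_ne _ _ (by decide)),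
    b 0 3 (sign4_ne _ _ (by decide)), b 1 3 (sign4_ne _ _ (by decide)),
    b 2 0 (sign4_ne _ _ (by decide)), b 2 1 (sign4_ne _ _ (by decide)),
    b 3 0 (sign4_ne _ _ (by decide)), b 3 1 (sign4_ne _ _ (by decide))]
  ring

namespace IsPKE

/-- Triangular changes of coframe preserve the triple root. -/
theorem tripleRoot_of_change (H : IsPKE S g K P) (hU : IsOpen U) (hS : U ⊆ S)
    (hu : IsAdaptedOn g K U u) (hu' : IsAdaptedOn g K U u') (hx : x ∈ U)
    (h0 : psi0 u x = 0 ∧ psi1 u x = 0 ∧ psi2 u x = 0 ∧ psi3 u x ≠ 0)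
    (h10 : transMat u u' x 1 0 = 0) :
    psi0 u' x = 0 ∧ psi1 u' x = 0 ∧ psi2 u' x = 0 ∧ psi3 u' x ≠ 0 := by
  have h := H.weylQuartic_eq hU hS hu hu' hx (β := transMat u u' x) rfl
  have hδ := ((H.isParaChange hU hS hu hu').trans_entries hx rfl).1
  obtain ⟨z0, z1, z2, z3⟩ := h0
  set p := transMat u u' x 0 0
  set q := transMat u u' x 0 1
  set m := transMat u u' x 1 1
  obtain ⟨k, hk, hk'⟩ : ∃ k, k = (p * m - q * transMat u u' x 1 0)⁻¹ ∧ k ≠ 0 :=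
    ⟨_, rfl, inv_ne_zero hδ⟩
  rw [← hk] at h
  simp only [weylQuartic, z0, z1, z2, h10] at h
  obtain ⟨q0, q1, q2, q3, -⟩ := quartic_coeff (a₀ := psi0 u' x) (a₁ := psi1 u' x)
    (a₂ := psi2 u' x) (a₃ := psi3 u' x) (a₄ := psi4 u' x) (b₀ := 0) (b₁ := 0) (b₂ := 0)
    (b₃ := k ^ 2 * (psi3 u x * (m ^ 3 * p)))
    (b₄ := k ^ 2 * (psi4 u x * m ^ 4 + 4 * psi3 u x * m ^ 3 * q)) (fun s t => by
      linear_combination h s t)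
  rw [h10] at hδ
  have hp : p ≠ 0 := by rintro h; simp [h] at hδ
  have hm : m ≠ 0 := by rintro h; simp [h] at hδ
  exact ⟨q0, q1, q2, by rw [q3]; positivity⟩

/-- The scaling laws Ψ₃ ↦ (m/p) Ψ₃ and J₂ ↦ J₂/m are solved by the diagonal change with m = J₂/c₂
and p = m Ψ₃/c₃. -/
theorem exists_normalized (H : IsPKE S g K P) (h3 : IsPetrovIII S g K)
    (hJ : JtwoNonvanishing S g K) (hS : IsOpen S) (hx : x ∈ S) (h₃ : c₃ ≠ 0) (h₂ : c₂ ≠ 0) :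
    ∃ U : Set M, IsOpen U ∧ x ∈ U ∧ U ⊆ S ∧ ∃ u : (x : M) → Coframe x,
      IsTripleRootAdaptedOn g K U u ∧ ∀ y ∈ U, psi3 u y = c₃ ∧ Jtwo u y = c₂ := by
  obtain ⟨U, hU, hxU, hUS, u, hu⟩ := H.exists_tripleRoot h3 hS hx
  have F := H.isFrameOn hU hUS hu.1
  have hm : SmoothFunOn (fun y => Jtwo u y * c₂⁻¹) U := (F.gammaCoef_smooth 1 0 2).mul (.const _)
  have hp : SmoothFunOn (fun y => Jtwo u y * c₂⁻¹ * (psi3 u y * c₃⁻¹)) U :=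
    hm.mul (SmoothFunOn.mul (F.weyl_smooth 0 2 1 2) (.const _))
  have hm0 : ∀ y ∈ U, Jtwo u y * c₂⁻¹ ≠ 0 := fun y hy =>
    mul_ne_zero (hJ U hU hUS u hu y hy) (inv_ne_zero h₂)
  have hp0 : ∀ y ∈ U, Jtwo u y * c₂⁻¹ * (psi3 u y * c₃⁻¹) ≠ 0 := fun y hy =>
    mul_ne_zero (hm0 y hy) (mul_ne_zero (hu.2 y hy).2.2.2 (inv_ne_zero h₃))
  obtain ⟨u', hu', hβ⟩ := hu.1.exists_change hp (.const 0) (.const 0) hm fun y hy => by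
    rw [zero_mul, sub_zero]
    exact mul_ne_zero (hp0 y hy) (hm0 y hy)
  have ht : IsTripleRootAdaptedOn g K U u' := ⟨hu', fun y hy =>
    H.tripleRoot_of_change hU hUS hu.1 hu' hy (hu.2 y hy) (hβ y hy).2.2.1⟩
  refine ⟨U, hU, hxU, hUS, u', ht, fun y hy => ⟨?_, ?_⟩⟩
  · have h := (H.transMat_one_zero hU hUS hu ht hy).2.2.2
    rw [(hβ y hy).1, (hβ y hy).2.2.2] at h
    refine mul_right_cancel₀ (hp0 y hy) (h.trans ?_)
    field_simp
  · have h := H.Jtwo_change hU hUS hu ht hy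
    rw [(hβ y hy).2.2.2] at h
    refine mul_right_cancel₀ (hm0 y hy) (h.trans ?_)
    field_simp

theorem transMat_normalized (H : IsPKE S g K P) (hU : IsOpen U) (hS : U ⊆ S)
    (hu : IsTripleRootAdaptedOn g K U u) (hu' : IsTripleRootAdaptedOn g K U u') (hx : x ∈ U)
    (h3 : psi3 u' x = psi3 u x) (h2 : Jtwo u' x = Jtwo u x) (h0 : Jtwo u x ≠ 0) :
    transMat u u' x 0 0 = 1 ∧ transMat u u' x 1 0 = 0 ∧ transMat u u' x 1 1 = 1 := by
  obtain ⟨h10, -, -, h⟩ := H.transMat_one_zero hU hS hu hu' hx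
  have hJ := H.Jtwo_change hU hS hu hu' hx
  rw [h2] at hJ
  have h11 : transMat u u' x 1 1 = 1 := by
    refine mul_left_cancel₀ h0 ?_
    rw [hJ, mul_one]
  rw [h3, h11, one_mul] at h
  refine ⟨mul_left_cancel₀ (hu.2 x hx).2.2.2 ?_, h10, h11⟩
  rw [h, mul_one]

/-- The normalised coframes form a smooth line bundle. -/
theorem isShearLineBundle (H : IsPKE S g K P) (h3 : IsPetrovIII S g K)
    (hJ : JtwoNonvanishing S g K) (hS : IsOpen S) (h₃ : c₃ ≠ 0) (h₂ : c₂ ≠ 0) :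
    IsShearLineBundle S (normalizedFibre S g K c₃ c₂) := by
  intro x hx
  obtain ⟨U, hU, hxU, hUS, u, hu, hc⟩ := H.exists_normalized h3 hJ hS hx h₃ h₂
  refine ⟨U, hU, hxU, hUS, u, hu.1.1, fun y hy t => ?_, fun y hy w hw => ?_⟩
  · obtain ⟨u', hu', hβ⟩ := hu.1.exists_change (.const 1) (.const (- t)) (.const 0) (.const 1)
      fun y hy => by norm_num
    have ht : IsTripleRootAdaptedOn g K U u' := ⟨hu', fun y hy =>
      H.tripleRoot_of_change hU hUS hu.1 hu' hy (hu.2 y hy) (hβ y hy).2.2.1⟩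
    obtain ⟨e0, e1, e2, e3⟩ := hβ y hy
    refine ⟨u' y, ⟨U, hU, hy, hUS, u', ht, rfl, ?_, ?_⟩, fun v => ?_⟩
    · have h := (H.transMat_one_zero hU hUS hu ht hy).2.2.2
      rwa [e0, e3, mul_one, one_mul, (hc y hy).1] at h
    · have h := H.Jtwo_change hU hUS hu ht hy
      rwa [e3, mul_one, (hc y hy).2] at h
    · rw [(H.isParaChange hU hUS hu.1 hu').eq_shear hy e0 e2 e3, e1, neg_neg]
  · obtain ⟨V, hV, hyV, hVS, v, hv, rfl, v3, v2⟩ := hw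
    have hUV : U ∩ V ⊆ U := Set.inter_subset_left
    have hUV' : U ∩ V ⊆ V := Set.inter_subset_right
    have hyUV : y ∈ U ∩ V := ⟨hy, hyV⟩
    obtain ⟨e0, e1, e2⟩ := H.transMat_normalized (hU.inter hV) (hUV.trans hUS) (hu.mono hUV)
      (hv.mono hUV') hyUV (v3.trans (hc y hy).1.symm) (v2.trans (hc y hy).2.symm)
      (by rw [(hc y hy).2]; exact h₂)
    refine ⟨- transMat u v y 0 1, (H.isParaChange (hU.inter hV) (hUV.trans hUS) (hu.1.mono hUV)
      (hv.1.mono hUV')).eq_shear hyUV e0 e1 e2, fun t ht => ?_⟩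
    -- On the dual vector ∂₂ the first component of `shear t` is t, so the action is free.
    have h1 := ht ((u y).symm (Pi.single 1 1))
    have h2 := (H.isParaChange (hU.inter hV) (hUV.trans hUS) (hu.1.mono hUV)
      (hv.1.mono hUV')).eq_shear hyUV e0 e1 e2 ((u y).symm (Pi.single 1 1))
    have h := congrFun (h1.symm.trans h2) 0
    simpa [shear] using h

/-- Membership in the fibre is witnessed at each point by a field that may agree with u at that
point only, while J₂ involves first derivatives. The change matrix is 1 at the point, which carries
over the conditions on Ψ₀, Ψ₁, Ψ₂. Once u is known to be adapted to the triple root on all of U, the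
transformation laws of Ψ₃ and J₂ apply and involve only the change matrix at the point. -/
theorem section_normalized (H : IsPKE S g K P) (hU : IsOpen U) (hS : U ⊆ S)
    (hu : SmoothCoframeOn u U) (hF : ∀ x ∈ U, u x ∈ normalizedFibre S g K c₃ c₂ x) :
    IsTripleRootAdaptedOn g K U u ∧ ∀ x ∈ U, psi3 u x = c₃ ∧ Jtwo u x = c₂ := by
  have hA : IsAdaptedOn g K U u := ⟨hu, fun x hx => by
    obtain ⟨V, -, hxV, -, v, hv, e, -⟩ := hF x hx
    rw [← e]
    exact hv.1.2 x hxV⟩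
  have hT : ∀ {x} {v : (x : M) → Coframe x}, v x = u x → transMat v u x = 1 := by
    intro x v e
    ext a b
    simp only [transMat, Matrix.of_apply, dualFrame, ← e]
    exact theta_dualFrame v a b x
  have hR : IsTripleRootAdaptedOn g K U u := ⟨hA, fun x hx => by
    obtain ⟨V, hV, hxV, hVS, v, hv, e, -⟩ := hF x hx
    exact H.tripleRoot_of_change (hU.inter hV) (Set.inter_subset_left.trans hS)
      (hv.1.mono Set.inter_subset_right) (hA.mono Set.inter_subset_left) ⟨hx, hxV⟩ (hv.2 x hxV)
      (by rw [hT e]; simp)⟩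
  refine ⟨hR, fun x hx => ?_⟩
  obtain ⟨V, hV, hxV, hVS, v, hv, e, v3, v2⟩ := hF x hx
  have hT := hT e
  constructor
  · have h := (H.transMat_one_zero (hU.inter hV) (Set.inter_subset_left.trans hS)
      (hv.mono Set.inter_subset_right) (hR.mono Set.inter_subset_left) ⟨hx, hxV⟩).2.2.2
    simpa [hT, v3] using h
  · have h := H.Jtwo_change (hU.inter hV) (Set.inter_subset_left.trans hS)
      (hv.mono Set.inter_subset_right) (hR.mono Set.inter_subset_left) ⟨hx, hxV⟩
    simpa [hT, v2] using h

end IsPKE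

end Reduction

section Structure

variable {M : Type*} [TopologicalSpace M] [ChartedSpace E4 M] [IsManifold 𝓘(ℝ, E4) ∞ M]
variable {U V S : Set M} {f : M → ℝ} {X Y Z : VField M} {x : M} {u u' : (x : M) → Coframe x}
  {g : (x : M) → TangentSpace 𝓘(ℝ, E4) x →L[ℝ] TangentSpace 𝓘(ℝ, E4) x →L[ℝ] ℝ}
  {K : (x : M) → TangentSpace 𝓘(ℝ, E4) x →L[ℝ] TangentSpace 𝓘(ℝ, E4) x} {P c₃ c₂ : ℝ}

/-! ### The structure equations -/

theorem dOne_theta (u : (x : M) → Coframe x) (a b c : Fin 4) (x : M) :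
    dOne (theta u a) (dualFrame u b) (dualFrame u c) x = - structFun u a b c x := by
  simp only [dOne, theta_dualFrame, derivAlong_const, structFun]
  ring

theorem dOne_Gam (u : (x : M) → Coframe x) (a b c d : Fin 4) (x : M) :
    dOne (Gam u a b) (dualFrame u c) (dualFrame u d) x = riem u a b c d x
      - ∑ e, (gammaCoef u a e c x * gammaCoef u e b d x
        - gammaCoef u a e d x * gammaCoef u e b c x) := by
  simp only [riem, wedge, Gam_dualFrame]
  ring

theorem IsKahlerFrameOn.structureEquations (F : IsKahlerFrameOn U u)
    (hE : ∀ x ∈ U, IsEinsteinAt u x) (hP : ∀ x ∈ U, psi2' u x = P) :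
    StructureEquations U u (Gam u 0 0) (Gam u 0 1) (Gam u 1 0) (Gam u 1 1)
      (fun _ => P) (psi0 u) (psi1 u) (psi2 u) (psi3 u) (psi4 u) := by
  intro x hx b c
  have l := fun c => gammaCoef_lower u c x
  obtain ⟨q, dd, -⟩ := F.riem_symm hx
  obtain ⟨⟨a1, a2, a3, a4⟩, ⟨b1, b2, b3, b4⟩, ⟨c1, c2, c3, c4⟩, ⟨d1, d2, d3, d4⟩⟩ :=
    F.riem_eq_psi hx (hE x hx) (hP x hx)
  have s := fun a b c d => riem_swap u a b c d x
  have one4 : ∀ a b : Fin 4, (1 : Matrix (Fin 4) (Fin 4) ℝ) a b = if a = b then 1 else 0 :=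
    fun _ _ => rfl
  simp only [dOne_theta, dOne_Gam, wedge, Gam_dualFrame, theta_dualFrame, gammaCoef_torsionFree,
    Fin.sum_univ_four,
    (l _).2.2.2.2.1, (l _).2.2.2.2.2.1, (l _).2.2.2.2.2.2.1, (l _).2.2.2.2.2.2.2.1,
    F.gamma_zero_three x hx, F.gamma_three_zero x hx, F.gamma_one_two hx, F.gamma_two_one hx]
  refine ⟨?_, ?_, ?_, ?_, ?_, ?_, ?_, ?_⟩ <;> fin_cases b <;> fin_cases c <;>
    simp only [Fin.zero_eta, Fin.mk_one, Fin.reduceFinMk, (q _ _).1, (q _ _).2.1, (q _ _).2.2.1,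
      (q _ _).2.2.2, dd, s _ _ 2 0, s _ _ 2 1,
      s _ _ 3 0, s _ _ 3 1, a1, a2, a3, a4, b1, b2, b3, b4, c1, c2, c3, c4, d1, d2, d3, d4,
      (l _).1, (l _).2.1, (l _).2.2.1, (l _).2.2.2.1,
      (l _).2.2.2.2.1, (l _).2.2.2.2.2.1, (l _).2.2.2.2.2.2.1, (l _).2.2.2.2.2.2.2.1,
      F.gamma_zero_three x hx, F.gamma_three_zero x hx, F.gamma_one_two hx, F.gamma_two_one hx,
      one4, Fin.reduceEq, if_true, if_false] <;> ring

/-- The reduction of a para-Kähler-Einstein structure of Petrov type III. -/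
theorem IsPKE.reduction (H : IsPKE S g K P) (h3 : IsPetrovIII S g K)
    (hJ : JtwoNonvanishing S g K) (hS : IsOpen S) (h₃ : c₃ ≠ 0) (h₂ : c₂ ≠ 0) :
    IsShearLineBundle S (normalizedFibre S g K c₃ c₂) ∧
    ∀ U : Set M, IsOpen U → U ⊆ S → ∀ u : (x : M) → Coframe x,
      SmoothCoframeOn u U → (∀ x ∈ U, u x ∈ normalizedFibre S g K c₃ c₂ x) →
      (∀ x ∈ U, psi3 u x = c₃ ∧ Jtwo u x = c₂) ∧
      StructureEquations U u (Gam u 0 0) (Gam u 0 1) (Gam u 1 0) (Gam u 1 1)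
        (fun _ => P) 0 0 0 (fun _ => c₃) (psi4 u) ∧
      ∃ J1 J3 J4 J5 J6 : M → ℝ,
        SmoothFunOn J1 U ∧ SmoothFunOn J3 U ∧ SmoothFunOn J4 U ∧ SmoothFunOn J5 U ∧
        SmoothFunOn J6 U ∧
        ReducedConnection U u J1 (fun _ => c₂) J3 J4 J5 J6 := by
  refine ⟨H.isShearLineBundle h3 hJ hS h₃ h₂, fun U hU hUS u hu hF => ?_⟩
  obtain ⟨ht, hc⟩ := H.section_normalized hU hUS hu hF
  have F := H.isKahlerFrameOn hU hUS ht.1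
  refine ⟨hc, ?_, gammaCoef u 1 0 1, gammaCoef u 0 0 1, gammaCoef u 0 0 2, gammaCoef u 1 1 2,
    gammaCoef u 1 1 1, F.gammaCoef_smooth _ _ _, F.gammaCoef_smooth _ _ _,
    F.gammaCoef_smooth _ _ _, F.gammaCoef_smooth _ _ _, F.gammaCoef_smooth _ _ _, ?_⟩
  · have E := F.structureEquations (fun x hx => H.einsteinAt hU hUS ht.1 hx)
      (H.psi2'_eq U hU hUS u ht.1)
    intro x hx b c
    have e := E x hx b c
    simp only [(ht.2 x hx).1, (ht.2 x hx).2.1, (ht.2 x hx).2.2.1, (hc x hx).1] at e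
    exact e
  · intro x hx
    obtain ⟨t0, t3⟩ := H.gammaCoef_tripleRoot hU hUS ht hx
    obtain ⟨f0, f3⟩ := H.gammaCoef_psi3_const hU hUS ht (fun y hy => (hc y hy).1) hx
    obtain ⟨k0, k3⟩ := H.gammaCoef_Jtwo_const hU hUS ht (fun y hy => (hc y hy).1)
      (fun y hy => (hc y hy).2) h₂ hx
    have t2 : gammaCoef u 1 0 2 x = c₂ := (hc x hx).2
    -- This produces the coefficients −J₁ − 2J₁ = −3J₁ of θ¹ and c₂ + 2c₂ = 3c₂ of θ⁴ in Γ¹₁.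
    rw [k0] at f0
    rw [k3, t2] at f3
    refine ⟨?_, ?_, ?_⟩
    · simp [Gam, Fin.sum_univ_four, t0, t3, t2]
    · simp only [Gam, Fin.sum_univ_four, f0, f3]
      module
    · simp only [Gam, Fin.sum_univ_four, k0, k3]
      module

end Structure

section Coordinates

variable {U : Set E4} {f h : E4 → ℝ} {X Y : VField E4} {x : E4}

/-! ### Coordinates on `ℝ⁴` -/

theorem smoothFunOn_iff : SmoothFunOn f U ↔ ContDiffOn ℝ ∞ f U := contMDiffOn_iff_contDiffOn

theorem smoothFieldOn_iff {X : E4 → E4} :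
    SmoothFieldOn (M := E4) X U ↔ ContDiffOn ℝ ∞ X U := contMDiffOn_vectorSpace_iff_contDiffOn

/-- The coframe `(dy¹, dy², dy³, dy⁴)`. -/
def coordCoframe : (y : E4) → Coframe y := fun _ => EuclideanSpace.equiv (Fin 4) ℝ

theorem theta_coordCoframe (k : Fin 4) (y v : E4) : theta coordCoframe k y v = v k := rfl

theorem isFrameOn_coordCoframe (hU : IsOpen U) : IsFrameOn U coordCoframe where
  isOpen := hU
  smooth a := smoothFieldOn_iff.2 contDiffOn_const
  smooth_theta V hV hVo X hX a := by
    rw [smoothFunOn_iff]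
    exact (contDiffOn_euclidean.1 (smoothFieldOn_iff.1 hX)) a

theorem structFun_coordCoframe (a b c : Fin 4) (y : E4) : structFun coordCoframe a b c y = 0 := by
  have : bracket (dualFrame coordCoframe b) (dualFrame coordCoframe c) y = 0 := by
    rw [bracket, VectorField.mlieBracket, VectorField.mlieBracketWithin_eq_lieBracketWithin]
    change VectorField.lieBracketWithin ℝ (fun _ : E4 => EuclideanSpace.single b (1 : ℝ))
      (fun _ : E4 => EuclideanSpace.single c (1 : ℝ)) Set.univ y = 0
    simp [VectorField.lieBracketWithin]
  rw [structFun, this, map_zero]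

theorem Gam_coordCoframe (a b : Fin 4) (y : E4) : Gam coordCoframe a b y = 0 := by
  simp [Gam, gammaCoef, structFun_coordCoframe]

variable {u : (y : E4) → Coframe y} {A : Fin 4 → Fin 4 → E4 → ℝ}

/-- The structure functions of a coframe that is given in coordinates by `θᵃ = Aᵃ_k dyᵏ`. -/
theorem structFun_eq_coord (hU : IsOpen U) (hx : x ∈ U) (hA : ∀ a k, SmoothFunOn (A a k) U)
    (hu : ∀ y ∈ U, ∀ a, theta u a y = ∑ k, A a k y • theta coordCoframe k y)
    (hs : SmoothCoframeOn u U) (a b c : Fin 4) :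
    structFun u a b c x = ∑ k, (derivAlong (dualFrame u c) (A a k) x
        * theta coordCoframe k x (dualFrame u b x)
      - derivAlong (dualFrame u b) (A a k) x * theta coordCoframe k x (dualFrame u c x)) := by
  have h1 := (isFrameOn_coordCoframe hU).dOne_sum_theta hx (hs b) (hs c) (hA a)
  have h3 : dOne (theta u a) (dualFrame u b) (dualFrame u c) x
      = dOne (fun z => ∑ k, A a k z • theta coordCoframe k z) (dualFrame u b) (dualFrame u c) x := by
    simp only [dOne]
    rw [derivAlong_congr hU hx fun z hz => by rw [hu z hz],
      derivAlong_congr (f := fun z => theta u a z (dualFrame u b z)) hU hx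
        fun z hz => by rw [hu z hz], hu x hx]
  rw [dOne_theta, h1] at h3
  rw [← neg_neg (structFun u a b c x), h3, ← Finset.sum_neg_distrib]
  refine Finset.sum_congr rfl fun k _ => ?_
  simp [Gam_coordCoframe]

theorem isFrameOn_of_coord (hU : IsOpen U) (hA : ∀ a k, SmoothFunOn (A a k) U)
    (hu : ∀ y ∈ U, ∀ a, theta u a y = ∑ k, A a k y • theta coordCoframe k y)
    (hs : SmoothCoframeOn u U) : IsFrameOn U u where
  isOpen := hU
  smooth := hs
  smooth_theta V hV hVo X hX a := by
    refine SmoothFunOn.congr (SmoothFunOn.sum fun k (_ : k ∈ Finset.univ) =>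
      ((hA a k).mono hV).mul ((isFrameOn_coordCoframe hVo).smooth_theta V subset_rfl hVo X hX k))
      fun y hy => ?_
    rw [hu y (hV hy)]
    simp

/-- `f` is differentiable at `x`, with derivative `d` in the direction `v`. -/
def HasDir (x v : E4) (f : E4 → ℝ) (d : ℝ) : Prop := DifferentiableAt ℝ f x ∧ fderiv ℝ f x v = d

namespace HasDir

variable {v : E4} {d e : ℝ}

theorem const (c : ℝ) : HasDir x v (fun _ => c) 0 := ⟨differentiableAt_const c, by simp⟩

theorem add (hf : HasDir x v f d) (hh : HasDir x v h e) :
    HasDir x v (fun y => f y + h y) (d + e) :=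
  ⟨hf.1.add hh.1, by rw [fderiv_fun_add hf.1 hh.1, ← hf.2, ← hh.2]; rfl⟩

theorem sub (hf : HasDir x v f d) (hh : HasDir x v h e) :
    HasDir x v (fun y => f y - h y) (d - e) :=
  ⟨hf.1.sub hh.1, by rw [fderiv_fun_sub hf.1 hh.1, ← hf.2, ← hh.2]; rfl⟩

theorem mul (hf : HasDir x v f d) (hh : HasDir x v h e) :
    HasDir x v (fun y => f y * h y) (d * h x + f x * e) :=
  ⟨hf.1.mul hh.1, by rw [fderiv_fun_mul hf.1 hh.1, ← hf.2, ← hh.2]; simp; ring⟩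

theorem pow (hf : HasDir x v f d) (n : ℕ) :
    HasDir x v (fun y => f y ^ n) (n * f x ^ (n - 1) * d) :=
  ⟨hf.1.pow n, by rw [fderiv_fun_pow n hf.1, ← hf.2]; simp⟩

theorem derivAlong_eq (hf : HasDir x (X x) f d) : derivAlong X f x = d := by
  rw [← hf.2]
  exact congrArg (fun L : E4 →L[ℝ] ℝ => L (X x)) mfderiv_eq_fderiv

end HasDir

end Coordinates

section Partial

/-! ### Partial derivatives of functions of two variables -/

/-- The partial derivative in the first variable. -/
def pd1 (f : ℝ → ℝ → ℝ) (s t : ℝ) : ℝ := deriv (fun r => f r t) s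

/-- The partial derivative in the second variable. -/
def pd2 (f : ℝ → ℝ → ℝ) (s t : ℝ) : ℝ := deriv (fun r => f s r) t

variable {D : Set (ℝ × ℝ)} {f : ℝ → ℝ → ℝ} {s t : ℝ} {x v : E4} {i j : Fin 4}

/-- Smoothness of a function of two variables. -/
def SmoothTwo (f : ℝ → ℝ → ℝ) (D : Set (ℝ × ℝ)) : Prop :=
  ContDiffOn ℝ ∞ (fun p : ℝ × ℝ => f p.1 p.2) D

namespace SmoothTwo

theorem hasFDerivAt (hf : SmoothTwo f D) (hD : IsOpen D) {p : ℝ × ℝ} (h : p ∈ D) :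
    HasFDerivAt (fun p : ℝ × ℝ => f p.1 p.2) (fderiv ℝ (fun p : ℝ × ℝ => f p.1 p.2) p) p :=
  ((ContDiffOn.contDiffAt hf (hD.mem_nhds h)).differentiableAt (by simp)).hasFDerivAt

theorem pd1_eq (hf : SmoothTwo f D) (hD : IsOpen D) (h : (s, t) ∈ D) :
    pd1 f s t = fderiv ℝ (fun p : ℝ × ℝ => f p.1 p.2) (s, t) (1, 0) :=
  (HasFDerivAt.comp_hasDerivAt (f := fun r : ℝ => (r, t)) s (hf.hasFDerivAt hD h)
    ((hasDerivAt_id s).prodMk (hasDerivAt_const s t))).deriv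

theorem pd2_eq (hf : SmoothTwo f D) (hD : IsOpen D) (h : (s, t) ∈ D) :
    pd2 f s t = fderiv ℝ (fun p : ℝ × ℝ => f p.1 p.2) (s, t) (0, 1) :=
  (HasFDerivAt.comp_hasDerivAt (f := fun r : ℝ => (s, r)) t (hf.hasFDerivAt hD h)
    ((hasDerivAt_const t s).prodMk (hasDerivAt_id t))).deriv

theorem fderiv_smooth (hf : SmoothTwo f D) (hD : IsOpen D) :
    ContDiffOn ℝ ∞ (fderiv ℝ (fun p : ℝ × ℝ => f p.1 p.2)) D :=
  ContDiffOn.fderiv_of_isOpen hf hD (by simp)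

theorem pd1 (hf : SmoothTwo f D) (hD : IsOpen D) : SmoothTwo (pd1 f) D :=
  ((hf.fderiv_smooth hD).clm_apply contDiffOn_const).congr fun _ hp => hf.pd1_eq hD hp

theorem pd2 (hf : SmoothTwo f D) (hD : IsOpen D) : SmoothTwo (pd2 f) D :=
  ((hf.fderiv_smooth hD).clm_apply contDiffOn_const).congr fun _ hp => hf.pd2_eq hD hp

theorem fderiv_fderiv (hf : SmoothTwo f D) (hD : IsOpen D) (h : (s, t) ∈ D) (v w : ℝ × ℝ) :
    fderiv ℝ (fun p => fderiv ℝ (fun p : ℝ × ℝ => f p.1 p.2) p v) (s, t) w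
      = fderiv ℝ (fderiv ℝ (fun p : ℝ × ℝ => f p.1 p.2)) (s, t) w v := by
  have h1 : DifferentiableAt ℝ (fderiv ℝ (fun p : ℝ × ℝ => f p.1 p.2)) (s, t) :=
    ((hf.fderiv_smooth hD).contDiffAt (hD.mem_nhds h)).differentiableAt (by simp)
  rw [fderiv_clm_apply h1 (differentiableAt_const v)]
  simp

theorem pd1_pd2 (hf : SmoothTwo f D) (hD : IsOpen D) (h : (s, t) ∈ D) :
    _root_.pd1 (_root_.pd2 f) s t = _root_.pd2 (_root_.pd1 f) s t := by
  have hn := hD.mem_nhds h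
  rw [(hf.pd2 hD).pd1_eq hD h, (hf.pd1 hD).pd2_eq hD h,
    Filter.EventuallyEq.fderiv_eq (Filter.eventuallyEq_of_mem hn fun p hp => hf.pd2_eq hD hp),
    Filter.EventuallyEq.fderiv_eq (Filter.eventuallyEq_of_mem hn fun p hp => hf.pd1_eq hD hp)]
  have h1 := hf.fderiv_fderiv hD h (0, 1) (1, 0)
  have h2 := hf.fderiv_fderiv hD h (1, 0) (0, 1)
  refine h1.trans (Eq.trans ?_ h2.symm)
  exact (ContDiffOn.contDiffAt hf hn).isSymmSndFDerivAt (minSmoothness_le_infty 2) _ _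

theorem hasDir (hf : SmoothTwo f D) (hD : IsOpen D) (h : (x i, x j) ∈ D) :
    HasDir x v (fun y => f (y i) (y j))
      (v i * _root_.pd1 f (x i) (x j) + v j * _root_.pd2 f (x i) (x j)) := by
  have h1 : HasFDerivAt (fun y : E4 => (y i, y j))
      ((EuclideanSpace.proj i : E4 →L[ℝ] ℝ).prod (EuclideanSpace.proj j)) x :=
    (EuclideanSpace.proj i : E4 →L[ℝ] ℝ).hasFDerivAt.prodMk
      (EuclideanSpace.proj j : E4 →L[ℝ] ℝ).hasFDerivAt
  have h2 := (hf.hasFDerivAt hD h).comp x h1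
  refine ⟨h2.differentiableAt, ?_⟩
  rw [show fderiv ℝ (fun y : E4 => f (y i) (y j)) x = _ from h2.fderiv, hf.pd1_eq hD h,
    hf.pd2_eq hD h]
  have h3 : (v i, v j) = v i • ((1 : ℝ), (0 : ℝ)) + v j • ((0 : ℝ), (1 : ℝ)) := by simp
  change fderiv ℝ (fun p : ℝ × ℝ => f p.1 p.2) (x i, x j) (v i, v j) = _
  rw [h3, map_add, map_smul, map_smul, smul_eq_mul, smul_eq_mul]

theorem smoothFunOn (hf : SmoothTwo f D) {Ω : Set E4} (h : ∀ y ∈ Ω, (y i, y j) ∈ D) :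
    SmoothFunOn (fun y : E4 => f (y i) (y j)) Ω := by
  rw [smoothFunOn_iff]
  have h1 : ContDiffOn ℝ ∞ (fun y : E4 => (y i, y j)) Ω :=
    (((EuclideanSpace.proj i : E4 →L[ℝ] ℝ).contDiff).prodMk
      ((EuclideanSpace.proj j : E4 →L[ℝ] ℝ).contDiff)).contDiffOn
  exact ContDiffOn.comp (g := fun p : ℝ × ℝ => f p.1 p.2) hf h1 h

end SmoothTwo

namespace HasDir

theorem coord (x v : E4) (i : Fin 4) : HasDir x v (fun y => y i) (v i) :=
  ⟨(EuclideanSpace.proj i : E4 →L[ℝ] ℝ).differentiableAt, by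
    rw [show fderiv ℝ (fun y : E4 => y i) x = _ from
      (EuclideanSpace.proj i : E4 →L[ℝ] ℝ).fderiv]
    rfl⟩

theorem exp (x v : E4) (c : ℝ) (i : Fin 4) :
    HasDir x v (fun y => Real.exp (c * y i)) (c * v i * Real.exp (c * x i)) := by
  have h := (const (x := x) (v := v) c).mul (coord x v i)
  refine ⟨h.1.exp, ?_⟩
  rw [fderiv_exp h.1]
  change Real.exp (c * x i) * fderiv ℝ (fun y : E4 => c * y i) x v = _
  rw [h.2]
  ring

end HasDir

end Partial

section FromCoframe

variable {M : Type*} [TopologicalSpace M] [ChartedSpace E4 M] [IsManifold 𝓘(ℝ, E4) ∞ M]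
variable {U V S : Set M} {x : M} {u u' : (x : M) → Coframe x} {P : ℝ}

/-! ### The structure defined by a coframe -/

/-- The metric `2 θ¹ θ³ + 2 θ² θ⁴`. -/
def metricOf (u : (x : M) → Coframe x) (x : M) :
    TangentSpace 𝓘(ℝ, E4) x →L[ℝ] TangentSpace 𝓘(ℝ, E4) x →L[ℝ] ℝ :=
  ∑ a, (theta u a x).smulRight (theta u (flip4 a) x)

/-- The endomorphism `θ¹ ⊗ ∂₁ + θ² ⊗ ∂₂ - θ³ ⊗ ∂₃ - θ⁴ ⊗ ∂₄`. -/
def endoOf (u : (x : M) → Coframe x) (x : M) :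
    TangentSpace 𝓘(ℝ, E4) x →L[ℝ] TangentSpace 𝓘(ℝ, E4) x :=
  ∑ a, (theta u a x).smulRight (sign4 a • dualFrame u a x)

theorem metricOf_apply (u : (x : M) → Coframe x) (x : M) (v w : TangentSpace 𝓘(ℝ, E4) x) :
    metricOf u x v w = theta u 0 x v * theta u 2 x w + theta u 2 x v * theta u 0 x w
      + theta u 1 x v * theta u 3 x w + theta u 3 x v * theta u 1 x w := by
  simp [metricOf, Fin.sum_univ_four, flip4]
  ring

theorem endoOf_apply (u : (x : M) → Coframe x) (x : M) (v : TangentSpace 𝓘(ℝ, E4) x) :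
    endoOf u x v = ∑ a, (sign4 a * theta u a x v) • dualFrame u a x := by
  simp [endoOf, smul_smul, mul_comm]

theorem theta_endoOf (u : (x : M) → Coframe x) (x : M) (a : Fin 4) (v : TangentSpace 𝓘(ℝ, E4) x) :
    theta u a x (endoOf u x v) = sign4 a * theta u a x v := by
  rw [endoOf_apply]
  simp [theta_dualFrame, Matrix.one_apply]

theorem theta_ext {v w : TangentSpace 𝓘(ℝ, E4) x} (h : ∀ a, theta u a x v = theta u a x w) :
    v = w := (u x).injective (funext h)

theorem isAdaptedAt_of (u : (x : M) → Coframe x) (x : M) :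
    IsAdaptedAt (metricOf u) (endoOf u) x (u x) := by
  refine ⟨fun v w => metricOf_apply u x v w, fun v => ?_⟩
  funext a
  refine (theta_endoOf u x a v).trans ?_
  change sign4 a * u x v a = _
  fin_cases a <;> simp [sign4]

/-- The pair (θⁱ, θʲ) maps the eigenspace isomorphically onto ℝ²; the other two components of an
eigenvector vanish because their eigenvalues differ from c. -/
theorem finrank_eigenspace_endoOf (u : (x : M) → Coframe x) (x : M) (c : ℝ) (i j k l : Fin 4)
    (hi : sign4 i = c) (hj : sign4 j = c) (hk : sign4 k ≠ c) (hl : sign4 l ≠ c) (hij : i ≠ j)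
    (h : ∀ a, a = i ∨ a = j ∨ a = k ∨ a = l) :
    Module.finrank ℝ (Module.End.eigenspace
      (endoOf u x : TangentSpace 𝓘(ℝ, E4) x →ₗ[ℝ] TangentSpace 𝓘(ℝ, E4) x) c) = 2 := by
  have hmem : ∀ v, v ∈ Module.End.eigenspace
      (endoOf u x : TangentSpace 𝓘(ℝ, E4) x →ₗ[ℝ] TangentSpace 𝓘(ℝ, E4) x) c ↔
      ∀ a, sign4 a * theta u a x v = c * theta u a x v := by
    intro v
    rw [Module.End.mem_eigenspace_iff]
    constructor
    · intro hv a
      rw [← theta_endoOf, show endoOf u x v = c • v from hv, map_smul, smul_eq_mul]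
    · intro hv
      exact theta_ext (u := u) fun a => by
        rw [map_smul, smul_eq_mul, ← hv a]
        exact theta_endoOf u x a v
  let L : Module.End.eigenspace
      (endoOf u x : TangentSpace 𝓘(ℝ, E4) x →ₗ[ℝ] TangentSpace 𝓘(ℝ, E4) x) c →ₗ[ℝ] (ℝ × ℝ) :=
    ((theta u i x).toLinearMap.prod (theta u j x).toLinearMap).comp (Submodule.subtype _)
  have hL : Function.Bijective L := by
    constructor
    · rw [injective_iff_map_eq_zero]
      intro v hv
      have h1 : theta u i x v = 0 := congrArg Prod.fst hv
      have h2 : theta u j x v = 0 := congrArg Prod.snd hv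
      have h3 := (hmem v).1 v.2
      refine Subtype.ext (theta_ext (u := u) fun a => ?_)
      rw [Submodule.coe_zero, map_zero]
      rcases h a with rfl | rfl | rfl | rfl
      · exact h1
      · exact h2
      · exact (mul_eq_zero.1 (by linear_combination h3 a :
          (sign4 a - c) * theta u a x v = 0)).resolve_left (sub_ne_zero.2 hk)
      · exact (mul_eq_zero.1 (by linear_combination h3 a :
          (sign4 a - c) * theta u a x v = 0)).resolve_left (sub_ne_zero.2 hl)
    · rintro ⟨s, t⟩
      refine ⟨⟨s • dualFrame u i x + t • dualFrame u j x, (hmem _).2 fun a => ?_⟩, ?_⟩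
      · simp only [map_add, map_smul, theta_dualFrame, Matrix.one_apply, smul_eq_mul]
        by_cases h1 : a = i
        · rw [h1, hi]
        · by_cases h2 : a = j
          · rw [h2, hj]
          · simp [h1, h2]
      · change (theta u i x (s • dualFrame u i x + t • dualFrame u j x),
          theta u j x (s • dualFrame u i x + t • dualFrame u j x)) = (s, t)
        simp [theta_dualFrame, hij, hij.symm]
  rw [(LinearEquiv.ofBijective L hL).finrank_eq]
  simp

namespace IsFrameOn

theorem isAlmostParaHermitian (F : IsFrameOn S u) :
    IsAlmostParaHermitian S (metricOf u) (endoOf u) where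
  smooth_g U hU hUS X Y hX hY := by
    have h := fun a => F.smooth_theta U hUS hU X hX a
    have k := fun a => F.smooth_theta U hUS hU Y hY a
    exact (((((h 0).mul (k 2)).add ((h 2).mul (k 0))).add ((h 1).mul (k 3))).add
      ((h 3).mul (k 1))).congr fun x _ => metricOf_apply u x _ _
  smooth_K U hU hUS X hX :=
    (SmoothFieldOn.sum fun a (_ : a ∈ Finset.univ) => SmoothFieldOn.smul
      ((SmoothFunOn.const (sign4 a)).mul (F.smooth_theta U hUS hU X hX a))
      ((F.smooth a).mono hUS)).congr fun x _ => endoOf_apply u x _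
  symm x _ v w := by rw [metricOf_apply, metricOf_apply]; ring
  nondegenerate x _ v h := theta_ext (u := u) fun a => by
    rw [(isAdaptedAt_of u x).theta_eq, h, map_zero]
  K_sq x _ v := theta_ext (u := u) fun a => by
    rw [theta_endoOf, theta_endoOf]
    fin_cases a <;> simp [sign4]
  rank_pos x _ := finrank_eigenspace_endoOf u x 1 0 1 2 3 (by simp [sign4]) (by simp [sign4])
    (by simp [sign4]; norm_num) (by simp [sign4]; norm_num) (by decide) (by decide)
  rank_neg x _ := finrank_eigenspace_endoOf u x (-1) 2 3 0 1 (by simp [sign4]) (by simp [sign4])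
    (by simp [sign4]; norm_num) (by simp [sign4]; norm_num) (by decide) (by decide)
  compatible x _ v w := by
    simp [metricOf_apply, theta_endoOf, sign4]
    ring

end IsFrameOn

namespace IsKahlerFrameOn

theorem Gam_eq (F : IsKahlerFrameOn S u) (hx : x ∈ S) :
    (Gam u 2 2 x = - Gam u 0 0 x ∧ Gam u 2 3 x = - Gam u 1 0 x ∧ Gam u 3 2 x = - Gam u 0 1 x ∧
      Gam u 3 3 x = - Gam u 1 1 x) ∧
    (Gam u 2 0 x = 0 ∧ Gam u 2 1 x = 0 ∧ Gam u 3 0 x = 0 ∧ Gam u 3 1 x = 0) ∧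
    Gam u 0 2 x = 0 ∧ Gam u 0 3 x = 0 ∧ Gam u 1 2 x = 0 ∧ Gam u 1 3 x = 0 := by
  have l := fun c => gammaCoef_lower u c x
  refine ⟨⟨?_, ?_, ?_, ?_⟩, ⟨?_, ?_, ?_, ?_⟩, ?_, ?_, ?_, ?_⟩
  iterate 4
    · simp only [Gam, Fin.sum_univ_four, (l _).1, (l _).2.1, (l _).2.2.1, (l _).2.2.2.1]
      module
  all_goals
    simp [Gam, (l _).2.2.2.2.1, (l _).2.2.2.2.2.1, (l _).2.2.2.2.2.2.1, (l _).2.2.2.2.2.2.2.1,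
      F.gamma_zero_three x hx, F.gamma_three_zero x hx, F.gamma_one_two hx, F.gamma_two_one hx]

/-- The connection is torsion-free and preserves the eigenspaces: each term of `theta_bracket`
contains either a component of X or Y outside the eigenspace or an off-block connection form. This
is involutivity of both eigendistributions. -/
theorem theta_bracket_eq_zero (F : IsKahlerFrameOn S u) (hx : x ∈ S) {X Y : VField M}
    (hX : SmoothFieldOn X S) (hY : SmoothFieldOn Y S) {c : ℝ}
    (eX : ∀ x ∈ S, endoOf u x (X x) = c • X x) (eY : ∀ x ∈ S, endoOf u x (Y x) = c • Y x)
    (a : Fin 4) (ha : sign4 a ≠ c) : theta u a x (bracket X Y x) = 0 := by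
  have key : ∀ {X : VField M}, (∀ x ∈ S, endoOf u x (X x) = c • X x) → ∀ x ∈ S, ∀ a,
      sign4 a ≠ c → theta u a x (X x) = 0 := by
    intro X eX x hx a ha
    have h1 := theta_endoOf u x a (X x)
    rw [eX x hx, map_smul, smul_eq_mul] at h1
    exact (mul_eq_zero.1 (by linear_combination - h1 :
      (sign4 a - c) * theta u a x (X x) = 0)).resolve_left (sub_ne_zero.2 ha)
  obtain ⟨-, ⟨g1, g2, g3, g4⟩, g5, g6, g7, g8⟩ := F.Gam_eq hx
  rw [F.theta_bracket hx hX hY, derivAlong_congr F.isOpen hx fun z hz => key eY z hz a ha,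
    derivAlong_congr F.isOpen hx fun z hz => key eX z hz a ha, derivAlong_const, derivAlong_const]
  have hb : ∀ b, sign4 b ≠ sign4 a ∧ Gam u a b x = 0 ∨ sign4 b = sign4 a := by
    intro b
    fin_cases a <;> fin_cases b <;> simp [sign4, g1, g2, g3, g4, g5, g6, g7, g8] <;> norm_num
  rw [sub_zero, zero_add]
  refine Finset.sum_eq_zero fun b _ => ?_
  rcases hb b with ⟨-, h⟩ | h
  · simp [h]
  · rw [key eX x hx b (h ▸ ha), key eY x hx b (h ▸ ha)]
    ring

/-- The Levi-Civita connection preserves both g and the splitting, so ρ is parallel. A parallel form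
is closed because the connection is torsion-free; this appears below as a cancellation after every
bracket is replaced by the torsion-free formula. -/
theorem isParaKahler (F : IsKahlerFrameOn S u) : IsParaKahler S (metricOf u) (endoOf u) where
  toIsAlmostParaHermitian := F.isAlmostParaHermitian
  integrable_pos U hU hUS X Y hX hY eX eY x hx := by
    have h := (F.mono hU hUS).theta_bracket_eq_zero hx hX hY (c := 1)
      (fun x hx => by rw [eX x hx, one_smul]) (fun x hx => by rw [eY x hx, one_smul])
    refine theta_ext (u := u) fun a => ?_
    rw [theta_endoOf]
    by_cases ha : sign4 a = 1
    · rw [ha, one_mul]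
    · rw [h a ha, mul_zero]
  integrable_neg U hU hUS X Y hX hY eX eY x hx := by
    have h := (F.mono hU hUS).theta_bracket_eq_zero hx hX hY (c := -1)
      (fun x hx => by rw [eX x hx, neg_one_smul]) (fun x hx => by rw [eY x hx, neg_one_smul])
    refine theta_ext (u := u) fun a => ?_
    rw [theta_endoOf, map_neg]
    by_cases ha : sign4 a = -1
    · rw [ha, neg_one_mul]
    · rw [h a ha, mul_zero, neg_zero]
  closed U hU hUS X Y Z hX hY hZ x hx := by
    have F' := F.mono hU hUS
    have D : ∀ X Y Z : VField M, SmoothFieldOn Y U → SmoothFieldOn Z U →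
        derivAlong X (fun z => metricOf u z (endoOf u z (Y z)) (Z z)) x
        = derivAlong X (fun z => theta u 0 z (Y z)) x * theta u 2 x (Z x)
        + theta u 0 x (Y x) * derivAlong X (fun z => theta u 2 z (Z z)) x
        - derivAlong X (fun z => theta u 2 z (Y z)) x * theta u 0 x (Z x)
        - theta u 2 x (Y x) * derivAlong X (fun z => theta u 0 z (Z z)) x
        + derivAlong X (fun z => theta u 1 z (Y z)) x * theta u 3 x (Z x)
        + theta u 1 x (Y x) * derivAlong X (fun z => theta u 3 z (Z z)) x
        - derivAlong X (fun z => theta u 3 z (Y z)) x * theta u 1 x (Z x)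
        - theta u 3 x (Y x) * derivAlong X (fun z => theta u 1 z (Z z)) x := by
      intro X Y Z hY hZ
      have h := fun a => (F'.smooth_theta U subset_rfl hU Y hY a)
      have k := fun a => (F'.smooth_theta U subset_rfl hU Z hZ a)
      have e : (fun z => metricOf u z (endoOf u z (Y z)) (Z z)) = fun z =>
          theta u 0 z (Y z) * theta u 2 z (Z z) - theta u 2 z (Y z) * theta u 0 z (Z z)
          + (theta u 1 z (Y z) * theta u 3 z (Z z) - theta u 3 z (Y z) * theta u 1 z (Z z)) := by
        funext z
        simp [metricOf_apply, theta_endoOf, sign4]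
        ring
      rw [e, derivAlong_add hU hx (((h 0).mul (k 2)).sub ((h 2).mul (k 0)))
          (((h 1).mul (k 3)).sub ((h 3).mul (k 1))),
        derivAlong_sub hU hx ((h 0).mul (k 2)) ((h 2).mul (k 0)),
        derivAlong_sub hU hx ((h 1).mul (k 3)) ((h 3).mul (k 1)),
        derivAlong_mul hU hx (h 0) (k 2), derivAlong_mul hU hx (h 2) (k 0),
        derivAlong_mul hU hx (h 1) (k 3), derivAlong_mul hU hx (h 3) (k 1)]
      ring
    rw [D X Y Z hY hZ, D Y Z X hZ hX, D Z X Y hX hY]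
    obtain ⟨⟨a1, a2, a3, a4⟩, ⟨g1, g2, g3, g4⟩, g5, g6, g7, g8⟩ := F'.Gam_eq hx
    simp only [metricOf_apply, theta_endoOf, F'.theta_bracket hx hX hY, F'.theta_bracket hx hY hZ,
      F'.theta_bracket hx hZ hX, Fin.sum_univ_four, a1, a2, a3, a4, g1, g2, g3, g4, g5, g6, g7, g8,
      zero_apply, neg_apply]
    simp only [sign4, Matrix.cons_val]
    ring

/-- The definition quantifies over all adapted coframes, but one suffices: the Einstein condition is
tensorial, and Ψ₂' = −R/12 is a scalar. -/
theorem isPKE (F : IsKahlerFrameOn S u) (hE : ∀ x ∈ S, IsEinsteinAt u x)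
    (hP : ∀ x ∈ S, psi2' u x = P) (h0 : P ≠ 0) : IsPKE S (metricOf u) (endoOf u) P where
  toIsParaKahler := F.isParaKahler
  einstein U hU hUS u' hu' x hx :=
    ((F.isAlmostParaHermitian.isParaChange hU hUS
      ⟨(F.mono hU hUS).smooth, fun x _ => isAdaptedAt_of u x⟩ hu').einstein hx (hE x (hUS hx))).1
  psi2'_eq U hU hUS u' hu' x hx := by
    have C := F.isAlmostParaHermitian.isParaChange hU hUS
      ⟨(F.mono hU hUS).smooth, fun x _ => isAdaptedAt_of u x⟩ hu'
    obtain ⟨e, s⟩ := C.einstein hx (hE x (hUS hx))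
    rw [(F.isParaKahler.isKahlerFrameOn hU hUS hu').psi2'_eq hx e, s,
      ← F.psi2'_eq (hUS hx) (hE x (hUS hx)), hP x (hUS hx)]
  ne_zero := h0

end IsKahlerFrameOn

namespace IsPKE

variable {g : (x : M) → TangentSpace 𝓘(ℝ, E4) x →L[ℝ] TangentSpace 𝓘(ℝ, E4) x →L[ℝ] ℝ}
  {K : (x : M) → TangentSpace 𝓘(ℝ, E4) x →L[ℝ] TangentSpace 𝓘(ℝ, E4) x}

theorem isPetrovIII (H : IsPKE S g K P) (hu : IsTripleRootAdaptedOn g K S u) :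
    IsPetrovIII S g K := by
  intro U hU hUS u' hu' x hx
  have h := H.weylQuartic_eq hU hUS (hu.1.mono hUS) hu' hx (β := transMat u u' x) rfl
  have hδ := ((H.isParaChange hU hUS (hu.1.mono hUS) hu').trans_entries hx rfl).1
  obtain ⟨z0, z1, z2, z3⟩ := hu.2 x (hUS hx)
  set p := transMat u u' x 0 0
  set q := transMat u u' x 0 1
  set r := transMat u u' x 1 0
  set m := transMat u u' x 1 1
  obtain ⟨k, hk, hk'⟩ : ∃ k, k = (p * m - q * r)⁻¹ ∧ k ≠ 0 := ⟨_, rfl, inv_ne_zero hδ⟩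
  rw [← hk] at h
  -- In u the quartic is t³(4Ψ₃ s + Ψ₄ t). Substituting (ps + qt, rs + mt) gives the triple factor
  -- rs + mt, and the simple factor absorbs the weight k².
  refine ⟨r, m, k ^ 2 * (4 * psi3 u x * p + psi4 u x * r), k ^ 2 * (4 * psi3 u x * q + psi4 u x * m),
    ?_, fun s t => ?_⟩
  · have e : r * (k ^ 2 * (4 * psi3 u x * q + psi4 u x * m))
        - m * (k ^ 2 * (4 * psi3 u x * p + psi4 u x * r))
        = -(k ^ 2 * (4 * psi3 u x) * (p * m - q * r)) := by ring
    rw [e]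
    exact neg_ne_zero.2 (mul_ne_zero (by positivity) hδ)
  · rw [h, weylQuartic, z0, z1, z2]
    ring

theorem jtwoNonvanishing (H : IsPKE S g K P) (hu : IsTripleRootAdaptedOn g K S u)
    (hJ : ∀ x ∈ S, Jtwo u x ≠ 0) : JtwoNonvanishing S g K := by
  intro U hU hUS u' hu' x hx h0
  have h := H.Jtwo_change hU hUS (hu.mono hUS) hu' hx
  rw [h0, zero_mul] at h
  exact hJ x (hUS hx) h.symm

end IsPKE

end FromCoframe

section Example

/-! ### The coefficients of the explicit coframe -/

/-- `exp (y⁴ / 2)`. -/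
def exE (y : E4) : ℝ := Real.exp (1 / 2 * y 3)

/-- `exp (- y⁴ / 2)`. -/
def exF (y : E4) : ℝ := Real.exp (-1 / 2 * y 3)

theorem exF_eq (y : E4) : exF y = (exE y)⁻¹ := by
  rw [exF, exE, ← Real.exp_neg]
  ring_nf

theorem exE_ne (y : E4) : exE y ≠ 0 := (Real.exp_pos _).ne'

variable (P : ℝ) (U W : ℝ → ℝ → ℝ)

/-- The function `U (y¹, y³)` on `ℝ⁴`. -/
def exU (y : E4) : ℝ := U (y 0) (y 2)

/-- The coefficient of `dy¹` in `θ¹`. -/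
def exA1 (y : E4) : ℝ :=
  -(1 / 4) * (3 * exE y * P * y 0 + y 1 * exE y * P + 6 * P ^ 2 * y 0 + 2 * y 1 * exE y ^ 2
    - 2 * exE y * pd1 W (y 2) (y 3) - P * pd1 W (y 2) (y 3) + exE y ^ 2 - pd1 U (y 0) (y 2)
    + pd1 (pd1 U) (y 0) (y 2)) * exF y ^ 4

/-- The coefficient of `dy³` in `θ¹`. -/
def exA3 (y : E4) : ℝ :=
  -(1 / 4) * (6 * P ^ 2 * y 0 * y 1 * exE y - 9 * y 1 * exE y ^ 2 * P * y 0
    + exE y ^ 2 * P * y 1 ^ 2 + 9 * P * y 0 * pd1 W (y 2) (y 3) * exE y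
    - 2 * pd1 W (y 2) (y 3) * P * y 1 * exE y - 6 * P ^ 2 * y 0 * pd1 W (y 2) (y 3)
    + 4 * y 1 * exE y ^ 2 * pd1 W (y 2) (y 3) - 2 * pd1 W (y 2) (y 3) ^ 2 * exE y
    - pd1 U (y 0) (y 2) * y 1 * exE y + pd1 (pd1 U) (y 0) (y 2) * y 1 * exE y
    + pd1 W (y 2) (y 3) ^ 2 * P - 2 * y 1 ^ 2 * exE y ^ 3 - exE y ^ 2 * pd1 W (y 2) (y 3)
    - 4 * exU U y * exE y + 4 * pd1 (pd1 W) (y 2) (y 3) * exE y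
    + pd1 U (y 0) (y 2) * pd1 W (y 2) (y 3) - pd1 W (y 2) (y 3) * pd1 (pd1 U) (y 0) (y 2)
    + y 1 * exE y ^ 3) * exF y ^ 4

/-- The coefficient of `dy⁴` in `θ¹`. -/
def exA4 (y : E4) : ℝ := 1 / 2 * exF y ^ 3 * (y 1 * exE y - 2 * pd2 (pd1 W) (y 2) (y 3))

/-- The coefficient of `dy³` in `θ²`. -/
def exB (y : E4) : ℝ := y 1 - exF y * pd1 W (y 2) (y 3)

/-- The coefficient of `dy¹` in `θ⁴`. -/
def exC1 (y : E4) : ℝ := -P * exF y - 1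

/-- The coefficient of `dy³` in `θ⁴`. -/
def exC3 (y : E4) : ℝ :=
  3 / 2 * exF y * P ^ 2 * y 0 + 3 / 4 * exF y * pd1 W (y 2) (y 3) * P
    - 1 / 4 * exF y * pd1 U (y 0) (y 2) + 1 / 4 * exF y * pd1 (pd1 U) (y 0) (y 2)
    - 1 / 2 * y 1 * exE y + 3 / 4 * P * y 0 - 3 / 4 * P * y 1 - 3 / 4 * exE y
    + 1 / 2 * pd1 W (y 2) (y 3)

/-- The coefficients `Aᵃ_k` of `θᵃ = Aᵃ_k dyᵏ`. -/
def exCoef (a k : Fin 4) (y : E4) : ℝ :=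
  !![exA1 P U W y, exF y ^ 2, exA3 P U W y, exA4 W y;
    exF y, 0, exB W y, 0;
    0, 0, exE y ^ 2, 0;
    exC1 P y, 0, exC3 P U W y, 1 / 2] a k

/-- The components `dyᵏ(∂_b)` of the dual frame. -/
def exFrame (b k : Fin 4) (y : E4) : ℝ :=
  -- Here `v0` and `v3` are the dy¹ and dy⁴ components of ∂₃. Only θ¹ contains dy², so the dy²
  -- components are solved for last, from the value of θ¹.
  let v0 := - exF y * exB W y
  let v3 := - 2 * ((P * exF y + 1) * exF y * exB W y + exC3 P U W y * exF y ^ 2)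
  !![0, exE y ^ 2, 0, 0;
    exE y, - exE y ^ 2 * (exA1 P U W y * exE y + exA4 W y * (2 * (P + exE y))), 0,
      2 * (P + exE y);
    v0, - exE y ^ 2 * (exA1 P U W y * v0 + exA3 P U W y * exF y ^ 2 + exA4 W y * v3),
      exF y ^ 2, v3;
    0, - 2 * exE y ^ 2 * exA4 W y, 0, 2] b k

theorem exCoef_mul_exFrame (y : E4) :
    (Matrix.of fun a k => exCoef P U W a k y) * (Matrix.of fun k b => exFrame P U W b k y) = 1 := by
  ext a b
  have h := exE_ne y
  rw [Matrix.mul_apply, Fin.sum_univ_four]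
  fin_cases a <;> fin_cases b <;>
    simp [exCoef, exFrame, exC1, exF_eq] <;> field_simp <;> ring

/-- The explicit coframe. -/
def exCoframe (y : E4) : Coframe y :=
  (EuclideanSpace.equiv (Fin 4) ℝ).trans
    (Matrix.toLin'OfInv (mul_eq_one_comm.1 (exCoef_mul_exFrame P U W y))
      (exCoef_mul_exFrame P U W y)).toContinuousLinearEquiv

theorem exCoframe_apply (y v : E4) (a : Fin 4) :
    exCoframe P U W y v a = ∑ k, exCoef P U W a k y * v k := by
  change (Matrix.toLin'OfInv (mul_eq_one_comm.1 (exCoef_mul_exFrame P U W y))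
    (exCoef_mul_exFrame P U W y)).toContinuousLinearEquiv
    (EuclideanSpace.equiv (Fin 4) ℝ v) a = _
  rw [LinearEquiv.coe_toContinuousLinearEquiv', Matrix.toLin'OfInv_apply]
  rfl

theorem dualFrame_exCoframe (b k : Fin 4) (y : E4) :
    theta coordCoframe k y (dualFrame (exCoframe P U W) b y) = exFrame P U W b k y := by
  have h : dualFrame (exCoframe P U W) b y = WithLp.toLp 2 fun k => exFrame P U W b k y := by
    refine (ContinuousLinearEquiv.symm_apply_eq _).2 (funext fun a => ?_)
    rw [exCoframe_apply]
    have := congrFun₂ (exCoef_mul_exFrame P U W y) a b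
    rw [Matrix.mul_apply] at this
    refine Eq.trans ?_ this.symm
    simp [Matrix.one_apply, Pi.single_apply]
  rw [h, theta_coordCoframe]

theorem exCoframe_eq_exampleForms (y v : E4) :
    exCoframe P U W y v = exampleForms P U W y v := by
  -- Every exponent is a multiple of 1/2, so the coefficients are polynomial in `exE` and its
  -- inverse `exF`, which brings later identities within reach of polynomial arithmetic.
  have e : ∀ (r : ℝ) (n : ℕ), r = n * (1 / 2) → Real.exp (r * y 3) = exE y ^ n := by
    intro r n h
    rw [exE, ← Real.exp_nat_mul, h]
    ring_nf
  have f : ∀ (r : ℝ) (n : ℕ), r = n * (-1 / 2) → Real.exp (r * y 3) = exF y ^ n := by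
    intro r n h
    rw [exF, ← Real.exp_nat_mul, h]
    ring_nf
  funext a
  rw [exCoframe_apply, Fin.sum_univ_four]
  have e1 := e (1 / 2) 1 (by norm_num)
  have e2 := e 1 2 (by norm_num)
  have e3 := e (3 / 2) 3 (by norm_num)
  have f1 := f (-1 / 2) 1 (by norm_num)
  have f2 := f (-1) 2 (by norm_num)
  have f3 := f (-3 / 2) 3 (by norm_num)
  have f4 := f (-2) 4 (by norm_num)
  rw [exampleForms]
  simp only [e1, e2, e3, f1, f2, f3, f4]
  fin_cases a
  · simp [exCoef, exU, exA1, exA3, exA4, pd1, pd2]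
    ring
  · simp [exCoef, exB, pd1]
  · simp [exCoef]
  · simp [exCoef, exC1, exC3, pd1]
    ring

end Example

section ExampleDer

/-! ### The derivatives of the coefficients -/

variable (P : ℝ) (U W : ℝ → ℝ → ℝ)

/-- The derivative of `Aᵃ_k` in the direction `v`. -/
def exDer (a k : Fin 4) (y : E4) (v : Fin 4 → ℝ) : ℝ :=
  let E := exE y
  let F := exF y
  let U1 := pd1 U (y 0) (y 2)
  let U11 := pd1 (pd1 U) (y 0) (y 2)
  let W3 := pd1 W (y 2) (y 3)
  let W33 := pd1 (pd1 W) (y 2) (y 3)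
  let W34 := pd2 (pd1 W) (y 2) (y 3)
  let dU0 := v 0 * U1 + v 2 * pd2 U (y 0) (y 2)
  let dU1 := v 0 * U11 + v 2 * pd2 (pd1 U) (y 0) (y 2)
  let dU11 := v 0 * pd1 (pd1 (pd1 U)) (y 0) (y 2) + v 2 * pd2 (pd1 (pd1 U)) (y 0) (y 2)
  let dW3 := v 2 * W33 + v 3 * W34
  let dW33 := v 2 * pd1 (pd1 (pd1 W)) (y 2) (y 3) + v 3 * pd2 (pd1 (pd1 W)) (y 2) (y 3)
  let dW34 := v 2 * pd2 (pd1 (pd1 W)) (y 2) (y 3) + v 3 * pd2 (pd2 (pd1 W)) (y 2) (y 3)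
  let dA1 := -(1 / 4) * (3 * (v 3 / 2 * E) * P * y 0 + 3 * E * P * v 0 + v 1 * E * P
      + y 1 * (v 3 / 2 * E) * P + 6 * P ^ 2 * v 0 + 2 * v 1 * E ^ 2 + 2 * y 1 * (v 3 * E ^ 2)
      - v 3 * E * W3 - 2 * E * dW3 - P * dW3 + v 3 * E ^ 2 - dU1 + dU11) * F ^ 4
    - 2 * v 3 * exA1 P U W y
  let dA3 := -(1 / 4) * (6 * P ^ 2 * (v 0 * y 1 + y 0 * v 1 + y 0 * y 1 * (v 3 / 2)) * E
      - 9 * P * (v 1 * y 0 + y 1 * v 0 + y 1 * y 0 * v 3) * E ^ 2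
      + P * (v 3 * y 1 ^ 2 + 2 * y 1 * v 1) * E ^ 2
      + 9 * P * (v 0 * W3 + y 0 * dW3 + y 0 * W3 * (v 3 / 2)) * E
      - 2 * P * (dW3 * y 1 + W3 * v 1 + W3 * y 1 * (v 3 / 2)) * E
      - 6 * P ^ 2 * (v 0 * W3 + y 0 * dW3)
      + 4 * (v 1 * W3 + y 1 * dW3 + y 1 * W3 * v 3) * E ^ 2
      - 2 * (2 * W3 * dW3 + W3 ^ 2 * (v 3 / 2)) * E
      - (dU1 * y 1 + U1 * v 1 + U1 * y 1 * (v 3 / 2)) * E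
      + (dU11 * y 1 + U11 * v 1 + U11 * y 1 * (v 3 / 2)) * E
      + 2 * W3 * dW3 * P - (4 * y 1 * v 1 + 3 * y 1 ^ 2 * v 3) * E ^ 3
      - (v 3 * W3 + dW3) * E ^ 2 - 4 * (dU0 + exU U y * (v 3 / 2)) * E
      + 4 * (dW33 + W33 * (v 3 / 2)) * E + dU1 * W3 + U1 * dW3 - dW3 * U11 - W3 * dU11
      + (v 1 + y 1 * (3 / 2 * v 3)) * E ^ 3) * F ^ 4
    - 2 * v 3 * exA3 P U W y
  let dA4 := 1 / 2 * F ^ 3 * (v 1 * E + y 1 * (v 3 / 2 * E) - 2 * dW34) - 3 / 2 * v 3 * exA4 W y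
  let dC3 := 3 / 2 * F * P ^ 2 * (v 0 - y 0 * (v 3 / 2)) + 3 / 4 * F * P * (dW3 - W3 * (v 3 / 2))
    - 1 / 4 * F * (dU1 - U1 * (v 3 / 2)) + 1 / 4 * F * (dU11 - U11 * (v 3 / 2))
    - 1 / 2 * (v 1 + y 1 * (v 3 / 2)) * E + 3 / 4 * P * v 0 - 3 / 4 * P * v 1
    - 3 / 4 * (v 3 / 2 * E) + 1 / 2 * dW3
  !![dA1, - v 3 * F ^ 2, dA3, dA4;
    - (v 3 / 2) * F, 0, v 1 + F * (v 3 / 2 * W3 - dW3), 0;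
    0, 0, v 3 * E ^ 2, 0;
    P * (v 3 / 2) * F, 0, dC3, 0] a k

variable {P U W} {DU DW : Set (ℝ × ℝ)} {y v : E4} {Ω : Set E4}

theorem HasDir.of_eq {x v : E4} {f : E4 → ℝ} {d e : ℝ} (h : HasDir x v f d) (he : d = e) :
    HasDir x v f e := he ▸ h

theorem hasDir_exE : HasDir y v exE (v 3 / 2 * exE y) :=
  (HasDir.exp y v (1 / 2) 3).of_eq (by rw [exE]; ring)

theorem hasDir_exF : HasDir y v exF (-(v 3 / 2 * exF y)) :=
  (HasDir.exp y v (-1 / 2) 3).of_eq (by rw [exF]; ring)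

theorem hasDir_exCoef (hU : SmoothTwo U DU) (hDU : IsOpen DU) (hW : SmoothTwo W DW)
    (hDW : IsOpen DW) (yU : (y 0, y 2) ∈ DU) (yW : (y 2, y 3) ∈ DW) (a k : Fin 4) :
    HasDir y v (exCoef P U W a k) (exDer P U W a k y v) := by
  have hE := hasDir_exE (y := y) (v := v)
  have hF := hasDir_exF (y := y) (v := v)
  have hU1 := hU.pd1 hDU
  have hW1 := hW.pd1 hDW
  have d0 : HasDir y v (exU U) _ := hU.hasDir (v := v) hDU yU
  have d1 := hU1.hasDir (v := v) hDU yU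
  have d2 := (hU1.pd1 hDU).hasDir (v := v) hDU yU
  have e1 := hW1.hasDir (v := v) hDW yW
  have e2 := (hW1.pd1 hDW).hasDir (v := v) hDW yW
  have e3 := (hW1.pd2 hDW).hasDir (v := v) hDW yW
  -- `exDer` records a single mixed third derivative of W, so the other order of differentiation is
  -- converted into it.
  rw [hW1.pd1_pd2 hDW yW] at e3
  fin_cases a <;> fin_cases k
  on_goal 1 => change HasDir y v (fun y => exA1 P U W y) _; unfold exA1
  on_goal 2 => change HasDir y v (fun y => exF y ^ 2) _
  on_goal 3 => change HasDir y v (fun y => exA3 P U W y) _; unfold exA3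
  on_goal 4 => change HasDir y v (fun y => exA4 W y) _; unfold exA4
  on_goal 5 => change HasDir y v (fun y => exF y) _
  on_goal 6 => change HasDir y v (fun y => 0) _
  on_goal 7 => change HasDir y v (fun y => exB W y) _; unfold exB
  on_goal 8 => change HasDir y v (fun y => 0) _
  on_goal 9 => change HasDir y v (fun y => 0) _
  on_goal 10 => change HasDir y v (fun y => 0) _
  on_goal 11 => change HasDir y v (fun y => exE y ^ 2) _
  on_goal 12 => change HasDir y v (fun y => 0) _
  on_goal 13 => change HasDir y v (fun y => exC1 P y) _; unfold exC1
  on_goal 14 => change HasDir y v (fun y => 0) _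
  on_goal 15 => change HasDir y v (fun y => exC3 P U W y) _; unfold exC3
  on_goal 16 => change HasDir y v (fun y => 1 / 2) _
  all_goals
    -- The differentiation rules follow the syntax of the coefficient and assemble its derivative;
    -- only then is the result compared with `exDer`.
    apply HasDir.of_eq
    · with_reducible repeat' first
        | exact HasDir.const _
        | exact hE
        | exact hF
        | exact HasDir.coord y v _
        | exact d0
        | exact d1
        | exact d2
        | exact e1
        | exact e2
        | exact e3
        | apply HasDir.add
        | apply HasDir.sub
        | apply HasDir.mul
        | apply HasDir.pow
    · simp [exDer, exA1, exA3, exA4]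
      try ring

theorem smooth_exCoef (hU : SmoothTwo U DU) (hDU : IsOpen DU) (hW : SmoothTwo W DW)
    (hDW : IsOpen DW) (hΩ : ∀ y ∈ Ω, (y 0, y 2) ∈ DU ∧ (y 2, y 3) ∈ DW) (a k : Fin 4) :
    SmoothFunOn (exCoef P U W a k) Ω ∧ SmoothFunOn (exFrame P U W a k) Ω := by
  have hc : ∀ i : Fin 4, ContDiffOn ℝ ∞ (fun y : E4 => y i) Ω := fun i =>
    ((EuclideanSpace.proj i : E4 →L[ℝ] ℝ).contDiff).contDiffOn
  have hE : ContDiffOn ℝ ∞ exE Ω := (contDiffOn_const.mul (hc 3)).exp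
  have hF : ContDiffOn ℝ ∞ exF Ω := (contDiffOn_const.mul (hc 3)).exp
  have hU1 := hU.pd1 hDU
  have hW1 := hW.pd1 hDW
  have d0 : ContDiffOn ℝ ∞ (exU U) Ω := smoothFunOn_iff.1 (hU.smoothFunOn fun y hy => (hΩ y hy).1)
  have d1 := smoothFunOn_iff.1 (hU1.smoothFunOn fun y hy => (hΩ y hy).1)
  have d2 := smoothFunOn_iff.1 ((hU1.pd1 hDU).smoothFunOn fun y hy => (hΩ y hy).1)
  have e1 := smoothFunOn_iff.1 (hW1.smoothFunOn fun y hy => (hΩ y hy).2)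
  have e2 := smoothFunOn_iff.1 ((hW1.pd1 hDW).smoothFunOn fun y hy => (hΩ y hy).2)
  have e3 := smoothFunOn_iff.1 ((hW1.pd2 hDW).smoothFunOn fun y hy => (hΩ y hy).2)
  have a1 : ContDiffOn ℝ ∞ (exA1 P U W) Ω := by unfold exA1; fun_prop
  have a3 : ContDiffOn ℝ ∞ (exA3 P U W) Ω := by unfold exA3; fun_prop
  have a4 : ContDiffOn ℝ ∞ (exA4 W) Ω := by unfold exA4; fun_prop
  have b : ContDiffOn ℝ ∞ (exB W) Ω := by unfold exB; fun_prop
  have c1 : ContDiffOn ℝ ∞ (exC1 P) Ω := by unfold exC1; fun_prop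
  have c3 : ContDiffOn ℝ ∞ (exC3 P U W) Ω := by unfold exC3; fun_prop
  rw [smoothFunOn_iff, smoothFunOn_iff]
  constructor
  · unfold exCoef
    fin_cases a <;> fin_cases k <;> simp <;> fun_prop
  · unfold exFrame
    fin_cases a <;> fin_cases k <;> simp <;> fun_prop

end ExampleDer

section ExampleStruct

/-! ### The structure functions of the explicit coframe -/

/-- `U (y¹, y³)` and `W (y³, y⁴)` are smooth functions on open sets, and `Ω ⊆ ℝ⁴` is an open set on
which they are defined. -/
structure IsExampleDomain (DU DW : Set (ℝ × ℝ)) (U W : ℝ → ℝ → ℝ) (Ω : Set E4) : Prop where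
  isOpen_U : IsOpen DU
  isOpen_W : IsOpen DW
  smooth_U : SmoothTwo U DU
  smooth_W : SmoothTwo W DW
  isOpen : IsOpen Ω
  mem_U : ∀ y ∈ Ω, (y 0, y 2) ∈ DU
  mem_W : ∀ y ∈ Ω, (y 2, y 3) ∈ DW

variable {P : ℝ} {DU DW : Set (ℝ × ℝ)} {U W : ℝ → ℝ → ℝ} {Ω : Set E4} {y : E4}

namespace IsExampleDomain

theorem theta_eq (y : E4) (a : Fin 4) : theta (exCoframe P U W) a y
    = ∑ k, exCoef P U W a k y • theta coordCoframe k y := by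
  ext v
  refine (exCoframe_apply P U W y v a).trans ?_
  simp only [sum_apply, smul_apply, smul_eq_mul]
  rfl

theorem smoothCoframeOn (H : IsExampleDomain DU DW U W Ω) :
    SmoothCoframeOn (exCoframe P U W) Ω := fun b =>
  smoothFieldOn_iff.2 (contDiffOn_euclidean.2 fun k => (smoothFunOn_iff.1
    (smooth_exCoef H.smooth_U H.isOpen_U H.smooth_W H.isOpen_W
      (fun y hy => ⟨H.mem_U y hy, H.mem_W y hy⟩) b k).2).congr fun y _ =>
      dualFrame_exCoframe P U W b k y)

theorem smooth_coef (H : IsExampleDomain DU DW U W Ω) (a k : Fin 4) :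
    SmoothFunOn (exCoef P U W a k) Ω :=
  (smooth_exCoef H.smooth_U H.isOpen_U H.smooth_W H.isOpen_W
      (fun y hy => ⟨H.mem_U y hy, H.mem_W y hy⟩) a k).1

theorem isFrameOn (H : IsExampleDomain DU DW U W Ω) : IsFrameOn Ω (exCoframe P U W) :=
  isFrameOn_of_coord H.isOpen H.smooth_coef (fun y _ a => theta_eq y a) H.smoothCoframeOn

theorem structFun_eq (H : IsExampleDomain DU DW U W Ω) (hy : y ∈ Ω) (a b c : Fin 4) :
    structFun (exCoframe P U W) a b c y
      = ∑ k, (exDer P U W a k y (fun i => exFrame P U W c i y) * exFrame P U W b k y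
        - exDer P U W a k y (fun i => exFrame P U W b i y) * exFrame P U W c k y) := by
  have h : ∀ b k, derivAlong (dualFrame (exCoframe P U W) b) (exCoef P U W a k) y
      = exDer P U W a k y (fun i => exFrame P U W b i y) := by
    intro b k
    rw [(hasDir_exCoef H.smooth_U H.isOpen_U H.smooth_W H.isOpen_W (H.mem_U y hy)
      (H.mem_W y hy) a k).derivAlong_eq]
    exact congrArg _ (funext fun i => dualFrame_exCoframe P U W b i y)
  rw [structFun_eq_coord H.isOpen hy H.smooth_coef (fun y _ a => theta_eq y a) H.smoothCoframeOn]
  simp only [h, dualFrame_exCoframe]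

/-- The function `J₄` of the explicit coframe. -/
def _root_.exJ (P : ℝ) (U W : ℝ → ℝ → ℝ) (y : E4) : ℝ :=
  2 * exF y - P * y 1 * exF y ^ 2 + (P * pd1 W (y 2) (y 3) - 6 * P ^ 2 * y 0
    + pd1 U (y 0) (y 2) - pd1 (pd1 U) (y 0) (y 2)) * exF y ^ 3

theorem structFun_two (H : IsExampleDomain DU DW U W Ω) (hy : y ∈ Ω) :
    structFun (exCoframe P U W) 2 0 1 y = 0 ∧ structFun (exCoframe P U W) 2 0 2 y = 0 ∧
    structFun (exCoframe P U W) 2 0 3 y = 0 ∧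
    structFun (exCoframe P U W) 2 1 2 y = - 2 * (exE y + P) ∧
    structFun (exCoframe P U W) 2 1 3 y = 0 ∧ structFun (exCoframe P U W) 2 2 3 y = 2 := by
  have h := exE_ne y
  refine ⟨?_, ?_, ?_, ?_, ?_, ?_⟩ <;>
    (rw [H.structFun_eq hy, Fin.sum_univ_four]
     simp [exDer, exFrame, exF_eq]) <;> field_simp
  ring

theorem structFun_one (H : IsExampleDomain DU DW U W Ω) (hy : y ∈ Ω) :
    structFun (exCoframe P U W) 1 0 1 y = 0 ∧ structFun (exCoframe P U W) 1 0 2 y = - 1 ∧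
    structFun (exCoframe P U W) 1 0 3 y = 0 ∧ structFun (exCoframe P U W) 1 1 2 y = - exF y ∧
    structFun (exCoframe P U W) 1 1 3 y = - 1 ∧ structFun (exCoframe P U W) 1 2 3 y = 0 := by
  have h := exE_ne y
  refine ⟨?_, ?_, ?_, ?_, ?_, ?_⟩ <;>
    (rw [H.structFun_eq hy, Fin.sum_univ_four]
     simp [exDer, exFrame, exB, exC3, exA1, exA4, exA3, exF_eq]) <;> field_simp <;> ring

end IsExampleDomain

end ExampleStruct

/-! ### Structure functions of the explicit coframe: the components of dθ¹ and dθ⁴. -/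

section ExampleStruct2

variable {P : ℝ} {DU DW : Set (ℝ × ℝ)} {U W : ℝ → ℝ → ℝ} {Ω : Set E4} {y : E4}

namespace IsExampleDomain

theorem structFun_three (H : IsExampleDomain DU DW U W Ω) (hy : y ∈ Ω) :
    structFun (exCoframe P U W) 3 0 1 y = 0 ∧ structFun (exCoframe P U W) 3 0 3 y = 0 ∧
    structFun (exCoframe P U W) 3 1 3 y = P := by
  have h := exE_ne y
  refine ⟨?_, ?_, ?_⟩ <;>
    (rw [H.structFun_eq hy, Fin.sum_univ_four]
     simp [exDer, exFrame, exF_eq]) <;> field_simp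

/-- `structFun _ 3 0 2` is not given a closed form: it cancels in the Koszul formula for Γ¹₁(∂₂),
and up to sign it is Γ¹₂(∂₁). -/
theorem structFun_zero_zero_one (H : IsExampleDomain DU DW U W Ω) (hy : y ∈ Ω) :
    structFun (exCoframe P U W) 0 0 1 y
      = - 2 * (exE y + P) - structFun (exCoframe P U W) 3 0 2 y := by
  have h := exE_ne y
  rw [H.structFun_eq hy, H.structFun_eq hy, Fin.sum_univ_four, Fin.sum_univ_four]
  simp [exDer, exFrame, exF_eq]
  field_simp
  ring

theorem structFun_zero_zero_two (H : IsExampleDomain DU DW U W Ω) (hy : y ∈ Ω) :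
    structFun (exCoframe P U W) 0 0 2 y = - exJ P U W y := by
  have h := exE_ne y
  rw [H.structFun_eq hy, Fin.sum_univ_four]
  simp [exDer, exFrame, exA1, exA3, exA4, exB, exC3, exJ, exF_eq]
  field_simp
  ring

theorem structFun_zero_zero_three (H : IsExampleDomain DU DW U W Ω) (hy : y ∈ Ω) :
    structFun (exCoframe P U W) 0 0 3 y = - 3 := by
  have h := exE_ne y
  rw [H.structFun_eq hy, Fin.sum_univ_four]
  simp [exDer, exFrame, exA4, exF_eq]
  field_simp
  ring

/-- As before, the common term `structFun _ 3 2 3` cancels in the Koszul formula, here for Γ²₂(∂₃),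
and need not be expanded. -/
theorem structFun_zero_one_three (H : IsExampleDomain DU DW U W Ω) (hy : y ∈ Ω) :
    structFun (exCoframe P U W) 0 1 3 y
      = - exF y - structFun (exCoframe P U W) 3 2 3 y := by
  have h := exE_ne y
  rw [H.structFun_eq hy, H.structFun_eq hy, Fin.sum_univ_four, Fin.sum_univ_four]
  simp [exDer, exFrame, exA1, exA4, exB, exC3, exF_eq]
  field_simp
  ring

theorem structFun_zero_two_three (H : IsExampleDomain DU DW U W Ω) (hy : y ∈ Ω) :
    structFun (exCoframe P U W) 0 2 3 y = 0 := by
  have h := exE_ne y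
  rw [H.structFun_eq hy, Fin.sum_univ_four]
  simp [exDer, exFrame, exA1, exA3, exA4, exB, exC3, exF_eq]
  field_simp
  ring

end IsExampleDomain

end ExampleStruct2

section ExampleConn

variable {P : ℝ} {DU DW : Set (ℝ × ℝ)} {U W : ℝ → ℝ → ℝ} {Ω : Set E4} {y : E4}

namespace IsExampleDomain

/-! ### The connection of the explicit coframe -/

theorem gammaCoef_eq (H : IsExampleDomain DU DW U W Ω) (hy : y ∈ Ω) :
    (∀ c, gammaCoef (exCoframe P U W) 0 3 c y = 0) ∧
    (∀ c, gammaCoef (exCoframe P U W) 3 0 c y = 0) ∧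
    (∀ c, gammaCoef (exCoframe P U W) 1 0 c y = ![0, 0, 1, 0] c) ∧
    (∀ c, gammaCoef (exCoframe P U W) 0 0 c y = ![0, 2 * (exE y + P), exJ P U W y, 3] c) ∧
    (∀ c, gammaCoef (exCoframe P U W) 1 1 c y = ![0, - P, exF y, 1] c) ∧
    gammaCoef (exCoframe P U W) 0 1 0 y = - structFun (exCoframe P U W) 3 0 2 y ∧
    gammaCoef (exCoframe P U W) 0 1 1 y = - structFun (exCoframe P U W) 3 1 2 y := by
  obtain ⟨a1, a2, a3, a4, a5, a6⟩ := H.structFun_two (P := P) hy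
  obtain ⟨b1, b2, b3, b4, b5, b6⟩ := H.structFun_one (P := P) hy
  obtain ⟨c1, c2, c3⟩ := H.structFun_three (P := P) hy
  have d1 := H.structFun_zero_zero_one (P := P) hy
  have d2 := H.structFun_zero_zero_two (P := P) hy
  have d3 := H.structFun_zero_zero_three (P := P) hy
  have d4 := H.structFun_zero_one_three (P := P) hy
  have d5 := H.structFun_zero_two_three (P := P) hy
  have s := fun a b c => structFun_swap (exCoframe P U W) a b c y
  have z : ∀ a b, structFun (exCoframe P U W) a b b y = 0 := fun a b => by linarith [s a b b]
  have s1 := fun a => s a 1 0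
  have s2 := fun a => s a 2 0
  have s3 := fun a => s a 3 0
  have s4 := fun a => s a 2 1
  have s5 := fun a => s a 3 1
  have s6 := fun a => s a 3 2
  refine ⟨fun c => ?_, fun c => ?_, fun c => ?_, fun c => ?_, fun c => ?_, ?_, ?_⟩
  iterate 5
    · fin_cases c <;>
      simp [gammaCoef, flip4, z, s1, s2, s3, s4, s5, s6, a1, a2, a3, a4, a5, a6, b1, b2, b3, b4,
        b5, b6, c1, c2, c3, d1, d2, d3, d4, d5] <;> ring
  · simp [gammaCoef, flip4, s2, a4, d1]
    ring
  · simp [gammaCoef, flip4, z, s4]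

theorem isKahlerFrameOn (H : IsExampleDomain DU DW U W Ω) :
    IsKahlerFrameOn Ω (exCoframe P U W) where
  toIsFrameOn := H.isFrameOn
  gamma_zero_three _ hx := (H.gammaCoef_eq hx).1
  gamma_three_zero _ hx := (H.gammaCoef_eq hx).2.1

theorem reducedConnection (H : IsExampleDomain DU DW U W Ω) :
    ReducedConnection Ω (exCoframe P U W) (fun _ => 0) (fun _ => 1)
      (fun y => 2 * (exE y + P)) (exJ P U W) exF (fun _ => - P) := by
  intro y hy
  obtain ⟨-, -, g10, g00, g11, -⟩ := H.gammaCoef_eq (P := P) hy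
  refine ⟨?_, ?_, ?_⟩
  · simp [Gam, Fin.sum_univ_four, g10]
  · simp [Gam, Fin.sum_univ_four, g00]
  · simp [Gam, Fin.sum_univ_four, g11]
    module

/-! ### The curvature of the explicit coframe -/

theorem derivAlong_exF (b : Fin 4) (y : E4) : derivAlong (dualFrame (exCoframe P U W) b) exF y
    = -(exFrame P U W b 3 y / 2 * exF y) := by
  rw [hasDir_exF.derivAlong_eq, ← dualFrame_exCoframe]
  rfl

theorem hasDir_exJ (H : IsExampleDomain DU DW U W Ω) (hy : y ∈ Ω) (v : E4) :
    HasDir y v (exJ P U W) (- v 3 * exF y - P * (v 1 - y 1 * v 3) * exF y ^ 2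
      + (P * (v 2 * pd1 (pd1 W) (y 2) (y 3) + v 3 * pd2 (pd1 W) (y 2) (y 3)) - 6 * P ^ 2 * v 0
        + (v 0 * pd1 (pd1 U) (y 0) (y 2) + v 2 * pd2 (pd1 U) (y 0) (y 2))
        - (v 0 * pd1 (pd1 (pd1 U)) (y 0) (y 2) + v 2 * pd2 (pd1 (pd1 U)) (y 0) (y 2))
        - 3 / 2 * v 3 * (P * pd1 W (y 2) (y 3) - 6 * P ^ 2 * y 0 + pd1 U (y 0) (y 2)
          - pd1 (pd1 U) (y 0) (y 2))) * exF y ^ 3) := by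
  have hF := hasDir_exF (y := y) (v := v)
  have hU := H.smooth_U.pd1 H.isOpen_U
  have d1 := hU.hasDir (v := v) H.isOpen_U (H.mem_U y hy)
  have d2 := (hU.pd1 H.isOpen_U).hasDir (v := v) H.isOpen_U (H.mem_U y hy)
  have e1 := (H.smooth_W.pd1 H.isOpen_W).hasDir (v := v) H.isOpen_W (H.mem_W y hy)
  have c0 := fun c : ℝ => HasDir.const (x := y) (v := v) c
  refine HasDir.of_eq ((((c0 2).mul hF).sub (((c0 P).mul (HasDir.coord y v 1)).mul
    (hF.pow 2))).add ((((((c0 P).mul e1).sub ((c0 (6 * P ^ 2)).mul (HasDir.coord y v 0))).add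
      d1).sub d2).mul (hF.pow 3))) ?_
  simp
  ring

end IsExampleDomain

end ExampleConn

/-! ### Curvature components of the explicit coframe. -/

section ExampleCurv

variable {P : ℝ} {DU DW : Set (ℝ × ℝ)} {U W : ℝ → ℝ → ℝ} {Ω : Set E4} {y : E4}

namespace IsExampleDomain

/-- The function `exJ` is the θ³ coefficient of Γ¹₁, and these derivatives enter the components of
Ω¹₁ on (∂₁, ∂₃) and (∂₂, ∂₃). They are written through the structure functions that equal −Γ¹₂(∂₁)
and −Γ¹₂(∂₂), so that these cancel in the curvature without being expanded. -/
theorem derivAlong_exJ (H : IsExampleDomain DU DW U W Ω) (hy : y ∈ Ω) :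
    derivAlong (dualFrame (exCoframe P U W) 0) (exJ P U W) y
      = 4 * structFun (exCoframe P U W) 3 0 2 y - 2 * exE y - 4 * P ∧
    derivAlong (dualFrame (exCoframe P U W) 1) (exJ P U W) y
      = 4 * structFun (exCoframe P U W) 3 1 2 y + exFrame P U W 2 3 y * exE y - 1
        - 2 * (exE y + P) * (exF y + exJ P U W y) := by
  have h := exE_ne y
  have d : ∀ b k, WithLp.ofLp (p := 2) (V := Fin 4 → ℝ) (dualFrame (exCoframe P U W) b y) k
      = exFrame P U W b k y := fun b k => dualFrame_exCoframe P U W b k y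
  refine ⟨?_, ?_⟩ <;>
  rw [(H.hasDir_exJ hy _).derivAlong_eq, H.structFun_eq hy, Fin.sum_univ_four, d, d, d, d]
  · simp [exDer, exFrame, exF_eq]
    field_simp
    ring
  · simp [exDer, exFrame, exA1, exA4, exB, exC3, exJ, exF_eq]
    field_simp
    ring

/-- By the curvature symmetries these components determine the Ricci tensor and Ψ₀, …, Ψ₃. The form
Ω¹₂ is avoided: all of its information except Ψ₄ occurs in the other forms, so Γ¹₂ is never
differentiated. -/
theorem riem_one (H : IsExampleDomain DU DW U W Ω) (hy : y ∈ Ω) :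
    riem (exCoframe P U W) 1 0 0 2 y = 0 ∧ riem (exCoframe P U W) 1 0 0 3 y = 0 ∧
    riem (exCoframe P U W) 1 0 1 2 y = - P ∧ riem (exCoframe P U W) 1 0 1 3 y = 0 ∧
    riem (exCoframe P U W) 1 1 1 2 y = 1 ∧ riem (exCoframe P U W) 1 1 1 3 y = - 2 * P ∧
    riem (exCoframe P U W) 0 0 0 2 y = - 2 * P ∧ riem (exCoframe P U W) 0 0 1 2 y = - 1 := by
  obtain ⟨a1, a2, a3, a4, a5, a6⟩ := H.structFun_two (P := P) hy
  obtain ⟨b1, b2, b3, b4, b5, b6⟩ := H.structFun_one (P := P) hy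
  obtain ⟨c1, c2, c3⟩ := H.structFun_three (P := P) hy
  obtain ⟨j1, j2⟩ := H.derivAlong_exJ (P := P) hy
  obtain ⟨g03, g30, g10, g00, g11, k1, k2⟩ := H.gammaCoef_eq (P := P) hy
  have l := fun c => gammaCoef_lower (exCoframe P U W) c y
  have d10 : ∀ b c, derivAlong (dualFrame (exCoframe P U W) b) (gammaCoef (exCoframe P U W) 1 0 c) y
      = 0 := fun b c => by
    rw [derivAlong_congr H.isOpen hy fun z hz => (H.gammaCoef_eq hz).2.2.1 c, derivAlong_const]
  have d00 := fun b c => derivAlong_congr (X := dualFrame (exCoframe P U W) b) H.isOpen hy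
    fun z hz => (H.gammaCoef_eq (P := P) hz).2.2.2.1 c
  have d11 := fun b c => derivAlong_congr (X := dualFrame (exCoframe P U W) b) H.isOpen hy
    fun z hz => (H.gammaCoef_eq (P := P) hz).2.2.2.2.1 c
  have dE : ∀ b, derivAlong (dualFrame (exCoframe P U W) b) (fun z => 2 * (exE z + P)) y
      = exFrame P U W b 3 y * exE y := fun b => by
    have h1 : ∀ v, HasDir y v (fun z => 2 * (exE z + P)) (v 3 * exE y) := fun v =>
      ((HasDir.const 2).mul (hasDir_exE.add (HasDir.const P))).of_eq (by ring)
    rw [(h1 _).derivAlong_eq, ← dualFrame_exCoframe]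
    rfl
  have hEF : exF y * exE y = 1 := by rw [exF_eq, inv_mul_cancel₀ (exE_ne y)]
  have f13 : exFrame P U W 1 3 y = 2 * (P + exE y) := by simp [exFrame]
  simp only [IsFrameOn.riem_eq, Fin.sum_univ_four, d10, d00, d11, (l _).2.2.2.2.1,
    (l _).2.2.2.2.2.1, (l _).2.2.2.2.2.2.1, (l _).2.2.2.2.2.2.2.1, (l _).2.2.2.2.2.2.2.2.1, g03, g30, g10, g00,
    g11, a2, a3, a4, a5, b2, b3, b4, b5, c2, c3, k1, k2, Matrix.cons_val, derivAlong_const, j1,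
    j2, dE, derivAlong_exF, f13]
  refine ⟨?_, ?_, ?_, ?_, ?_, ?_, ?_, ?_⟩
  · ring
  · ring
  · ring
  · ring
  · linear_combination hEF
  · ring
  · ring
  · ring

end IsExampleDomain

end ExampleCurv

/-! ### The explicit coframe is para-Kähler-Einstein of Petrov type III with J₂ = 1. -/

section ExampleMain

variable {P : ℝ} {DU DW : Set (ℝ × ℝ)} {U W : ℝ → ℝ → ℝ} {Ω : Set E4} {y : E4}

namespace IsExampleDomain

theorem scal_eq (H : IsExampleDomain DU DW U W Ω) (hy : y ∈ Ω) :
    scal (exCoframe P U W) y = - 12 * P ∧ IsEinsteinAt (exCoframe P U W) y := by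
  obtain ⟨r1, r2, r3, r4, r5, r6, r7, r8⟩ := H.riem_one (P := P) hy
  obtain ⟨-, -, -, e1, -, e3, -, e5, -, e7⟩ := (H.isKahlerFrameOn (P := P)).riem_symm hy
  obtain ⟨h02, h03, h12, h13, hs, h00, h01, h11, h22, h23, h33⟩ :=
    (H.isKahlerFrameOn (P := P)).ricci_eq hy
  have k02 : ricci (exCoframe P U W) 0 2 y = - 3 * P := by linarith
  have k03 : ricci (exCoframe P U W) 0 3 y = 0 := by linarith
  have k12 : ricci (exCoframe P U W) 1 2 y = 0 := by linarith
  have k13 : ricci (exCoframe P U W) 1 3 y = - 3 * P := by linarith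
  have hscal : scal (exCoframe P U W) y = - 12 * P := by
    simp [scal, eta, Fin.sum_univ_four, k02, k13, hs 2 0, hs 3 1]
    ring
  refine ⟨hscal, fun a b => ?_⟩
  rw [hscal]
  fin_cases a <;> fin_cases b <;>
    simp [eta, k02, k03, k12, k13, h00, h01, h11, h22, h23, h33, hs 1 0, hs 2 0, hs 3 0, hs 2 1,
      hs 3 1, hs 3 2] <;> ring

theorem psi2'_eq (H : IsExampleDomain DU DW U W Ω) (hy : y ∈ Ω) :
    psi2' (exCoframe P U W) y = P := by
  obtain ⟨h, hE⟩ := H.scal_eq (P := P) hy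
  rw [H.isKahlerFrameOn.psi2'_eq hy hE, h]
  ring

theorem psi_eq (H : IsExampleDomain DU DW U W Ω) (hy : y ∈ Ω) :
    psi0 (exCoframe P U W) y = 0 ∧ psi1 (exCoframe P U W) y = 0 ∧
    psi2 (exCoframe P U W) y = 0 ∧ psi3 (exCoframe P U W) y = 1 := by
  obtain ⟨r1, r2, r3, r4, r5, -⟩ := H.riem_one (P := P) hy
  obtain ⟨-, -, ⟨e1, e2, e3, -⟩, -, -, e4, -⟩ :=
    H.isKahlerFrameOn.riem_eq_psi hy (H.scal_eq (P := P) hy).2 (H.psi2'_eq hy)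
  refine ⟨?_, ?_, ?_, ?_⟩ <;> linarith

theorem isPKE (H : IsExampleDomain DU DW U W Ω) (hP : P ≠ 0) :
    IsPKE Ω (metricOf (exCoframe P U W)) (endoOf (exCoframe P U W)) P :=
  H.isKahlerFrameOn.isPKE (fun _ hy => (H.scal_eq hy).2) (fun _ hy => H.psi2'_eq hy) hP

theorem isTripleRootAdaptedOn (H : IsExampleDomain DU DW U W Ω) :
    IsTripleRootAdaptedOn (metricOf (exCoframe P U W)) (endoOf (exCoframe P U W)) Ω
      (exCoframe P U W) :=
  ⟨⟨H.smoothCoframeOn, fun y _ => isAdaptedAt_of _ y⟩, fun y hy => by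
    obtain ⟨h0, h1, h2, h3⟩ := H.psi_eq (P := P) hy
    exact ⟨h0, h1, h2, by rw [h3]; exact one_ne_zero⟩⟩

theorem Jtwo_eq (H : IsExampleDomain DU DW U W Ω) (hy : y ∈ Ω) :
    Jtwo (exCoframe P U W) y = 1 := (H.gammaCoef_eq hy).2.2.1 2

end IsExampleDomain

theorem isExampleDomain (hDU : IsOpen DU) (hDW : IsOpen DW) (hU : SmoothTwo U DU)
    (hW : SmoothTwo W DW) :
    IsExampleDomain DU DW U W {y : E4 | (y 0, y 2) ∈ DU ∧ (y 2, y 3) ∈ DW} where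
  isOpen_U := hDU
  isOpen_W := hDW
  smooth_U := hU
  smooth_W := hW
  isOpen := (hDU.preimage (by fun_prop : Continuous fun y : E4 => (y 0, y 2))).inter
    (hDW.preimage (by fun_prop : Continuous fun y : E4 => (y 2, y 3)))
  mem_U _ hy := hy.1
  mem_W _ hy := hy.2

end ExampleMain

/-! ### The proposition. -/

theorem mainTheorem8 :
    -- the reduction, for a pKE structure of Petrov type III with nonvanishing `J₂` on an open
    -- subset `S` (possibly everything) of a smooth `4`-manifold `M`
    (∀ (M : Type*) [TopologicalSpace M] [ChartedSpace E4 M] [IsManifold 𝓘(ℝ, E4) ∞ M]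
      (S : Set M)
      (g : (x : M) → TangentSpace 𝓘(ℝ, E4) x →L[ℝ] TangentSpace 𝓘(ℝ, E4) x →L[ℝ] ℝ)
      (K : (x : M) → TangentSpace 𝓘(ℝ, E4) x →L[ℝ] TangentSpace 𝓘(ℝ, E4) x)
      (P : ℝ),
      IsOpen S → IsPKE S g K P → IsPetrovIII S g K → JtwoNonvanishing S g K →
      ∀ c₃ c₂ : ℝ, c₃ ≠ 0 → c₂ ≠ 0 →
        IsShearLineBundle S (normalizedFibre S g K c₃ c₂) ∧
        ∀ U : Set M, IsOpen U → U ⊆ S → ∀ u : (x : M) → Coframe x,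
          SmoothCoframeOn u U → (∀ x ∈ U, u x ∈ normalizedFibre S g K c₃ c₂ x) →
          (∀ x ∈ U, psi3 u x = c₃ ∧ Jtwo u x = c₂) ∧
          StructureEquations U u (Gam u 0 0) (Gam u 0 1) (Gam u 1 0) (Gam u 1 1)
            (fun _ => P) 0 0 0 (fun _ => c₃) (psi4 u) ∧
          ∃ J1 J3 J4 J5 J6 : M → ℝ,
            SmoothFunOn J1 U ∧ SmoothFunOn J3 U ∧ SmoothFunOn J4 U ∧ SmoothFunOn J5 U ∧
            SmoothFunOn J6 U ∧
            ReducedConnection U u J1 (fun _ => c₂) J3 J4 J5 J6) ∧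
    -- the examples
    (∀ (P : ℝ), P ≠ 0 → ∀ (DU DW : Set (ℝ × ℝ)) (U W : ℝ → ℝ → ℝ), IsOpen DU → IsOpen DW →
      ContDiffOn ℝ ∞ (fun p : ℝ × ℝ => U p.1 p.2) DU →
      ContDiffOn ℝ ∞ (fun p : ℝ × ℝ => W p.1 p.2) DW →
      ∀ Ω : Set E4, Ω = {y : E4 | (y 0, y 2) ∈ DU ∧ (y 2, y 3) ∈ DW} →
      ∃ (g : (y : E4) → TangentSpace 𝓘(ℝ, E4) y →L[ℝ] TangentSpace 𝓘(ℝ, E4) y →L[ℝ] ℝ)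
        (K : (y : E4) → TangentSpace 𝓘(ℝ, E4) y →L[ℝ] TangentSpace 𝓘(ℝ, E4) y)
        (u : (y : E4) → Coframe y),
        (∀ y ∈ Ω, ∀ v : E4, u y v = exampleForms P U W y v) ∧
        IsAdaptedOn g K Ω u ∧
        IsPKE Ω g K P ∧ IsPetrovIII Ω g K ∧ JtwoNonvanishing Ω g K ∧
        (∀ y ∈ Ω, psi0 u y = 0 ∧ psi1 u y = 0 ∧ psi2 u y = 0 ∧ psi3 u y = 1) ∧
        ∃ J3 J4 J5 : E4 → ℝ,
          ReducedConnection Ω u (fun _ => 0) (fun _ => 1) J3 J4 J5 (fun _ => - P)) := by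
  refine ⟨fun M _ _ _ S g K P hS H h3 hJ c₃ c₂ h₃ h₂ => H.reduction h3 hJ hS h₃ h₂, ?_⟩
  rintro P hP DU DW U W hDU hDW hU hW Ω rfl
  have H := isExampleDomain hDU hDW hU hW
  have hu := H.isTripleRootAdaptedOn (P := P)
  refine ⟨metricOf (exCoframe P U W), endoOf (exCoframe P U W), exCoframe P U W,
    fun y _ v => exCoframe_eq_exampleForms P U W y v, hu.1, H.isPKE hP, (H.isPKE hP).isPetrovIII hu,
    (H.isPKE hP).jtwoNonvanishing hu fun y hy => ?_, fun y hy => H.psi_eq hy,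
    _, _, _, H.reducedConnection⟩
  rw [H.Jtwo_eq hy]
  exact one_ne_zero
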